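/- For $s\in\mathbb{R}$ let $L^2_s(\mathbb{R},\mathbb{C})$ be the weighted space with norm $\|u\|_{L^2_s}=\|\langle x\rangle^s u\|_{L^2}$, $\langle x\rangle=(1+x^2)^{1/2}$. Let $N=3$, let $\Omega=\mathbb{C}_+=\{z\in\mathbb{C}:\ \mathrm{Im}\,z>0\}$, $z_0=0$, and let $A=(-\mathrm{i}\partial_x)^N$ in $L^2(\mathbb{R},\mathbb{C})$ with domain $H^N(\mathbb{R},\mathbb{C})$. Let $s,s'>N-3/2$, so that $L^2_s\hookrightarrow L^2\hookrightarrow L^2_{-s'}$, and let $\hat A$ be the closure of $A$ as an operator in $L^2_{-s'}$. Let $B$ be a (possibly unbounded) linear operator from $L^2_{-s'}$ to $L^2_s$ which is $\hat A$-compact: $B$ is defined on $\mathfrak{D}(\hat A)$, and $\{Bu:\ u\in\mathfrak{D}(\hat A),\ \|u\|_{L^2_{-s'}}+\|\hat A u\|_{L^2_{-s'}}\le 1\}$ is precompact in $L^2_s$. An operator $H$ in $L^2$ is said to satisfy the limiting absorption principle at $z_0$ relative to $(\Omega,L^2_s,L^2_{-s'})$ if for some $\delta>0$ all $z\in\Omega$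 with $|z-z_0|<\delta$ are in the resolvent set of $H$ and $(H-z)^{-1}$, as a map $L^2_s\to L^2_{-s'}$, converges in the weak operator topology as $z\to z_0$, $z\in\Omega$; the limit is denoted by $(H-z_0)^{-1}_{\Omega}\in\mathscr{B}(L^2_s,L^2_{-s'})$. A virtual state of $A+B$ at $z_0$ is a nonzero $\Psi\in L^2_{-s'}$ such that $\Psi\in\mathfrak{D}(\hat A)$, $(\hat A+B-z_0)\Psi=0$, and $\Psi$ is in the range of $(A+B+C-z_0)^{-1}_{\Omega}$ for some bounded finite rank operator $C:L^2_{-s'}\to L^2_s$ such that $A+B+C$ satisfies the limiting absorption principle at $z_0$. Theorem. Exactly one of the following holds: 1. $A+B$ satisfies the limiting absorption principle at $z_0=0$ relative to $(\Omega,L^2_s,L^2_{-s'})$, and moreover $(A+B-z)^{-1}$ converges in the uniform operator topology of $\mathscr{B}(L^2_s,L^2_{-s'})$ as $z\to 0$, $z\in\Omega$; 2. $A+B$ does not satisfy this limiting absorption principle, and there is a virtual state $\Psi\in L^2_{-s'}$ of $A+B$ at $z_0=0$. (There is no virtual state in case 1.) -/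

import Mathlib

open MeasureTheory Topology Filter
open scoped SchwartzMap LineDeriv ENNReal

noncomputable section

/-! ## Unbounded operators, resolvents, virtual levels -/

namespace VirtualLevels

section Abstract

variable {E X F : Type*}
  [NormedAddCommGroup E] [NormedSpace ℂ E]
  [NormedAddCommGroup X] [NormedSpace ℂ X]
  [NormedAddCommGroup F] [NormedSpace ℂ F]

/-- `R` is the bounded two-sided inverse of `A - z`: it maps `X` into the domain of `A`,
`(A - z) R x = x` for all `x ∈ X`, and `R (A - z) u = u` for all `u` in the domain of `A`. -/
def IsResolventAt (A : X →ₗ.[ℂ] X) (z : ℂ) (R : X →L[ℂ] X) : Prop :=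
  (∀ x : X, ∃ h : R x ∈ A.domain, A ⟨R x, h⟩ - z • R x = x) ∧
    ∀ u : A.domain, R (A u - z • (u : X)) = u

/-- The resolvent set of an unbounded operator (the complement of its spectrum). -/
def resolventSet (A : X →ₗ.[ℂ] X) : Set ℂ := {z | ∃ R : X →L[ℂ] X, IsResolventAt A z R}

open Classical in
/-- The resolvent `(A - z)⁻¹` for `z` in the resolvent set (and `0` elsewhere). -/
def resolventOp (A : X →ₗ.[ℂ] X) (z : ℂ) : X →L[ℂ] X :=
  if h : ∃ R : X →L[ℂ] X, IsResolventAt A z R then h.choose else 0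

/-- On the resolvent set, `resolventOp` is the inverse of `A - z`. -/
theorem isResolventAt_resolventOp {A : X →ₗ.[ℂ] X} {z : ℂ} (hz : z ∈ resolventSet A) :
    IsResolventAt A z (resolventOp A z) := by
  have h : ∃ R : X →L[ℂ] X, IsResolventAt A z R := hz
  rw [resolventOp, dif_pos h]
  exact h.choose_spec

/-- `B`, from `F` to `E`, is compact relative to an operator `S` in `F`: it is defined on the
domain of `S`, and the image of the unit ball `‖u‖ + ‖S u‖ ≤ 1` is precompact in `E`. -/
def IsRelativelyCompact (S : F →ₗ.[ℂ] F) (B : F →ₗ.[ℂ] E) : Prop :=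
  S.domain ≤ B.domain ∧
    IsCompact (closure {e : E | ∃ (u : F) (hS : u ∈ S.domain) (hB : u ∈ B.domain),
      ‖u‖ + ‖S ⟨u, hS⟩‖ ≤ 1 ∧ B ⟨u, hB⟩ = e})

variable (E X F) in
/-- A triple of spaces with continuous embeddings `E ↪ X ↪ F`. -/
structure EmbeddedTriple where
  /-- the embedding `E ↪ X` -/
  emb₁ : E →L[ℂ] X
  /-- the embedding `X ↪ F` -/
  emb₂ : X →L[ℂ] F
  emb₁_injective : Function.Injective emb₁
  emb₂_injective : Function.Injective emb₂

namespace EmbeddedTriple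

variable (T : EmbeddedTriple E X F)

/-- `A` regarded as an operator in `F`: its domain is the image of the domain of `A`, and it
sends the image of `u` to the image of `A u`. -/
def pushforward (A : X →ₗ.[ℂ] X) : F →ₗ.[ℂ] F where
  domain := A.domain.map (T.emb₂ : X →ₗ[ℂ] F)
  toFun := (T.emb₂ : X →ₗ[ℂ] F) ∘ₗ A.toFun ∘ₗ
    ((A.domain.equivMapOfInjective (T.emb₂ : X →ₗ[ℂ] F) T.emb₂_injective).symm : _ →ₗ[ℂ] A.domain)

/-- The extension `Â` of `A` onto `F`: the closure in `F` of the operator `pushforward A`. -/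
def extension (A : X →ₗ.[ℂ] X) : F →ₗ.[ℂ] F := (T.pushforward A).closure

/-- A (possibly unbounded) operator `B` from `F` to `E`, regarded as an operator in `X`. -/
def perturbX (B : F →ₗ.[ℂ] E) : X →ₗ.[ℂ] X where
  domain := B.domain.comap (T.emb₂ : X →ₗ[ℂ] F)
  toFun := (T.emb₁ : E →ₗ[ℂ] X) ∘ₗ B.toFun ∘ₗ (T.emb₂ : X →ₗ[ℂ] F).submoduleComap B.domain

/-- A (possibly unbounded) operator `B` from `F` to `E`, regarded as an operator in `F`. -/
def perturbF (B : F →ₗ.[ℂ] E) : F →ₗ.[ℂ] F :=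
  ((T.emb₂ ∘L T.emb₁ : E →L[ℂ] F) : E →ₗ[ℂ] F).compPMap B

/-- The resolvent at `z` as a bounded map from `E` to `F`. -/
def resolventEF (A : X →ₗ.[ℂ] X) (z : ℂ) : E →L[ℂ] F :=
  T.emb₂ ∘L resolventOp A z ∘L T.emb₁

/-- Near `z₀` the set `Ω` is contained in the resolvent set of `A`, and the resolvent, as a map
from `E` to `F`, converges to `L` in the weak operator topology as `z → z₀`, `z ∈ Ω`. -/
def HasWeakResolventLimit (A : X →ₗ.[ℂ] X) (Ω : Set ℂ) (z₀ : ℂ) (L : E →L[ℂ] F) : Prop :=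
  (∃ δ : ℝ, 0 < δ ∧ Ω ∩ Metric.ball z₀ δ ⊆ resolventSet A) ∧
    ∀ (e : E) (φ : F →L[ℂ] ℂ),
      Tendsto (fun z => φ (T.resolventEF A z e)) (𝓝[Ω] z₀) (𝓝 (φ (L e)))

/-- The resolvent of `A` satisfies the limiting absorption principle at `z₀` relative to
`(Ω, E, F)`. -/
def SatisfiesLAP (A : X →ₗ.[ℂ] X) (Ω : Set ℂ) (z₀ : ℂ) : Prop :=
  ∃ L : E →L[ℂ] F, T.HasWeakResolventLimit A Ω z₀ L

/-- The resolvent of `A`, as a map from `E` to `F`, converges in the uniform operator topology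
(the norm topology of the bounded operators from `E` to `F`) as `z → z₀`, `z ∈ Ω`. -/
def ResolventConvergesUniformly (A : X →ₗ.[ℂ] X) (Ω : Set ℂ) (z₀ : ℂ) : Prop :=
  ∃ L : E →L[ℂ] F, Tendsto (fun z => T.resolventEF A z) (𝓝[Ω] z₀) (𝓝 L)

/-- `Ψ ∈ F` is a virtual state of `A + B` at `z₀` relative to `(Ω, E, F)`: it is nonzero,
`(Â + B - z₀) Ψ = 0`, and `Ψ` is in the range of the limit resolvent
`(A + B + C - z₀)⁻¹ : E → F` for a finite rank operator `C : F → E` such that this limit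
exists. -/
def IsVirtualState (A : X →ₗ.[ℂ] X) (B : F →ₗ.[ℂ] E) (Ω : Set ℂ) (z₀ : ℂ) (Ψ : F) : Prop :=
  Ψ ≠ 0 ∧
  (∃ h : Ψ ∈ (T.extension A + T.perturbF B).domain,
    (T.extension A + T.perturbF B) ⟨Ψ, h⟩ - z₀ • Ψ = 0) ∧
  ∃ C : F →L[ℂ] E, FiniteDimensional ℂ (LinearMap.range (C : F →ₗ[ℂ] E)) ∧
    ∃ L : E →L[ℂ] F,
      T.HasWeakResolventLimit (A + T.perturbX (B + (C : F →ₗ[ℂ] E).toPMap ⊤)) Ω z₀ L ∧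
      Ψ ∈ Set.range L

end EmbeddedTriple

end Abstract

/-! ## Weighted spaces -/

/-- The measure `⟨x⟩^(2s) dx` on the line, where `⟨x⟩ = (1 + x²)^(1/2)`. -/
def weightedMeasure (s : ℝ) : Measure ℝ :=
  volume.withDensity fun x => ENNReal.ofReal ((1 + x ^ 2) ^ s)

/-- The weighted space `L²_s(ℝ, ℂ)`, with `‖u‖² = ∫ ⟨x⟩^(2s) |u(x)|² dx`. -/
abbrev WeightedL2 (s : ℝ) : Type := Lp ℂ 2 (weightedMeasure s)

theorem volume_le_weightedMeasure {s : ℝ} (hs : 0 ≤ s) : volume ≤ weightedMeasure s := by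
  conv_lhs => rw [← withDensity_one (μ := (volume : Measure ℝ))]
  refine withDensity_mono (Eventually.of_forall fun x => ?_)
  simp only [Pi.one_apply, ENNReal.one_le_ofReal]
  exact Real.one_le_rpow (by nlinarith [sq_nonneg x]) hs

theorem weightedMeasure_le_volume {s : ℝ} (hs : s ≤ 0) : weightedMeasure s ≤ volume := by
  conv_rhs => rw [← withDensity_one (μ := (volume : Measure ℝ))]
  refine withDensity_mono (Eventually.of_forall fun x => ?_)
  simp only [Pi.one_apply, ENNReal.ofReal_le_one]
  exact Real.rpow_le_one_of_one_le_of_nonpos (by nlinarith [sq_nonneg x]) hs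

theorem volume_absolutelyContinuous_weightedMeasure (s : ℝ) :
    (volume : Measure ℝ) ≪ weightedMeasure s := by
  refine withDensity_absolutelyContinuous' (by fun_prop) (Eventually.of_forall fun x => ?_)
  have : (0 : ℝ) < (1 + x ^ 2) ^ s := Real.rpow_pos_of_pos (by positivity) s
  simpa using this

/-- For `μ ≤ ν`, the map from `L²(ν)` to `L²(μ)` which sends (the class of) a function to (the
class of) the same function. -/
def lpInclusion {μ ν : Measure ℝ} (h : μ ≤ ν) : Lp ℂ 2 ν →L[ℂ] Lp ℂ 2 μ :=
  LinearMap.mkContinuous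
    { toFun := fun f => ((Lp.memLp f).mono_measure h).toLp f
      map_add' := fun f g => by
        rw [← MemLp.toLp_add, MemLp.toLp_eq_toLp_iff]
        exact (Measure.absolutelyContinuous_of_le h).ae_le (Lp.coeFn_add f g)
      map_smul' := fun c f => by
        rw [RingHom.id_apply, ← MemLp.toLp_const_smul, MemLp.toLp_eq_toLp_iff]
        exact (Measure.absolutelyContinuous_of_le h).ae_le (Lp.coeFn_smul c f) }
    1 fun f => by
      rw [one_mul, LinearMap.coe_mk, AddHom.coe_mk, Lp.norm_toLp, Lp.norm_def]
      exact ENNReal.toReal_mono (Lp.eLpNorm_ne_top f) (eLpNorm_mono_measure _ h)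

theorem lpInclusion_coeFn {μ ν : Measure ℝ} (h : μ ≤ ν) (f : Lp ℂ 2 ν) :
    lpInclusion h f =ᵐ[μ] f :=
  MemLp.coeFn_toLp ((Lp.memLp f).mono_measure h)

theorem lpInclusion_injective {μ ν : Measure ℝ} (h : μ ≤ ν) (h' : ν ≪ μ) :
    Function.Injective (lpInclusion h) := by
  intro f g hfg
  refine Lp.ext (h'.ae_le ?_)
  have hf := lpInclusion_coeFn h f
  rw [hfg] at hf
  exact hf.symm.trans (lpInclusion_coeFn h g)

/-- The triple `L²_s(ℝ, ℂ) ↪ L²(ℝ, ℂ) ↪ L²_{-s'}(ℝ, ℂ)`, for `s, s' ≥ 0`. -/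
def weightedTriple (s s' : ℝ) (hs : 0 ≤ s) (hs' : 0 ≤ s') :
    EmbeddedTriple (WeightedL2 s) (Lp ℂ 2 (volume : Measure ℝ)) (WeightedL2 (-s')) where
  emb₁ := lpInclusion (volume_le_weightedMeasure hs)
  emb₂ := lpInclusion (weightedMeasure_le_volume (neg_nonpos.mpr hs'))
  emb₁_injective := lpInclusion_injective _ (withDensity_absolutelyContinuous _ _)
  emb₂_injective := lpInclusion_injective _ (volume_absolutelyContinuous_weightedMeasure _)

/-! ## The operator `(-i∂ₓ)^N` -/

/-- The operator `-i∂ₓ` on tempered distributions on the line. -/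
def momentum : 𝓢'(ℝ, ℂ) →ₗ[ℂ] 𝓢'(ℝ, ℂ) :=
  (-Complex.I) • (LineDeriv.lineDerivOpCLM ℂ 𝓢'(ℝ, ℂ) (1 : ℝ) : 𝓢'(ℝ, ℂ) →ₗ[ℂ] 𝓢'(ℝ, ℂ))

theorem momentum_apply (f : 𝓢'(ℝ, ℂ)) : momentum f = (-Complex.I) • ∂_{(1 : ℝ)} f := rfl

theorem momentum_eq_deriv (f : 𝓢'(ℝ, ℂ)) :
    momentum f = (-Complex.I) • TemperedDistribution.derivCLM ℂ f := by
  rw [momentum_apply]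
  rfl

theorem memSobolev_momentum {s : ℝ} {f : 𝓢'(ℝ, ℂ)}
    (hf : TemperedDistribution.MemSobolev s 2 f) :
    TemperedDistribution.MemSobolev (s - 1) 2 (momentum f) :=
  (hf.lineDerivOp (m := (1 : ℝ))).smul (-Complex.I)

theorem memSobolev_momentum_pow {s : ℝ} {f : 𝓢'(ℝ, ℂ)}
    (hf : TemperedDistribution.MemSobolev s 2 f) (N : ℕ) :
    TemperedDistribution.MemSobolev (s - N) 2 ((momentum ^ N) f) := by
  induction N with
  | zero => simpa using hf
  | succ n ih =>
    rw [pow_succ', Module.End.mul_apply]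
    have := memSobolev_momentum ih
    rwa [sub_sub, ← Nat.cast_succ] at this

theorem exists_momentum_pow {N : ℕ} {f : 𝓢'(ℝ, ℂ)}
    (hf : TemperedDistribution.MemSobolev N 2 f) :
    ∃ v : Lp ℂ 2 (volume : Measure ℝ), (momentum ^ N) f = (v : 𝓢'(ℝ, ℂ)) := by
  have := memSobolev_momentum_pow hf N
  rwa [sub_self, TemperedDistribution.memSobolev_zero_iff] at this

theorem toTemperedDistributionCLM_injective : Function.Injective
    (Lp.toTemperedDistributionCLM ℂ (volume : Measure ℝ) 2) :=
  LinearMap.ker_eq_bot.mp Lp.ker_toTemperedDistributionCLM_eq_bot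

/-- The Sobolev space `H^N(ℝ, ℂ)` as a subspace of `L²(ℝ, ℂ)`. -/
def sobolevSpace (N : ℕ) : Submodule ℂ (Lp ℂ 2 (volume : Measure ℝ)) where
  carrier := {u | TemperedDistribution.MemSobolev N 2 (u : 𝓢'(ℝ, ℂ))}
  add_mem' := fun {u v} hu hv => by
    have := TemperedDistribution.MemSobolev.add hu hv
    rwa [← Lp.toTemperedDistributionCLM_apply, ← Lp.toTemperedDistributionCLM_apply,
      ← map_add] at this
  zero_mem' := by
    have := TemperedDistribution.memSobolev_fun_zero ℝ ℂ (N : ℝ) 2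
    rwa [← map_zero (Lp.toTemperedDistributionCLM ℂ (volume : Measure ℝ) 2)] at this
  smul_mem' := fun c u hu => by
    have := TemperedDistribution.MemSobolev.smul c hu
    rwa [← Lp.toTemperedDistributionCLM_apply, ← map_smul] at this

/-- The function `(-i∂ₓ)^N u ∈ L²(ℝ, ℂ)`, for `u ∈ H^N(ℝ, ℂ)`. -/
def momentumPowFun {N : ℕ} (u : sobolevSpace N) : Lp ℂ 2 (volume : Measure ℝ) :=
  (exists_momentum_pow u.2).choose

theorem momentumPowFun_spec {N : ℕ} (u : sobolevSpace N) :
    Lp.toTemperedDistributionCLM ℂ (volume : Measure ℝ) 2 (momentumPowFun u) =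
      (momentum ^ N) (Lp.toTemperedDistributionCLM ℂ (volume : Measure ℝ) 2 u) :=
  (exists_momentum_pow u.2).choose_spec.symm

/-- The operator `(-i∂ₓ)^N` in `L²(ℝ, ℂ)` with domain the Sobolev space `H^N(ℝ, ℂ)`. -/
def momentumPow (N : ℕ) :
    Lp ℂ 2 (volume : Measure ℝ) →ₗ.[ℂ] Lp ℂ 2 (volume : Measure ℝ) where
  domain := sobolevSpace N
  toFun :=
    { toFun := momentumPowFun
      map_add' := fun u v => toTemperedDistributionCLM_injective <| by
        rw [map_add, momentumPowFun_spec, momentumPowFun_spec, momentumPowFun_spec,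
          Submodule.coe_add, map_add, map_add]
      map_smul' := fun c u => toTemperedDistributionCLM_injective <| by
        rw [RingHom.id_apply, map_smul, momentumPowFun_spec, momentumPowFun_spec,
          Submodule.coe_smul, map_smul, map_smul] }

/-- `momentumPow N` acts as `(-i∂ₓ)^N` in the sense of distributions. -/
theorem momentumPow_apply {N : ℕ} (u : (momentumPow N).domain) :
    ((momentumPow N u : Lp ℂ 2 (volume : Measure ℝ)) : 𝓢'(ℝ, ℂ)) =
      (momentum ^ N) ((u : Lp ℂ 2 (volume : Measure ℝ)) : 𝓢'(ℝ, ℂ)) :=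
  momentumPowFun_spec u

/-! ## `(-i∂ₓ)^N` is closable in `L²_{-s'}`, so that its extension is a closed operator -/

theorem hasTemperateGrowth_weight (s : ℝ) :
    (fun x : ℝ => (((1 + x ^ 2) ^ s : ℝ) : ℂ)).HasTemperateGrowth := by
  have h := Function.hasTemperateGrowth_one_add_norm_sq_rpow ℝ s
  simp only [Real.norm_eq_abs, sq_abs] at h
  fun_prop

theorem exists_schwartz_weight (s : ℝ) (φ : 𝓢(ℝ, ℂ)) :
    ∃ ψ : 𝓢(ℝ, ℂ), ∀ x, ψ x = (((1 + x ^ 2) ^ s : ℝ) : ℂ) * φ x :=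
  ⟨SchwartzMap.smulLeftCLM ℂ (fun x : ℝ => (((1 + x ^ 2) ^ s : ℝ) : ℂ)) φ, fun x => by
    rw [SchwartzMap.smulLeftCLM_apply_apply (hasTemperateGrowth_weight s)]; rfl⟩

theorem integral_weightedMeasure (s : ℝ) (f : ℝ → ℂ) :
    ∫ x, f x ∂(weightedMeasure s) = ∫ x, (((1 + x ^ 2) ^ s : ℝ) : ℂ) * f x := by
  rw [weightedMeasure, integral_withDensity_eq_integral_toReal_smul₀ (by fun_prop)
    (by simp)]
  refine integral_congr_ae (Eventually.of_forall fun x => ?_)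
  have : (0 : ℝ) ≤ (1 + x ^ 2) ^ s := by positivity
  simp [ENNReal.toReal_ofReal this]

theorem exists_pairing {s : ℝ} (hs : s ≤ 0) (φ : 𝓢(ℝ, ℂ)) :
    ∃ l : WeightedL2 s →L[ℂ] ℂ, ∀ u, l u = ∫ x, φ x * u x ∂(weightedMeasure s) := by
  have hm : MemLp (fun x => (starRingEnd ℂ) (φ x)) 2 (weightedMeasure s) :=
    ((φ.memLp 2 volume).star).mono_measure (weightedMeasure_le_volume hs)
  refine ⟨innerSL ℂ (hm.toLp _), fun u => ?_⟩
  rw [innerSL_apply_apply, L2.inner_def]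
  refine integral_congr_ae ?_
  filter_upwards [hm.coeFn_toLp] with x hx
  rw [hx]
  simp [mul_comm]

/-- Every power of `-i∂ₓ` has a transpose on Schwartz functions. -/
theorem exists_transpose (N : ℕ) (φ : 𝓢(ℝ, ℂ)) :
    ∃ χ : 𝓢(ℝ, ℂ), ∀ f : 𝓢'(ℝ, ℂ), (momentum ^ N) f φ = f χ := by
  induction N generalizing φ with
  | zero => exact ⟨φ, fun f => rfl⟩
  | succ n ih =>
    obtain ⟨χ, hχ⟩ := ih φ
    refine ⟨Complex.I • ∂_{(1 : ℝ)} χ, fun f => ?_⟩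
    rw [pow_succ, Module.End.mul_apply, hχ, momentum_apply, map_smul]
    change (-Complex.I) • f (-∂_{(1 : ℝ)} χ) = _
    simp

/-- The operator `(-i∂ₓ)^N`, regarded as an operator in `L²_{-s'}`, is closable. -/
theorem momentumPow_isClosable (N : ℕ) (s s' : ℝ) (hs : 0 ≤ s) (hs' : 0 ≤ s') :
    ((weightedTriple s s' hs hs').pushforward (momentumPow N)).IsClosable := by
  set P := (weightedTriple s s' hs hs').pushforward (momentumPow N) with hP
  have hs0 : -s' ≤ 0 := neg_nonpos.mpr hs'
  have key : ∀ p ∈ P.graph.topologicalClosure, p.1 = 0 → p.2 = 0 := by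
    intro p hp hp1
    have hae : ∀ᵐ x ∂(weightedMeasure (-s')), p.2 x = 0 := by
      have : IsLocallyFiniteMeasure (weightedMeasure (-s')) :=
        Measure.isLocallyFiniteMeasure_of_le (weightedMeasure_le_volume hs0)
      refine ae_eq_zero_of_integral_contDiff_smul_eq_zero
        ((Lp.memLp p.2).locallyIntegrable one_le_two) fun g hg hgc => ?_
      have hgc' : HasCompactSupport (Complex.ofRealCLM ∘ g) := hgc.comp_left rfl
      have hg' : ContDiff ℝ ((⊤ : ℕ∞) : WithTop ℕ∞) (Complex.ofRealCLM ∘ g) := by fun_prop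
      let ψ : 𝓢(ℝ, ℂ) := hgc'.toSchwartzMap hg'
      have hψ : ∀ x, ψ x = (g x : ℂ) := fun x => rfl
      obtain ⟨φ, hφ⟩ := exists_schwartz_weight (-s') ψ
      obtain ⟨χ, hχ⟩ := exists_transpose N φ
      obtain ⟨η, hη⟩ := exists_schwartz_weight s' χ
      obtain ⟨l₁, hl₁⟩ := exists_pairing hs0 η
      obtain ⟨l₂, hl₂⟩ := exists_pairing hs0 ψ
      have hw : ∀ x : ℝ, (((1 + x ^ 2) ^ (-s') : ℝ) : ℂ) * (((1 + x ^ 2) ^ s' : ℝ) : ℂ) = 1 := by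
        intro x
        rw [← Complex.ofReal_mul, ← Real.rpow_add (by positivity)]
        simp
      have hgraph : ∀ q ∈ P.graph, l₂ q.2 - l₁ q.1 = 0 := by
        rintro q hq
        obtain ⟨⟨v, hv⟩, hq1, hq2⟩ := (LinearPMap.mem_graph_iff _).mp hq
        obtain ⟨u, hu, huv⟩ := hv
        subst huv
        have hPu : P ⟨_, ⟨u, hu, rfl⟩⟩ =
            (weightedTriple s s' hs hs').emb₂ (momentumPow N ⟨u, hu⟩) := by
          change (weightedTriple s s' hs hs').emb₂ (momentumPow N
            (((momentumPow N).domain.equivMapOfInjective _ _).symm ⟨_, ⟨u, hu, rfl⟩⟩)) = _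
          congr 2
          exact (LinearEquiv.symm_apply_eq _).mpr rfl
        have hint : ∀ (w : Lp ℂ 2 (volume : Measure ℝ)) (α β : 𝓢(ℝ, ℂ)),
            (∀ x, (((1 + x ^ 2) ^ (-s') : ℝ) : ℂ) * α x = β x) →
            ∫ x, α x * (weightedTriple s s' hs hs').emb₂ w x ∂(weightedMeasure (-s')) =
              (w : 𝓢'(ℝ, ℂ)) β := by
          intro w α β hαβ
          rw [Lp.toTemperedDistribution_apply, integral_weightedMeasure]
          refine integral_congr_ae ?_
          filter_upwards [(volume_absolutelyContinuous_weightedMeasure (-s')).ae_le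
            (lpInclusion_coeFn (weightedMeasure_le_volume hs0) w)] with x hx
          rw [← mul_assoc, hαβ]
          change β x * _ = β x * _
          congr 1
        rw [← hq1, ← hq2, hl₁, hl₂, hPu]
        change ∫ x, ψ x * (weightedTriple s s' hs hs').emb₂ (momentumPow N ⟨u, hu⟩) x ∂_ -
          ∫ x, η x * (weightedTriple s s' hs hs').emb₂ u x ∂_ = 0
        rw [hint _ ψ φ (fun x => (hφ x).symm), hint u η χ (fun x => by
          rw [hη, ← mul_assoc, hw, one_mul]), momentumPow_apply, hχ, sub_self]
      have hcl : l₂ p.2 - l₁ p.1 = 0 := by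
        have hc : IsClosed {q : WeightedL2 (-s') × WeightedL2 (-s') | l₂ q.2 - l₁ q.1 = 0} :=
          isClosed_eq (by fun_prop) continuous_const
        exact closure_minimal (fun q hq => hgraph q hq) hc hp
      rw [hp1, map_zero, sub_zero, hl₂] at hcl
      rw [← hcl]
      refine integral_congr_ae (Eventually.of_forall fun x => ?_)
      simp [hψ]
    exact (Lp.eq_zero_iff_ae_eq_zero).mpr hae
  exact ⟨P.graph.topologicalClosure.toLinearPMap,
    (Submodule.toLinearPMap_graph_eq _ fun p hp hp1 => key p hp hp1).symm⟩

/-- The extension of `(-i∂ₓ)^N` onto `L²_{-s'}` is closed, and extends the operator. -/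
theorem momentumPow_extension_isClosed (N : ℕ) (s s' : ℝ) (hs : 0 ≤ s) (hs' : 0 ≤ s') :
    ((weightedTriple s s' hs hs').extension (momentumPow N)).IsClosed ∧
      (weightedTriple s s' hs hs').pushforward (momentumPow N) ≤
        (weightedTriple s s' hs hs').extension (momentumPow N) :=
  ⟨(momentumPow_isClosable N s s' hs hs').closure_isClosed, LinearPMap.le_closure _⟩

end VirtualLevels

end

open VirtualLevels

/-! The abstract half reduces the dichotomy to one good finite rank perturbation. Write E, X, F for
the triple of spaces, and suppose that C₁ has finite rank and that (A + C₁ - z)⁻¹ : E → F converges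
in norm to L₁. Since Â is closed, L₁ maps into its domain, so B L₁ is compact on E. Also L₁ is
injective, so its adjoint has dense range, and some finite rank C' gives ‖B L₁ + C' L₁‖ < 1
(`exists_finiteRank_norm_add_comp_lt`). Inverting 1 + B L₁ + C' L₁ yields norm convergence of (A + B
+ C - z)⁻¹ to some L, with C = C' + C₁ (`exists_finiteRank_regularization`).

Removing C amounts to inverting 1 - C L, the identity minus a finite rank operator, for which
injectivity and surjectivity coincide. If it is invertible, the resolvents of A + B converge in
norm, and a virtual state L g would put g ≠ 0 in its kernel. If it is not, a nonzero e = C L e gives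
the virtual state L e, while limiting absorption would make 1 - C L surjective, by the second
resolvent identity in the limit (`virtualState_dichotomy`).

The concrete half produces C₁ = 1_[0,1]⟨1_[0,1], ·⟩. With ζ³ = z, the Green function G of (-i∂ₓ)³ -
z has the form a ζ⁻² + b t ζ⁻¹ + O(1) at fixed t, while G' is 1-Lipschitz uniformly in ζ. Let G₁(x),
G₂(y) and m be the means of G(x - y) over y, over x and over both variables in [0,1]. The perturbed
resolvent has the kernel G - G₁G₂/(1 + m) = (G - G₁ - G₂ + m) + 1 - (G₁ - m - 1)(G₂ - m - 1)/(1 +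
m). The bracket is an averaged second difference, so it is at most (1 + |x|)(1 + |y|). The numerator
is O(ζ⁻²) with the same growth, and 1 + m has exact order ζ⁻². Thus a single rank removes both
singular orders (`IsSectorRoot.perturbedKernel_eq`). The kernels converge pointwise under a bound
which is square integrable for the weights when s, s' > 3/2, and dominated convergence in
Hilbert-Schmidt norm gives norm convergence (`exists_tendsto_of_tendsto_kernel`). -/

open VirtualLevels

noncomputable section

namespace VirtualLevels

/-! ### Finite rank correction of compact operators -/

section FiniteRank

variable {E F : Type*} [NormedAddCommGroup E] [InnerProductSpace ℂ E] [CompleteSpace E]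
  [NormedAddCommGroup F] [InnerProductSpace ℂ F] [CompleteSpace F]

open ContinuousLinearMap in
/-- The adjoint of an injective operator has dense range. -/
theorem dense_range_adjoint {L : E →L[ℂ] F} (hL : Function.Injective L) :
    (LinearMap.range (adjoint L : F →ₗ[ℂ] E)).topologicalClosure = ⊤ := by
  rw [Submodule.topologicalClosure_eq_top_iff, ContinuousLinearMap.orthogonal_range,
    adjoint_adjoint]
  exact LinearMap.ker_eq_bot.mpr hL

open ContinuousLinearMap in
/-- A compact operator becomes small after adding `C L`, for a finite rank operator `C`. -/
theorem exists_finiteRank_norm_add_comp_lt {K : E →L[ℂ] E} (hK : IsCompactOperator K)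
    {L : E →L[ℂ] F} (hL : Function.Injective L) :
    ∃ C : F →L[ℂ] E, FiniteDimensional ℂ (LinearMap.range (C : F →ₗ[ℂ] E)) ∧
      ‖K + C ∘L L‖ < 1 := by
  obtain ⟨Q, hQ, hKQ⟩ := IsCompactOperator.image_closedBall_subset_compact (𝕜₁ := ℂ)
    (f := (K : E →ₗ[ℂ] E)) hK 1
  -- A finite 1/4-net of the image of the unit ball spans `S`; projecting onto `S` changes `K` by at
  -- most 1/4, because the projection is the best approximation.
  obtain ⟨t, ht, hcover⟩ := Metric.totallyBounded_iff.mp hQ.totallyBounded (1 / 4) (by norm_num)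
  set S := Submodule.span ℂ t with hS
  have : FiniteDimensional ℂ S := FiniteDimensional.span_of_finite ℂ ht
  have hPK : ‖K - S.starProjection ∘L K‖ ≤ 1 / 4 := by
    refine ContinuousLinearMap.opNorm_le_of_unit_norm (𝕜 := ℂ) (by norm_num) fun x hx => ?_
    have hx' : K x ∈ Q := hKQ ⟨x, by simp [hx], rfl⟩
    obtain ⟨y, hy, hxy⟩ := Set.mem_iUnion₂.mp (hcover hx')
    have := S.starProjection_minimal (K x)
    rw [sub_apply, ContinuousLinearMap.comp_apply, this]
    refine (ciInf_le ⟨0, ?_⟩ (⟨y, Submodule.subset_span hy⟩ : S)).trans ?_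
    · rintro _ ⟨z, rfl⟩
      positivity
    · simpa [dist_eq_norm] using (Metric.mem_ball.mp hxy).le
  set n := Module.finrank ℂ S
  let b := stdOrthonormalBasis ℂ S
  -- The errors of `n` coordinates then add up to at most 1/4; `n + 1` covers the case `n = 0`.
  have hε : (0 : ℝ) < 1 / (4 * (n + 1)) := by positivity
  -- The i-th coordinate of the projection of `K x` is the functional ⟨K* bᵢ, x⟩. By density K* bᵢ
  -- is nearly some L* fᵢ, and ⟨L* fᵢ, x⟩ = ⟨fᵢ, L x⟩ factors through `L`.
  have hf : ∀ i, ∃ f : F, ‖adjoint K (b i) - adjoint L f‖ < 1 / (4 * (n + 1)) := by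
    intro i
    have hmem : adjoint K (b i) ∈
        (LinearMap.range (adjoint L : F →ₗ[ℂ] E)).topologicalClosure := by
      rw [dense_range_adjoint hL]; trivial
    obtain ⟨_, ⟨f, rfl⟩, hf⟩ := Metric.mem_closure_iff.mp hmem _ hε
    exact ⟨f, by simpa [dist_eq_norm] using hf⟩
  choose f hf using hf
  let C : F →L[ℂ] E := -∑ i, (innerSL ℂ (f i)).smulRight (b i : E)
  have hCL : ∀ x, C (L x) = -∑ i, inner ℂ (adjoint L (f i)) x • (b i : E) := by
    intro x
    simp [C, adjoint_inner_left]
  have hPKx : ∀ x, S.starProjection (K x) = ∑ i, inner ℂ (adjoint K (b i)) x • (b i : E) := by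
    intro x
    rw [Submodule.starProjection_apply, b.orthogonalProjectionOnto_apply_eq_sum]
    simp [adjoint_inner_left]
  refine ⟨C, ?_, ?_⟩
  · have hle : LinearMap.range (C : F →ₗ[ℂ] E) ≤ S := by
      rintro _ ⟨x, rfl⟩
      simp only [ContinuousLinearMap.coe_coe, C, neg_apply,
        sum_apply, ContinuousLinearMap.smulRight_apply]
      exact S.neg_mem (S.sum_mem fun i _ => S.smul_mem _ (b i).2)
    exact Submodule.finiteDimensional_of_le hle
  · have h2 : ‖S.starProjection ∘L K + C ∘L L‖ ≤ 1 / 4 := by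
      refine ContinuousLinearMap.opNorm_le_bound _ (by norm_num) fun x => ?_
      have : (S.starProjection ∘L K + C ∘L L) x =
          ∑ i, inner ℂ (adjoint K (b i) - adjoint L (f i)) x • (b i : E) := by
        simp only [add_apply, ContinuousLinearMap.comp_apply, hCL, hPKx,
          ← sub_eq_add_neg, ← Finset.sum_sub_distrib, ← sub_smul, inner_sub_left]
      rw [this]
      calc _ ≤ ∑ i : Fin n, 1 / (4 * ((n : ℝ) + 1)) * ‖x‖ := by
            refine norm_sum_le_of_le _ fun i _ => ?_
            rw [norm_smul]
            have hb : ‖(b i : E)‖ = 1 := b.norm_eq_one i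
            rw [hb, mul_one]
            exact (norm_inner_le_norm _ _).trans (by gcongr; exact (hf i).le)
        _ = (n / (n + 1)) * (1 / 4) * ‖x‖ := by
            simp; field_simp
        _ ≤ 1 * (1 / 4) * ‖x‖ := by
            gcongr
            rw [div_le_one (by positivity)]; linarith
        _ = _ := by ring
    calc ‖K + C ∘L L‖ = ‖(K - S.starProjection ∘L K) + (S.starProjection ∘L K + C ∘L L)‖ := by
          congr 1; abel
      _ ≤ 1 / 4 + 1 / 4 := (norm_add_le _ _).trans (add_le_add hPK h2)
      _ < 1 := by norm_num

end FiniteRank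

/-! ### Fredholm alternative and weak limits for finite rank operators -/

section FiniteRankAlgebra

variable {E F : Type*} [NormedAddCommGroup E] [NormedSpace ℂ E]
  [NormedAddCommGroup F] [NormedSpace ℂ F]

/-- The identity minus a finite rank operator is injective if and only if it is surjective. -/
theorem injective_iff_surjective_one_sub_of_finiteRank (P : E →ₗ[ℂ] E)
    [FiniteDimensional ℂ (LinearMap.range P)] :
    Function.Injective (1 - P : E →ₗ[ℂ] E) ↔ Function.Surjective (1 - P : E →ₗ[ℂ] E) := by
  set V := LinearMap.range P
  -- `1 - P` preserves the range `V` of `P` and is the identity modulo `V`, so both properties can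
  -- be tested on the finite dimensional `V`.
  have hmaps : ∀ v ∈ V, (1 - P) v ∈ V := fun v hv => V.sub_mem hv ⟨v, rfl⟩
  let Q : V →ₗ[ℂ] V := (1 - P).restrict hmaps
  have hQ : ∀ v : V, (Q v : E) = v - P v := fun v => rfl
  have key : Function.Injective Q ↔ Function.Surjective Q := LinearMap.injective_iff_surjective
  constructor
  · intro h
    have hQs : Function.Surjective Q := key.mp fun v w hvw =>
      Subtype.ext (h (congrArg Subtype.val hvw))
    intro y
    obtain ⟨v, hv⟩ := hQs ⟨P y, ⟨y, rfl⟩⟩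
    have hv' : (v : E) - P v = P y := by rw [← hQ, hv]
    refine ⟨y + v, ?_⟩
    simp only [LinearMap.sub_apply, Module.End.one_apply, map_add]
    rw [← hv']
    abel
  · intro h
    have hQi : Function.Injective Q := by
      refine key.mpr fun v => ?_
      obtain ⟨x, hx⟩ := h v
      have hx' : x - P x = v := hx
      refine ⟨⟨x, ?_⟩, Subtype.ext hx⟩
      rw [← sub_add_cancel x (P x), hx']
      exact V.add_mem v.2 ⟨x, rfl⟩
    rw [← LinearMap.ker_eq_bot, LinearMap.ker_eq_bot']
    intro x hx
    have hx' : x - P x = 0 := hx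
    have hxV : x ∈ V := ⟨x, (sub_eq_zero.mp hx').symm⟩
    have : (⟨x, hxV⟩ : V) = 0 := hQi (Subtype.ext (by rw [hQ, map_zero]; exact hx'))
    exact congrArg Subtype.val this

/-- A finite rank operator maps weakly convergent families to norm convergent ones. -/
theorem tendsto_finiteRank_of_weak (C : F →L[ℂ] E)
    [FiniteDimensional ℂ (LinearMap.range (C : F →ₗ[ℂ] E))] {ι : Type*} {l : Filter ι}
    {u : ι → F} {v : F} (h : ∀ φ : F →L[ℂ] ℂ, Tendsto (fun i => φ (u i)) l (𝓝 (φ v))) :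
    Tendsto (fun i => C (u i)) l (𝓝 (C v)) := by
  let b := Module.finBasis ℂ (LinearMap.range (C : F →ₗ[ℂ] E))
  let c : F →L[ℂ] LinearMap.range (C : F →ₗ[ℂ] E) := C.codRestrict _ fun x => ⟨x, rfl⟩
  have hC : ∀ x, C x = ∑ i, b.equivFunL (c x) i • (b i : E) := by
    intro x
    have := congrArg Subtype.val (b.sum_equivFun (c x))
    simp only [Submodule.coe_sum, Submodule.coe_smul] at this
    exact this.symm
  simp_rw [hC]
  refine tendsto_finsetSum _ fun i _ => Tendsto.smul_const ?_ _
  -- Each coordinate of `C` is a continuous functional on `F`, so the weak hypothesis applies to it.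
  exact h ((ContinuousLinearMap.proj (R := ℂ) (φ := fun _ => ℂ) i) ∘L
    b.equivFunL.toContinuousLinearMap ∘L c)

end FiniteRankAlgebra

/-! ### Resolvents of perturbed operators -/

section Perturbation

variable {E X F : Type*}
  [NormedAddCommGroup E] [NormedSpace ℂ E]
  [NormedAddCommGroup X] [NormedSpace ℂ X]
  [NormedAddCommGroup F] [NormedSpace ℂ F]

theorem IsResolventAt.unique {A : X →ₗ.[ℂ] X} {z : ℂ} {R R' : X →L[ℂ] X}
    (h : IsResolventAt A z R) (h' : IsResolventAt A z R') : R = R' := by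
  ext x
  obtain ⟨hx, hx'⟩ := h'.1 x
  have := h.2 ⟨R' x, hx⟩
  rwa [hx'] at this

theorem IsResolventAt.resolventOp_eq {A : X →ₗ.[ℂ] X} {z : ℂ} {R : X →L[ℂ] X}
    (h : IsResolventAt A z R) : resolventOp A z = R :=
  (isResolventAt_resolventOp ⟨R, h⟩).unique h

theorem exists_ball_subset_iff_eventually {Ω S : Set ℂ} {z₀ : ℂ} :
    (∃ δ : ℝ, 0 < δ ∧ Ω ∩ Metric.ball z₀ δ ⊆ S) ↔ ∀ᶠ z in 𝓝[Ω] z₀, z ∈ S := by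
  rw [show (∀ᶠ z in 𝓝[Ω] z₀, z ∈ S) ↔ S ∈ 𝓝[Ω] z₀ from Iff.rfl, Metric.mem_nhdsWithin_iff]
  simp only [Set.inter_comm, gt_iff_lt]

namespace EmbeddedTriple

variable (T : EmbeddedTriple E X F) (A : X →ₗ.[ℂ] X)

/-- The operator `A + w` in `X`, for a linear map `w` from the domain of `A` to `E`. -/
def perturb (w : A.domain →ₗ[ℂ] E) : X →ₗ.[ℂ] X :=
  ⟨A.domain, A.toFun + (T.emb₁ : E →ₗ[ℂ] X) ∘ₗ w⟩

theorem isResolventAt_perturb_iff {w : A.domain →ₗ[ℂ] E} {z : ℂ} {R : X →L[ℂ] X} :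
    IsResolventAt (T.perturb A w) z R ↔
      (∀ x : X, ∃ h : R x ∈ A.domain, A ⟨R x, h⟩ + T.emb₁ (w ⟨R x, h⟩) - z • R x = x) ∧
        ∀ u : A.domain, R (A u + T.emb₁ (w u) - z • (u : X)) = u :=
  Iff.rfl

/-- A partially defined operator from `F` to `E` as a linear map on the domain of `A`. -/
def restrictToDomain (W : F →ₗ.[ℂ] E) (h : ∀ u : A.domain, T.emb₂ u ∈ W.domain) :
    A.domain →ₗ[ℂ] E :=
  W.toFun ∘ₗ ((T.emb₂ : X →ₗ[ℂ] F) ∘ₗ A.domain.subtype).codRestrict W.domain h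

/-- As `W` is defined wherever `A` is, adding it does not shrink the domain. Perturbations thus
become total linear maps on `A.domain`, which all later resolvent computations use. -/
theorem add_perturbX_eq (W : F →ₗ.[ℂ] E) (h : ∀ u : A.domain, T.emb₂ u ∈ W.domain) :
    A + T.perturbX W = T.perturb A (T.restrictToDomain A W h) := by
  refine LinearPMap.ext ?_ ?_
  · refine le_antisymm (fun u hu => hu.1) fun u hu => ⟨hu, h ⟨u, hu⟩⟩
  · intro u hu hu'
    rfl

theorem emb₂_mem_graph_extension (u : A.domain) :
    (T.emb₂ u, T.emb₂ (A u)) ∈ (T.extension A).graph := by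
  refine LinearPMap.le_graph_of_le (LinearPMap.le_closure (T.pushforward A)) ?_
  rw [LinearPMap.mem_graph_iff]
  refine ⟨⟨T.emb₂ u, ⟨u, u.2, rfl⟩⟩, rfl, ?_⟩
  change T.emb₂ (A ((A.domain.equivMapOfInjective _ _).symm ⟨_, ⟨u, u.2, rfl⟩⟩)) = _
  congr 2
  exact (LinearEquiv.symm_apply_eq _).mpr rfl

theorem emb₂_mem_domain_extension (u : A.domain) : T.emb₂ u ∈ (T.extension A).domain :=
  LinearPMap.mem_domain_of_mem_graph (T.emb₂_mem_graph_extension A u)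

variable {T A}

/-- The resolvent of a perturbed operator from that of the unperturbed one. -/
theorem isResolventAt_perturb {w₁ w₂ : A.domain →ₗ[ℂ] E} {z : ℂ} {R : X →L[ℂ] X}
    (hR : IsResolventAt (T.perturb A w₁) z R) {N : X →L[ℂ] E}
    (hN : ∀ x (hx : R x ∈ A.domain), N x = w₂ ⟨R x, hx⟩ - w₁ ⟨R x, hx⟩)
    {J : E →L[ℂ] E} (hJ₁ : ∀ e, J (e + N (T.emb₁ e)) = e)
    (hJ₂ : ∀ e, J e + N (T.emb₁ (J e)) = e) :
    IsResolventAt (T.perturb A w₂) z (R ∘L (1 - T.emb₁ ∘L J ∘L N)) := by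
  -- With ι the embedding of `E`, the operator `J` is the inverse of 1 + N ι on `E`, and 1 - ι J N
  -- is the inverse of 1 + ι N on `X`. All inversion takes place in `E`, where norm limits are
  -- available.
  rw [isResolventAt_perturb_iff] at hR ⊢
  constructor
  · intro x
    obtain ⟨h, hx⟩ := hR.1 (x - T.emb₁ (J (N x)))
    refine ⟨h, ?_⟩
    have hN' := hN _ h
    have h2 : w₂ ⟨R (x - T.emb₁ (J (N x))), h⟩ = N (x - T.emb₁ (J (N x))) +
        w₁ ⟨R (x - T.emb₁ (J (N x))), h⟩ := by rw [hN']; abel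
    have h3 : N (x - T.emb₁ (J (N x))) = J (N x) := by
      rw [map_sub, sub_eq_iff_eq_add]
      exact (hJ₂ (N x)).symm
    change A ⟨R (x - T.emb₁ (J (N x))), h⟩ + T.emb₁ (w₂ ⟨R (x - T.emb₁ (J (N x))), h⟩) -
      z • R (x - T.emb₁ (J (N x))) = x
    rw [h2, h3, map_add]
    calc _ = (A ⟨R (x - T.emb₁ (J (N x))), h⟩ +
        T.emb₁ (w₁ ⟨R (x - T.emb₁ (J (N x))), h⟩) - z • R (x - T.emb₁ (J (N x)))) +
        T.emb₁ (J (N x)) := by abel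
      _ = _ := by rw [hx]; abel
  · intro u
    set v : X := A u + T.emb₁ (w₁ u) - z • (u : X) with hv
    have hRv : R v = u := hR.2 u
    have hNv : N v = w₂ u - w₁ u := by
      have h : R v ∈ A.domain := hRv ▸ u.2
      rw [hN v h]
      have : (⟨R v, h⟩ : A.domain) = u := Subtype.ext hRv
      rw [this]
    have h1 : A u + T.emb₁ (w₂ u) - z • (u : X) = v + T.emb₁ (N v) := by
      rw [hNv, hv, map_sub]
      abel
    rw [h1]
    change R (v + T.emb₁ (N v) - T.emb₁ (J (N (v + T.emb₁ (N v))))) = _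
    rw [map_add N, hJ₁, add_sub_cancel_right, hRv]

set_option maxHeartbeats 800000 in
/-- Norm convergence of resolvents is inherited by perturbations for which `1 + K₀` is
invertible. -/
theorem tendsto_resolventEF_perturb [CompleteSpace E] {w₁ w₂ : A.domain →ₗ[ℂ] E} {l : Filter ℂ}
    (hR : ∀ᶠ z in l, z ∈ resolventSet (T.perturb A w₁)) {L : E →L[ℂ] F}
    (hL : Tendsto (fun z => T.resolventEF (T.perturb A w₁) z) l (𝓝 L))
    {N : ℂ → X →L[ℂ] E}
    (hN : ∀ᶠ z in l, ∀ x (hx : resolventOp (T.perturb A w₁) z x ∈ A.domain),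
      N z x = w₂ ⟨_, hx⟩ - w₁ ⟨_, hx⟩)
    {K : E →L[ℂ] E} (hK : Tendsto (fun z => N z ∘L T.emb₁) l (𝓝 K)) (hu : IsUnit (1 + K)) :
    (∀ᶠ z in l, z ∈ resolventSet (T.perturb A w₂)) ∧
      Tendsto (fun z => T.resolventEF (T.perturb A w₂) z) l
        (𝓝 (L ∘L Ring.inverse (1 + K))) := by
  have hK1 : Tendsto (fun z => 1 + N z ∘L T.emb₁) l (𝓝 (1 + K)) := hK.const_add 1
  have hunit : ∀ᶠ z in l, IsUnit (1 + N z ∘L T.emb₁) :=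
    hK1.eventually (Units.isOpen.mem_nhds hu)
  have hinv : Tendsto (fun z => Ring.inverse (1 + N z ∘L T.emb₁)) l
      (𝓝 (Ring.inverse (1 + K))) := by
    obtain ⟨U, hU⟩ := hu
    rw [← hU] at hK1 ⊢
    exact (NormedRing.inverse_continuousAt U).tendsto.comp hK1
  have key : ∀ᶠ z in l, IsResolventAt (T.perturb A w₂) z
      (resolventOp (T.perturb A w₁) z ∘L
        (1 - T.emb₁ ∘L Ring.inverse (1 + N z ∘L T.emb₁) ∘L N z)) := by
    filter_upwards [hR, hN, hunit] with z h1 h2 h3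
    refine isResolventAt_perturb (isResolventAt_resolventOp h1) h2 ?_ ?_
    · intro e
      exact DFunLike.congr_fun (Ring.inverse_mul_cancel _ h3) e
    · intro e
      exact DFunLike.congr_fun (Ring.mul_inverse_cancel _ h3) e
  refine ⟨key.mono fun z hz => ⟨_, hz⟩, ?_⟩
  have hcomp : Tendsto (fun z => T.resolventEF (T.perturb A w₁) z ∘L
      Ring.inverse (1 + N z ∘L T.emb₁)) l (𝓝 (L ∘L Ring.inverse (1 + K))) :=
    ((ContinuousLinearMap.compL ℂ E E F).continuous₂.tendsto (L, Ring.inverse (1 + K))).comp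
      (hL.prodMk_nhds hinv)
  refine hcomp.congr' ?_
  filter_upwards [key, hunit] with z hz hz'
  ext e
  -- For J = (1 + N ι)⁻¹ one has J + J N ι = 1, hence (1 - ι J N) ι = ι J: seen from `E` to `F`, the
  -- new resolvent is the old one composed with J.
  have h1 : Ring.inverse (1 + N z ∘L T.emb₁) e +
      Ring.inverse (1 + N z ∘L T.emb₁) (N z (T.emb₁ e)) = e := by
    rw [← map_add]
    exact DFunLike.congr_fun (Ring.inverse_mul_cancel _ hz') e
  rw [resolventEF, resolventEF, hz.resolventOp_eq]
  change T.emb₂ (resolventOp _ z (T.emb₁ (Ring.inverse (1 + N z ∘L T.emb₁) e))) =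
    T.emb₂ (resolventOp _ z (T.emb₁ e -
      T.emb₁ (Ring.inverse (1 + N z ∘L T.emb₁) (N z (T.emb₁ e)))))
  rw [← map_sub, ← eq_sub_of_add_eq h1]

variable (T A) in
/-- A relatively compact operator is a compact operator on the graph. -/
theorem exists_compact_on_graph {S : F →ₗ.[ℂ] F} {B : F →ₗ.[ℂ] E}
    (hB : IsRelativelyCompact S B) :
    ∃ b : S.graph →L[ℂ] E, IsCompactOperator b ∧ ∀ p : S.graph, ((p : F × F).1, b p) ∈ B.graph := by
  have hdom : ∀ p : S.graph, (p : F × F).1 ∈ B.domain := fun p =>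
    hB.1 (LinearPMap.mem_domain_of_mem_graph p.2)
  let bl : S.graph →ₗ[ℂ] E :=
    B.toFun ∘ₗ (LinearMap.fst ℂ F F ∘ₗ S.graph.subtype).codRestrict B.domain hdom
  have hbl : ∀ p, bl p = B ⟨_, hdom p⟩ := fun p => rfl
  have hc : IsCompactOperator bl := by
    rw [isCompactOperator_iff_exists_mem_nhds_image_subset_compact]
    -- The graph carries the sup norm of the product, so radius 1/2 ensures ‖u‖ + ‖S u‖ ≤ 1.
    refine ⟨Metric.ball 0 (1 / 2), Metric.ball_mem_nhds _ (by norm_num), _, hB.2, ?_⟩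
    rintro _ ⟨p, hp, rfl⟩
    refine subset_closure ?_
    have hp' : ‖(p : F × F)‖ < 1 / 2 := by simpa using hp
    have hS := LinearPMap.mem_domain_of_mem_graph p.2
    refine ⟨(p : F × F).1, hS, hdom p, ?_, rfl⟩
    have h2 : S ⟨(p : F × F).1, hS⟩ = (p : F × F).2 := (LinearPMap.image_iff hS).mpr p.2 |>.symm
    rw [h2]
    have := norm_fst_le (p : F × F)
    have := norm_snd_le (p : F × F)
    linarith
  refine ⟨ContinuousLinearMap.mkOfIsCompactOperator hc, hc, fun p => ?_⟩
  exact LinearPMap.mem_graph B ⟨_, hdom p⟩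

end EmbeddedTriple

end Perturbation

/-! ### Limits of resolvents and the second resolvent identity -/

namespace EmbeddedTriple

section Dichotomy

variable {E X F : Type*}
  [NormedAddCommGroup E] [NormedSpace ℂ E]
  [NormedAddCommGroup X] [NormedSpace ℂ X]
  [NormedAddCommGroup F] [NormedSpace ℂ F]

variable (T : EmbeddedTriple E X F) (A : X →ₗ.[ℂ] X)

/-- A bounded operator from `F` to `E` as a linear map on the domain of `A`. -/
def boundedOnDomain (C : F →L[ℂ] E) : A.domain →ₗ[ℂ] E :=
  (C ∘L T.emb₂ : X →ₗ[ℂ] E) ∘ₗ A.domain.subtype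

theorem boundedOnDomain_apply (C : F →L[ℂ] E) (u : A.domain) :
    T.boundedOnDomain A C u = C (T.emb₂ u) := rfl

theorem boundedOnDomain_zero : T.boundedOnDomain A 0 = 0 := rfl

theorem add_perturbX_add_bounded_eq {B : F →ₗ.[ℂ] E} (hB : ∀ u : A.domain, T.emb₂ u ∈ B.domain)
    (C : F →L[ℂ] E) :
    A + T.perturbX (B + (C : F →ₗ[ℂ] E).toPMap ⊤) =
      T.perturb A (T.restrictToDomain A B hB + T.boundedOnDomain A C) :=
  T.add_perturbX_eq A (B + (C : F →ₗ[ℂ] E).toPMap ⊤) fun u => ⟨hB u, trivial⟩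

variable {T A}

theorem hasWeakResolventLimit_of_tendsto {S : X →ₗ.[ℂ] X} {Ω : Set ℂ} {z₀ : ℂ} {L : E →L[ℂ] F}
    (hS : ∀ᶠ z in 𝓝[Ω] z₀, z ∈ resolventSet S)
    (hL : Tendsto (fun z => T.resolventEF S z) (𝓝[Ω] z₀) (𝓝 L)) :
    T.HasWeakResolventLimit S Ω z₀ L := by
  refine ⟨exists_ball_subset_iff_eventually.mpr hS, fun e φ => ?_⟩
  have : Tendsto (fun z => T.resolventEF S z e) (𝓝[Ω] z₀) (𝓝 (L e)) :=
    ((ContinuousLinearMap.apply ℂ F e).continuous.tendsto L).comp hL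
  exact (φ.continuous.tendsto _).comp this

/-- Apply R to (A + w₁ - z) R' x, which differs from x = (A + w₂ - z) R' x by (w₁ - w₂) R' x. -/
theorem second_resolvent_identity {w₁ w₂ : A.domain →ₗ[ℂ] E} {z : ℂ} {R R' : X →L[ℂ] X}
    (h : IsResolventAt (T.perturb A w₁) z R) (h' : IsResolventAt (T.perturb A w₂) z R') (x : X) :
    ∃ hd : R' x ∈ A.domain, R' x = R (x + T.emb₁ (w₁ ⟨R' x, hd⟩ - w₂ ⟨R' x, hd⟩)) := by
  rw [isResolventAt_perturb_iff] at h h'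
  obtain ⟨hd, hx⟩ := h'.1 x
  refine ⟨hd, ?_⟩
  have h2 := h.2 ⟨_, hd⟩
  have h3 : x + T.emb₁ (w₁ ⟨R' x, hd⟩ - w₂ ⟨R' x, hd⟩) =
      A ⟨R' x, hd⟩ + T.emb₁ (w₁ ⟨R' x, hd⟩) - z • R' x := by
    rw [map_sub, ← sub_eq_zero]
    rw [← sub_eq_zero, ← neg_eq_zero] at hx
    rw [← hx]
    abel
  rw [h3, h2]

/-- The second resolvent identity in the limit, for perturbations which differ by a finite rank
operator. -/
theorem weakResolventLimit_eq {w : A.domain →ₗ[ℂ] E} {Ω : Set ℂ} {z₀ : ℂ} [(𝓝[Ω] z₀).NeBot]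
    {C D : F →L[ℂ] E} [FiniteDimensional ℂ (LinearMap.range (C : F →ₗ[ℂ] E))]
    [FiniteDimensional ℂ (LinearMap.range (D : F →ₗ[ℂ] E))] {L M : E →L[ℂ] F}
    (hS : ∀ᶠ z in 𝓝[Ω] z₀, z ∈ resolventSet (T.perturb A (w + T.boundedOnDomain A C)))
    (hL : Tendsto (fun z => T.resolventEF (T.perturb A (w + T.boundedOnDomain A C)) z)
      (𝓝[Ω] z₀) (𝓝 L))
    (hM : T.HasWeakResolventLimit (T.perturb A (w + T.boundedOnDomain A D)) Ω z₀ M) (e : E) :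
    M e = L (e + (C (M e) - D (M e))) := by
  set S := T.perturb A (w + T.boundedOnDomain A C) with hSdef
  set S' := T.perturb A (w + T.boundedOnDomain A D) with hSdef'
  have hS' := exists_ball_subset_iff_eventually.mp hM.1
  refine (SeparatingDual.eq_iff_forall_dual_eq (R := ℂ)).mpr fun φ => ?_
  -- The two perturbations differ by finite rank operators, so the weak limit of the resolvent makes
  -- this argument converge in norm. It can then be paired with the norm convergent resolvents.
  have hCl : Tendsto (fun z => e + (C (T.resolventEF S' z e) - D (T.resolventEF S' z e))) (𝓝[Ω] z₀)
      (𝓝 (e + (C (M e) - D (M e)))) :=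
    ((tendsto_finiteRank_of_weak C (hM.2 e)).sub
      (tendsto_finiteRank_of_weak D (hM.2 e))).const_add e
  have hcomp := ((isBoundedBilinearMap_apply (𝕜 := ℂ) (E := E) (F := F)).continuous.tendsto
    (L, e + (C (M e) - D (M e)))).comp (hL.prodMk_nhds hCl)
  refine tendsto_nhds_unique (hM.2 e φ) (((φ.continuous.tendsto _).comp hcomp).congr' ?_)
  filter_upwards [hS, hS'] with z hz hz'
  obtain ⟨hd, hx⟩ := second_resolvent_identity (isResolventAt_resolventOp hz)
    (isResolventAt_resolventOp hz') (T.emb₁ e)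
  simp only [LinearMap.add_apply, boundedOnDomain_apply, add_sub_add_left_eq_sub] at hx
  rw [← map_add] at hx
  exact congrArg (fun x => φ (T.emb₂ x)) hx.symm

theorem tendsto_const_comp {G : Type*} [NormedAddCommGroup G] [NormedSpace ℂ G] (P : F →L[ℂ] G)
    {l : Filter ℂ} {R : ℂ → E →L[ℂ] F} {L : E →L[ℂ] F} (h : Tendsto R l (𝓝 L)) :
    Tendsto (fun z => P ∘L R z) l (𝓝 (P ∘L L)) :=
  ((ContinuousLinearMap.compL ℂ E F G P).continuous.tendsto L).comp h

end Dichotomy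

/-! ### Regularizing a relatively compact perturbation by a finite rank operator -/

section Regularization

variable {E X F : Type*}
  [NormedAddCommGroup E] [InnerProductSpace ℂ E] [CompleteSpace E]
  [NormedAddCommGroup X] [NormedSpace ℂ X]
  [NormedAddCommGroup F] [InnerProductSpace ℂ F] [CompleteSpace F]
  {T : EmbeddedTriple E X F} {A : X →ₗ.[ℂ] X}

/-- If a finite rank perturbation of `A` has resolvents converging in norm, then the same is true
of `A + B`, for relatively compact `B`. -/
theorem exists_finiteRank_regularization (hA : (T.extension A).IsClosed) {Ω : Set ℂ} {z₀ : ℂ}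
    [(𝓝[Ω] z₀).NeBot] {C₁ : F →L[ℂ] E}
    [FiniteDimensional ℂ (LinearMap.range (C₁ : F →ₗ[ℂ] E))] {L₁ : E →L[ℂ] F}
    (hS : ∀ᶠ z in 𝓝[Ω] z₀, z ∈ resolventSet (T.perturb A (T.boundedOnDomain A C₁)))
    (hL : Tendsto (fun z => T.resolventEF (T.perturb A (T.boundedOnDomain A C₁)) z)
      (𝓝[Ω] z₀) (𝓝 L₁))
    {B : F →ₗ.[ℂ] E} (hB : IsRelativelyCompact (T.extension A) B)
    (hdom : ∀ u : A.domain, T.emb₂ u ∈ B.domain) :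
    ∃ (C : F →L[ℂ] E) (L : E →L[ℂ] F), FiniteDimensional ℂ (LinearMap.range (C : F →ₗ[ℂ] E)) ∧
      (∀ᶠ z in 𝓝[Ω] z₀, z ∈
        resolventSet (T.perturb A (T.restrictToDomain A B hdom + T.boundedOnDomain A C))) ∧
      Tendsto (fun z => T.resolventEF
        (T.perturb A (T.restrictToDomain A B hdom + T.boundedOnDomain A C)) z)
        (𝓝[Ω] z₀) (𝓝 L) ∧
      ∀ e, ∃ v b, (L e, v) ∈ (T.extension A).graph ∧ (L e, b) ∈ B.graph ∧
        v + T.emb₂ (T.emb₁ b) + T.emb₂ (T.emb₁ (C (L e))) - z₀ • L e = T.emb₂ (T.emb₁ e) := by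
  set S := T.perturb A (T.boundedOnDomain A C₁) with hSdef
  set G := (T.extension A).graph with hG
  obtain ⟨b, hbc, hb⟩ := exists_compact_on_graph hB
  let j : E →L[ℂ] F := T.emb₂ ∘L T.emb₁
  -- For `z` in the resolvent set this is x ↦ (R x, Â R x), with Â R eliminated through (A + C₁ - z)
  -- R = 1. In this form the second component is visibly bounded and converges with the first.
  let Γ : ℂ → X →L[ℂ] F × F := fun z =>
    (T.emb₂ ∘L resolventOp S z).prod
      (T.emb₂ + z • (T.emb₂ ∘L resolventOp S z) - j ∘L C₁ ∘L T.emb₂ ∘L resolventOp S z)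
  let Γ₀ : E →L[ℂ] F × F := L₁.prod (j + z₀ • L₁ - j ∘L C₁ ∘L L₁)
  have hL₂ : Tendsto (fun z => j + z • T.resolventEF S z - j ∘L C₁ ∘L T.resolventEF S z)
      (𝓝[Ω] z₀) (𝓝 (j + z₀ • L₁ - j ∘L C₁ ∘L L₁)) :=
    ((tendsto_nhdsWithin_of_tendsto_nhds tendsto_id |>.smul hL).const_add j).sub
      (tendsto_const_comp (j ∘L C₁) hL)
  have hΓ : Tendsto (fun z => ‖Γ z ∘L T.emb₁ - Γ₀‖) (𝓝[Ω] z₀) (𝓝 0) := by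
    have h1 := (tendsto_iff_norm_sub_tendsto_zero.mp hL).max
      (tendsto_iff_norm_sub_tendsto_zero.mp hL₂)
    rw [max_self] at h1
    exact h1.congr fun z => (ContinuousLinearMap.opNorm_prod (𝕜 := ℂ)
      (T.resolventEF S z - L₁) ((j + z • T.resolventEF S z - j ∘L C₁ ∘L T.resolventEF S z) -
        (j + z₀ • L₁ - j ∘L C₁ ∘L L₁))).symm
  have hmem : ∀ z ∈ resolventSet S, ∀ x, Γ z x ∈ G := by
    intro z hz x
    have h := (isResolventAt_perturb_iff T A).mp (isResolventAt_resolventOp hz)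
    obtain ⟨hd, hx⟩ := h.1 x
    rw [boundedOnDomain_apply] at hx
    have := T.emb₂_mem_graph_extension A ⟨_, hd⟩
    have h2 : A ⟨_, hd⟩ = x + z • resolventOp S z x -
        T.emb₁ (C₁ (T.emb₂ (resolventOp S z x))) := by
      rw [eq_sub_iff_add_eq, ← sub_eq_iff_eq_add]
      exact hx
    rw [h2] at this
    rwa [map_sub, map_add, map_smul] at this
  -- Here the closedness of Â enters: the limit pair stays on the graph.
  have hmem₀ : ∀ e, Γ₀ e ∈ G := by
    intro e
    have : Tendsto (fun z => Γ z (T.emb₁ e)) (𝓝[Ω] z₀) (𝓝 (Γ₀ e)) :=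
      (((ContinuousLinearMap.apply ℂ F e).continuous.tendsto L₁).comp hL).prodMk_nhds
        (((ContinuousLinearMap.apply ℂ F e).continuous.tendsto _).comp hL₂)
    exact IsClosed.mem_of_tendsto hA this (hS.mono fun z hz => hmem z hz _)
  -- If L₁ e = 0, the limit pair is (0, j e); a graph containing it forces j e = 0.
  have hinj : Function.Injective L₁ := by
    refine (injective_iff_map_eq_zero L₁).mpr fun e he => ?_
    have h := hmem₀ e
    have h2 : Γ₀ e = (0, j e) := by
      simp [Γ₀, he]
    rw [h2] at h
    have h3 : j e = 0 := LinearPMap.graph_fst_eq_zero_snd _ h rfl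
    exact T.emb₁_injective (T.emb₂_injective (by rw [map_zero, map_zero]; exact h3))
  -- This is B L₁, compact because `B` is compact on the graph of Â.
  let bΓ : E →L[ℂ] E := b ∘L Γ₀.codRestrict G hmem₀
  obtain ⟨C', hC', hlt⟩ := exists_finiteRank_norm_add_comp_lt (K := bΓ)
    (hbc.comp_clm (Γ₀.codRestrict G hmem₀)) hinj
  set K := bΓ + C' ∘L L₁ with hK
  have hu : IsUnit (1 + K) := by
    have := isUnit_one_sub_of_norm_lt_one (x := -K) (by rwa [norm_neg])
    rwa [sub_neg_eq_add] at this
  classical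
  -- The branch 0 is a filler: for `z` in the resolvent set, hence eventually, the membership holds
  -- and `N z` is (B + C') R.
  let N : ℂ → X →L[ℂ] E := fun z =>
    (if h : ∀ x, Γ z x ∈ G then b ∘L (Γ z).codRestrict G h else 0) +
      C' ∘L T.emb₂ ∘L resolventOp S z
  have hNval : ∀ z (hz : z ∈ resolventSet S) x,
      N z x = b ⟨Γ z x, hmem z hz x⟩ + C' (T.emb₂ (resolventOp S z x)) := by
    intro z hz x
    simp only [N, dif_pos (hmem z hz)]
    rfl
  have hNK : Tendsto (fun z => N z ∘L T.emb₁) (𝓝[Ω] z₀) (𝓝 K) := by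
    have h1 : Tendsto (fun z => ‖b‖ * ‖Γ z ∘L T.emb₁ - Γ₀‖ +
        ‖C' ∘L T.resolventEF S z - C' ∘L L₁‖) (𝓝[Ω] z₀) (𝓝 0) := by
      have h2 := hΓ.const_mul ‖b‖
      have h3 := tendsto_iff_norm_sub_tendsto_zero.mp (tendsto_const_comp C' hL)
      simpa using h2.add h3
    rw [tendsto_iff_norm_sub_tendsto_zero]
    refine squeeze_zero' (Eventually.of_forall fun z => norm_nonneg _) ?_ h1
    filter_upwards [hS] with z hz
    refine ContinuousLinearMap.opNorm_le_bound _ (by positivity) fun e => ?_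
    have : (N z ∘L T.emb₁ - K) e = b (⟨Γ z (T.emb₁ e), hmem z hz _⟩ - ⟨Γ₀ e, hmem₀ e⟩) +
        (C' ∘L T.resolventEF S z - C' ∘L L₁) e := by
      rw [map_sub]
      change N z (T.emb₁ e) - (b ⟨Γ₀ e, hmem₀ e⟩ + C' (L₁ e)) = _
      rw [hNval z hz]
      change _ = _ + (C' (T.emb₂ (resolventOp S z (T.emb₁ e))) - C' (L₁ e))
      abel
    rw [this, add_mul]
    refine (norm_add_le _ _).trans (add_le_add ?_ (ContinuousLinearMap.le_opNorm _ _))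
    refine (b.le_opNorm _).trans ?_
    rw [mul_assoc]
    gcongr
    exact (Γ z ∘L T.emb₁ - Γ₀).le_opNorm e
  have hN : ∀ᶠ z in 𝓝[Ω] z₀, ∀ x (hx : resolventOp S z x ∈ A.domain), N z x =
      (T.restrictToDomain A B hdom + T.boundedOnDomain A (C' + C₁)) ⟨_, hx⟩ -
        T.boundedOnDomain A C₁ ⟨_, hx⟩ := by
    filter_upwards [hS] with z hz x hx
    rw [hNval z hz]
    have h1 : b ⟨Γ z x, hmem z hz x⟩ = T.restrictToDomain A B hdom ⟨_, hx⟩ :=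
      LinearPMap.mem_graph_snd_inj B (hb ⟨Γ z x, hmem z hz x⟩)
        (LinearPMap.mem_graph B ⟨T.emb₂ (resolventOp S z x), hdom ⟨_, hx⟩⟩) rfl
    rw [h1, LinearMap.add_apply, boundedOnDomain_apply, boundedOnDomain_apply, add_apply]
    abel
  obtain ⟨hS', hL'⟩ := tendsto_resolventEF_perturb hS hL hN hNK hu
  -- `N` encodes adding B + C' to A + C₁, so the total finite rank term is C' + C₁.
  refine ⟨C' + C₁, L₁ ∘L Ring.inverse (1 + K), ?_, hS', hL', fun e => ?_⟩
  · have hle : LinearMap.range ((C' + C₁ : F →L[ℂ] E) : F →ₗ[ℂ] E) ≤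
        LinearMap.range (C' : F →ₗ[ℂ] E) ⊔ LinearMap.range (C₁ : F →ₗ[ℂ] E) := by
      rintro _ ⟨x, rfl⟩
      exact Submodule.add_mem_sup ⟨x, rfl⟩ ⟨x, rfl⟩
    exact Submodule.finiteDimensional_of_le hle
  -- Here L e = L₁ f and e = f + B L₁ f + C' L₁ f, so the limit equation follows from the one
  -- satisfied by L₁ f.
  · set f := Ring.inverse (1 + K) e with hf
    have hfe : f + (b ⟨Γ₀ f, hmem₀ f⟩ + C' (L₁ f)) = e :=
      DFunLike.congr_fun (Ring.mul_inverse_cancel _ hu) e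
    refine ⟨(Γ₀ f).2, b ⟨Γ₀ f, hmem₀ f⟩, hmem₀ f, hb ⟨Γ₀ f, hmem₀ f⟩, ?_⟩
    change (j f + z₀ • L₁ f - j (C₁ (L₁ f))) + j _ + j (C' (L₁ f) + C₁ (L₁ f)) - z₀ • L₁ f = j e
    rw [← hfe]
    simp only [map_add]
    abel

end Regularization

/-! ### The abstract dichotomy -/

section Dichotomy

variable {E X F : Type*}
  [NormedAddCommGroup E] [InnerProductSpace ℂ E] [CompleteSpace E]
  [NormedAddCommGroup X] [NormedSpace ℂ X]
  [NormedAddCommGroup F] [InnerProductSpace ℂ F] [CompleteSpace F]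
  {T : EmbeddedTriple E X F} {A : X →ₗ.[ℂ] X}

/-- If a finite rank perturbation of `A` has resolvents converging in norm, then `A + B` either has
resolvents converging in norm and no virtual states, or violates the limiting absorption principle
and has a virtual state. -/
theorem virtualState_dichotomy (hA : (T.extension A).IsClosed) {Ω : Set ℂ} {z₀ : ℂ}
    [(𝓝[Ω] z₀).NeBot] {C₁ : F →L[ℂ] E}
    [FiniteDimensional ℂ (LinearMap.range (C₁ : F →ₗ[ℂ] E))] {L₁ : E →L[ℂ] F}
    (hS : ∀ᶠ z in 𝓝[Ω] z₀, z ∈ resolventSet (T.perturb A (T.boundedOnDomain A C₁)))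
    (hL : Tendsto (fun z => T.resolventEF (T.perturb A (T.boundedOnDomain A C₁)) z)
      (𝓝[Ω] z₀) (𝓝 L₁))
    {B : F →ₗ.[ℂ] E} (hB : IsRelativelyCompact (T.extension A) B) :
    (T.SatisfiesLAP (A + T.perturbX B) Ω z₀ ∧
        T.ResolventConvergesUniformly (A + T.perturbX B) Ω z₀ ∧
        ¬ ∃ Ψ : F, T.IsVirtualState A B Ω z₀ Ψ) ∨
      (¬ T.SatisfiesLAP (A + T.perturbX B) Ω z₀ ∧
        ∃ Ψ : F, T.IsVirtualState A B Ω z₀ Ψ) := by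
  have hdom : ∀ u : A.domain, T.emb₂ u ∈ B.domain := fun u =>
    hB.1 (T.emb₂_mem_domain_extension A u)
  obtain ⟨C, L, hC, hS, hL, hLe⟩ := exists_finiteRank_regularization hA hS hL hB hdom
  set w := T.restrictToDomain A B hdom with hw
  have hAB : A + T.perturbX B = T.perturb A (w + T.boundedOnDomain A 0) := by
    rw [boundedOnDomain_zero, add_zero, hw, ← add_perturbX_eq]
  have hzero : FiniteDimensional ℂ (LinearMap.range ((0 : F →L[ℂ] E) : F →ₗ[ℂ] E)) := by
    have : ((0 : F →L[ℂ] E) : F →ₗ[ℂ] E) = 0 := rfl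
    rw [this, LinearMap.range_zero]
    infer_instance
  have hCL : FiniteDimensional ℂ (LinearMap.range ((C ∘L L : E →L[ℂ] E) : E →ₗ[ℂ] E)) := by
    refine Submodule.finiteDimensional_of_le (S₂ := LinearMap.range (C : F →ₗ[ℂ] E)) ?_
    rintro _ ⟨x, rfl⟩
    exact ⟨L x, rfl⟩
  -- Everything is decided by 1 - C L on `E`, since A + B arises from A + B + C by subtracting C.
  have hiff := injective_iff_surjective_one_sub_of_finiteRank ((C ∘L L : E →L[ℂ] E) : E →ₗ[ℂ] E)
  have hval : ∀ x, (1 - ((C ∘L L : E →L[ℂ] E) : E →ₗ[ℂ] E) : E →ₗ[ℂ] E) x = x - C (L x) :=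
    fun x => rfl
  rw [hAB]
  by_cases hinj : Function.Injective (1 - ((C ∘L L : E →L[ℂ] E) : E →ₗ[ℂ] E) : E →ₗ[ℂ] E)
  · left
    have hu : IsUnit (1 + (-C) ∘L L) := by
      rw [ContinuousLinearMap.isUnit_iff_bijective]
      have : ⇑(1 + (-C) ∘L L) = ⇑(1 - ((C ∘L L : E →L[ℂ] E) : E →ₗ[ℂ] E) : E →ₗ[ℂ] E) := by
        ext x
        rw [hval]
        change x + -C (L x) = _
        rw [sub_eq_add_neg]
      rw [this]
      exact ⟨hinj, hiff.mp hinj⟩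
    obtain ⟨hS', hL'⟩ := tendsto_resolventEF_perturb
      (w₂ := w + T.boundedOnDomain A 0) hS hL
      (N := fun z => (-C) ∘L T.emb₂ ∘L resolventOp (T.perturb A (w + T.boundedOnDomain A C)) z)
      (Eventually.of_forall fun z x hx => by
        simp only [LinearMap.add_apply, boundedOnDomain_apply, zero_apply, add_zero,
          sub_add_cancel_left]
        rfl)
      (tendsto_const_comp (-C) hL) hu
    refine ⟨⟨_, hasWeakResolventLimit_of_tendsto hS' hL'⟩, ⟨_, hL'⟩, ?_⟩
    rintro ⟨Ψ, hΨ, ⟨hd, hΨ0⟩, D, hD, M, hM, f, rfl⟩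
    rw [add_perturbX_add_bounded_eq T A hdom] at hM
    have hMf := weakResolventLimit_eq hS hL hM f
    set g := f + (C (M f) - D (M f)) with hg
    obtain ⟨v, b, hv, hb, hvb⟩ := hLe g
    rw [← hMf] at hv hb hvb
    have h1 : v + T.emb₂ (T.emb₁ b) - z₀ • M f = 0 := by
      rw [← hΨ0]
      congr 1
      have hv' := LinearPMap.mem_graph_snd_inj _ hv
        (LinearPMap.mem_graph (T.extension A) ⟨M f, hd.1⟩) rfl
      have hb' := LinearPMap.mem_graph_snd_inj _ hb (LinearPMap.mem_graph B ⟨M f, hd.2⟩) rfl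
      rw [hv', hb']
      rfl
    -- The virtual state Ψ = M f equals L g, so (Â + B + C - z₀)Ψ = g. Subtracting (Â + B - z₀)Ψ = 0
    -- leaves C L g = g.
    have h2 : T.emb₂ (T.emb₁ (C (M f))) = T.emb₂ (T.emb₁ g) := by
      rw [← hvb, ← sub_eq_zero, ← neg_eq_zero, ← h1]
      abel
    have h3 : C (M f) = g := T.emb₁_injective (T.emb₂_injective h2)
    have h4 : g = 0 := by
      refine (injective_iff_map_eq_zero _).mp hinj g ?_
      rw [hval, ← hMf, h3, sub_self]
    exact hΨ (by rw [hMf, h4, map_zero])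
  · right
    refine ⟨?_, ?_⟩
    · rintro ⟨M, hM⟩
      -- A limit M of the resolvents of A + B satisfies M e = L(e + C M e), so x = e + C M e solves
      -- x - C L x = e.
      refine hinj (hiff.mpr fun e => ⟨e + C (M e), ?_⟩)
      have := weakResolventLimit_eq hS hL hM e
      rw [zero_apply, sub_zero] at this
      rw [hval, ← this, add_sub_cancel_right]
    · rw [injective_iff_map_eq_zero] at hinj
      push Not at hinj
      obtain ⟨e, he, he0⟩ := hinj
      rw [hval, sub_eq_zero] at he
      obtain ⟨v, b, hv, hb, hvb⟩ := hLe e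
      have hdA := LinearPMap.mem_domain_of_mem_graph hv
      have hdB := LinearPMap.mem_domain_of_mem_graph hb
      -- The kernel equation e = C L e shows that L e ≠ 0 and cancels C L e against the right-hand
      -- side e.
      refine ⟨L e, fun h => he0 (by rw [he, h, map_zero]), ⟨⟨hdA, hdB⟩, ?_⟩, C, hC, L, ?_, e, rfl⟩
      · have hv' := LinearPMap.mem_graph_snd_inj _ hv
          (LinearPMap.mem_graph (T.extension A) ⟨L e, hdA⟩) rfl
        have hb' := LinearPMap.mem_graph_snd_inj _ hb (LinearPMap.mem_graph B ⟨L e, hdB⟩) rfl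
        rw [← he] at hvb
        change T.extension A ⟨L e, hdA⟩ + T.emb₂ (T.emb₁ (B ⟨L e, hdB⟩)) - z₀ • L e = 0
        rw [← hv', ← hb']
        rw [add_sub_right_comm, add_eq_right] at hvb
        exact hvb
      · rw [add_perturbX_add_bounded_eq T A hdom]
        exact hasWeakResolventLimit_of_tendsto hS hL

end Dichotomy

end EmbeddedTriple

/-! ### The resolvent of (-i∂ₓ)³ as a Fourier multiplier -/

section FreeResolvent

open TemperedDistribution Real

/-- The symbol `2πξ` of the momentum operator. -/
def momentumSymbol (ξ : ℝ) : ℂ := ((2 * π * ξ : ℝ) : ℂ)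

theorem hasTemperateGrowth_momentumSymbol : momentumSymbol.HasTemperateGrowth := by
  unfold momentumSymbol
  fun_prop

theorem momentum_eq_fourierMultiplierCLM (f : 𝓢'(ℝ, ℂ)) :
    momentum f = fourierMultiplierCLM ℂ momentumSymbol f := by
  have h : momentumSymbol = (2 * π : ℂ) • fun x : ℝ => ((inner ℝ x (1 : ℝ) : ℝ) : ℂ) := by
    ext x
    simp [momentumSymbol]
  rw [momentum_apply, lineDeriv_eq_fourierMultiplierCLM, h,
    fourierMultiplierCLM_smul (by fun_prop), smul_smul]
  have : -Complex.I * (2 * π * Complex.I) = 2 * π := by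
    linear_combination (-2 * π : ℂ) * Complex.I_mul_I
  rw [this]
  rfl

theorem momentum_pow_eq_fourierMultiplierCLM (n : ℕ) (f : 𝓢'(ℝ, ℂ)) :
    (momentum ^ n) f = fourierMultiplierCLM ℂ (momentumSymbol ^ n) f := by
  induction n generalizing f with
  | zero =>
    have : (momentumSymbol ^ 0) = fun _ => (1 : ℂ) := rfl
    rw [this, fourierMultiplierCLM_const]
    simp
  | succ n ih =>
    rw [pow_succ', Module.End.mul_apply, momentum_eq_fourierMultiplierCLM, ih,
      fourierMultiplierCLM_fourierMultiplierCLM_apply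
        (hasTemperateGrowth_momentumSymbol.pow n) hasTemperateGrowth_momentumSymbol, pow_succ]

/-- The symbol `((2πξ)^n - z)⁻¹` of the resolvent of `(-i∂ₓ)^n`. -/
def resolventSymbol (n : ℕ) (z : ℂ) (ξ : ℝ) : ℂ := (momentumSymbol ξ ^ n - z)⁻¹

theorem momentumSymbol_pow_sub_ne_zero (n : ℕ) {z : ℂ} (hz : z.im ≠ 0) (ξ : ℝ) :
    momentumSymbol ξ ^ n - z ≠ 0 := by
  intro h
  apply hz
  have := congrArg Complex.im h
  rw [momentumSymbol, ← Complex.ofReal_pow, Complex.sub_im, Complex.ofReal_im] at this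
  simpa using this

theorem abs_im_le_norm_momentumSymbol_pow_sub (n : ℕ) (z : ℂ) (ξ : ℝ) :
    |z.im| ≤ ‖momentumSymbol ξ ^ n - z‖ := by
  have := Complex.abs_im_le_norm (momentumSymbol ξ ^ n - z)
  rw [momentumSymbol, ← Complex.ofReal_pow, Complex.sub_im, Complex.ofReal_im, zero_sub,
    abs_neg] at this
  rwa [momentumSymbol, ← Complex.ofReal_pow]

/-- Write a for the real symbol and h = (a - Re z)/Im z. Then |a - z|² = (Im z)²(1 + h²), so (a -
z)⁻¹ is the polynomial a - z̄ times (Im z)⁻² times the composition of (1 + |·|²)⁻¹ with the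
polynomial h. -/
theorem hasTemperateGrowth_resolventSymbol (n : ℕ) {z : ℂ} (hz : z.im ≠ 0) :
    (resolventSymbol n z).HasTemperateGrowth := by
  let h : ℝ → ℝ := fun ξ => ((2 * π * ξ) ^ n - z.re) * z.im⁻¹
  have hh : h.HasTemperateGrowth := by
    have h1 : (fun ξ : ℝ => 2 * π * ξ).HasTemperateGrowth := by fun_prop
    have h2 := h1.pow n
    exact (h2.sub (Function.HasTemperateGrowth.const z.re)).mul
      (Function.HasTemperateGrowth.const z.im⁻¹)
  have h1 : (fun ξ => (1 + ‖h ξ‖ ^ 2) ^ (-1 : ℝ)).HasTemperateGrowth :=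
    (Function.hasTemperateGrowth_one_add_norm_sq_rpow ℝ (-1)).comp hh
  have h2 : resolventSymbol n z = fun ξ =>
      (momentumSymbol ξ ^ n - (starRingEnd ℂ) z) *
        ((((1 + ‖h ξ‖ ^ 2) ^ (-1 : ℝ) : ℝ) : ℂ) * (z.im⁻¹ ^ 2 : ℂ)) := by
    ext ξ
    rw [resolventSymbol, Real.rpow_neg_one]
    refine inv_eq_iff_eq_inv.mpr ?_
    have hne := momentumSymbol_pow_sub_ne_zero n hz ξ
    have hne' := momentumSymbol_pow_sub_ne_zero n (z := (starRingEnd ℂ) z) (by simpa using hz) ξ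
    have hz' : (z.im : ℂ) ≠ 0 := by exact_mod_cast hz
    have hmul : (((1 + ‖h ξ‖ ^ 2 : ℝ)) : ℂ) * (z.im : ℂ) ^ 2 =
        (momentumSymbol ξ ^ n - z) * (momentumSymbol ξ ^ n - (starRingEnd ℂ) z) := by
      have hzz : z * (starRingEnd ℂ) z = ((z.re ^ 2 + z.im ^ 2 : ℝ) : ℂ) := by
        rw [Complex.mul_conj, Complex.normSq_apply]; push_cast; ring
      have hzc : z + (starRingEnd ℂ) z = ((2 * z.re : ℝ) : ℂ) := Complex.add_conj z
      have : (1 + ‖h ξ‖ ^ 2) * z.im ^ 2 = ((2 * π * ξ) ^ n) ^ 2 - (2 * π * ξ) ^ n * (2 * z.re) +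
          (z.re ^ 2 + z.im ^ 2) := by
        rw [Real.norm_eq_abs, sq_abs]
        simp only [h]
        field_simp
        ring
      rw [momentumSymbol, ← Complex.ofReal_pow, ← Complex.ofReal_pow, ← Complex.ofReal_mul, this]
      rw [Complex.ofReal_add, Complex.ofReal_sub, Complex.ofReal_mul, ← hzz, ← hzc]
      push_cast
      ring
    have hne2 : (((1 + ‖h ξ‖ ^ 2 : ℝ)) : ℂ) ≠ 0 := by
      have : (0 : ℝ) < 1 + ‖h ξ‖ ^ 2 := by positivity
      exact_mod_cast this.ne'
    simp only [Complex.ofReal_inv]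
    refine eq_inv_of_mul_eq_one_right ?_
    rw [mul_comm, ← mul_assoc, ← hmul]
    field_simp
  rw [h2]
  have h3 : (fun ξ => ((((1 + ‖h ξ‖ ^ 2) ^ (-1 : ℝ) : ℝ) : ℂ))).HasTemperateGrowth :=
    Function.HasTemperateGrowth.comp Function.Complex.hasTemperateGrowth_ofReal h1
  exact ((hasTemperateGrowth_momentumSymbol.pow n).sub (Function.HasTemperateGrowth.const _)).mul
    (h3.mul (Function.HasTemperateGrowth.const _))

theorem fourierMultiplierCLM_resolventSymbol (n : ℕ) {z : ℂ} (hz : z.im ≠ 0) (v : 𝓢'(ℝ, ℂ)) :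
    fourierMultiplierCLM ℂ (resolventSymbol n z) ((momentum ^ n) v - z • v) = v := by
  rw [momentum_pow_eq_fourierMultiplierCLM, map_sub, map_smul,
    fourierMultiplierCLM_fourierMultiplierCLM_apply (hasTemperateGrowth_momentumSymbol.pow n)
      (hasTemperateGrowth_resolventSymbol n hz)]
  have h1 : momentumSymbol ^ n * resolventSymbol n z =
      (fun _ => (1 : ℂ)) + z • resolventSymbol n z := by
    ext ξ
    have := momentumSymbol_pow_sub_ne_zero n hz ξ
    simp only [Pi.mul_apply, Pi.pow_apply, Pi.add_apply, Pi.smul_apply, resolventSymbol,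
      smul_eq_mul]
    field_simp
    ring
  have h2 : fourierMultiplierCLM ℂ ((fun _ => (1 : ℂ)) + z • resolventSymbol n z) v =
      v + z • fourierMultiplierCLM ℂ (resolventSymbol n z) v := by
    have hr := hasTemperateGrowth_resolventSymbol n hz
    rw [fourierMultiplierCLM_apply, smulLeftCLM_add (Function.HasTemperateGrowth.const 1)
      (by exact (Function.HasTemperateGrowth.const z).mul hr), smulLeftCLM_smul hr]
    simp [fourierMultiplierCLM_apply, FourierTransform.fourierInv_add,
      FourierTransform.fourierInv_smul]
  rw [h1, h2, add_sub_cancel_right]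

theorem momentum_pow_fourierMultiplierCLM_resolventSymbol (n : ℕ) {z : ℂ} (hz : z.im ≠ 0)
    (v : 𝓢'(ℝ, ℂ)) :
    (momentum ^ n) (fourierMultiplierCLM ℂ (resolventSymbol n z) v) -
      z • fourierMultiplierCLM ℂ (resolventSymbol n z) v = v := by
  have h := fourierMultiplierCLM_resolventSymbol n hz v
  rw [map_sub, map_smul, momentum_pow_eq_fourierMultiplierCLM,
    fourierMultiplierCLM_fourierMultiplierCLM_apply (hasTemperateGrowth_momentumSymbol.pow n)
      (hasTemperateGrowth_resolventSymbol n hz)] at h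
  rw [momentum_pow_eq_fourierMultiplierCLM,
    fourierMultiplierCLM_fourierMultiplierCLM_apply (hasTemperateGrowth_resolventSymbol n hz)
      (hasTemperateGrowth_momentumSymbol.pow n), mul_comm]
  exact h

/-- Fourier multipliers with bounded symbol act on `L²`. -/
theorem exists_fourierMultiplier_L2 {g : ℝ → ℂ} (hg : g.HasTemperateGrowth) {c : ℝ}
    (hc : ∀ x, ‖g x‖ ≤ c) :
    ∃ R : Lp ℂ 2 (volume : Measure ℝ) →L[ℂ] Lp ℂ 2 (volume : Measure ℝ),
      ∀ f, (R f : 𝓢'(ℝ, ℂ)) = fourierMultiplierCLM ℂ g (f : 𝓢'(ℝ, ℂ)) := by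
  have hgm : MemLp g ⊤ (volume : Measure ℝ) :=
    memLp_top_of_bound hg.1.continuous.aestronglyMeasurable c (Eventually.of_forall hc)
  let U := Lp.fourierTransformₗᵢ ℝ ℂ
  let m : Lp ℂ 2 (volume : Measure ℝ) →L[ℂ] Lp ℂ 2 (volume : Measure ℝ) :=
    (ContinuousLinearMap.lsmul ℂ ℂ).holderL volume ⊤ 2 2 (hgm.toLp g)
  refine ⟨(U.symm : Lp ℂ 2 (volume : Measure ℝ) →L[ℂ] Lp ℂ 2 (volume : Measure ℝ)) ∘L m ∘L
    (U : Lp ℂ 2 (volume : Measure ℝ) →L[ℂ] Lp ℂ 2 (volume : Measure ℝ)), fun f => ?_⟩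
  have h1 : ∀ h, m h = (hgm.toLp g) • h := fun h => rfl
  change ((FourierTransformInv.fourierInv (m (FourierTransform.fourier f)) :
    Lp ℂ 2 (volume : Measure ℝ)) : 𝓢'(ℝ, ℂ)) = _
  rw [← Lp.fourierInv_toTemperedDistribution_eq, h1, Lp.toTemperedDistribution_smul_eq hg hgm,
    ← Lp.fourier_toTemperedDistribution_eq, fourierMultiplierCLM_apply]

/-- This bound puts the range of the resolvent in H³: |ξ|³ is controlled by the denominator plus
|z|, and constants by the denominator divided by |Im z|. -/
theorem norm_bessel_mul_resolventSymbol_le {z : ℂ} (hz : z.im ≠ 0) (ξ : ℝ) :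
    ‖(((1 + ‖ξ‖ ^ 2) ^ ((3 : ℝ) / 2) : ℝ) : ℂ) * resolventSymbol 3 z ξ‖ ≤
      3 * ((1 + ‖z‖) / |z.im| + 1) := by
  have hne := norm_pos_iff.mpr (momentumSymbol_pow_sub_ne_zero 3 hz ξ)
  have hy : 0 < |z.im| := abs_pos.mpr hz
  rw [norm_mul, resolventSymbol, norm_inv, ← div_eq_mul_inv, div_le_iff₀ hne, Complex.norm_real,
    Real.norm_of_nonneg (by positivity)]
  -- Both sides are compared through their squares: (1 + a²)³ ≤ 9(1 + a³)².
  have h1 : (1 + ‖ξ‖ ^ 2) ^ ((3 : ℝ) / 2) ≤ 3 * (1 + |ξ| ^ 3) := by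
    rw [← Real.sqrt_sq (show 0 ≤ 3 * (1 + |ξ| ^ 3) by positivity), div_eq_mul_inv,
      Real.rpow_mul (by positivity), ← one_div, ← Real.sqrt_eq_rpow]
    refine Real.sqrt_le_sqrt ?_
    norm_cast
    rw [Real.norm_eq_abs]
    set a := |ξ|
    have ha : 0 ≤ a := abs_nonneg ξ
    nlinarith [sq_nonneg (a ^ 3 - 1), sq_nonneg (a ^ 2 - 1), sq_nonneg (a - 1), pow_nonneg ha 3,
      pow_nonneg ha 2, sq_nonneg (a * (a - 1)), sq_nonneg (a * (a ^ 2 - 1)), pow_nonneg ha 4,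
      pow_nonneg ha 6]
  have h2 : |ξ| ^ 3 ≤ ‖momentumSymbol ξ ^ 3 - z‖ + ‖z‖ := by
    have h3 : ‖momentumSymbol ξ ^ 3‖ ≤ ‖momentumSymbol ξ ^ 3 - z‖ + ‖z‖ := by
      conv_lhs => rw [← sub_add_cancel (momentumSymbol ξ ^ 3) z]
      exact norm_add_le _ _
    refine le_trans ?_ h3
    rw [norm_pow, momentumSymbol, Complex.norm_real, Real.norm_eq_abs, abs_mul]
    have : 1 ≤ |2 * π| := by
      rw [abs_of_pos (by positivity)]; linarith [Real.pi_gt_three]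
    gcongr
    nlinarith [abs_nonneg ξ]
  have h3 : 1 + ‖z‖ ≤ (1 + ‖z‖) / |z.im| * ‖momentumSymbol ξ ^ 3 - z‖ := by
    rw [div_mul_eq_mul_div, le_div_iff₀ hy]
    gcongr
    exact abs_im_le_norm_momentumSymbol_pow_sub 3 z ξ
  calc _ ≤ 3 * (1 + |ξ| ^ 3) := h1
    _ ≤ 3 * ((1 + ‖z‖) / |z.im| * ‖momentumSymbol ξ ^ 3 - z‖ + ‖momentumSymbol ξ ^ 3 - z‖) := by
        refine mul_le_mul_of_nonneg_left ?_ (by norm_num)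
        linarith
    _ = _ := by ring

/-- The resolvent of `(-i∂ₓ)³` is a Fourier multiplier. -/
theorem exists_resolvent_momentumPow {z : ℂ} (hz : z.im ≠ 0) :
    ∃ R : Lp ℂ 2 (volume : Measure ℝ) →L[ℂ] Lp ℂ 2 (volume : Measure ℝ),
      IsResolventAt (momentumPow 3) z R ∧
      ∀ (f v : Lp ℂ 2 (volume : Measure ℝ)),
        (momentum ^ 3) (v : 𝓢'(ℝ, ℂ)) - z • (v : 𝓢'(ℝ, ℂ)) = (f : 𝓢'(ℝ, ℂ)) → R f = v := by
  have hy : 0 < |z.im| := abs_pos.mpr hz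
  obtain ⟨R, hR⟩ := exists_fourierMultiplier_L2 (hasTemperateGrowth_resolventSymbol 3 hz)
    (c := |z.im|⁻¹) fun ξ => by
      rw [resolventSymbol, norm_inv]
      exact inv_anti₀ hy (abs_im_le_norm_momentumSymbol_pow_sub 3 z ξ)
  -- The multiplier inverts the symbol on all tempered distributions, so any L² solution of the
  -- distributional equation is R f, with no Sobolev regularity assumed. The Green function is
  -- identified this way later.
  have huniq : ∀ (f v : Lp ℂ 2 (volume : Measure ℝ)),
      (momentum ^ 3) (v : 𝓢'(ℝ, ℂ)) - z • (v : 𝓢'(ℝ, ℂ)) = (f : 𝓢'(ℝ, ℂ)) → R f = v := by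
    intro f v h
    apply toTemperedDistributionCLM_injective
    rw [Lp.toTemperedDistributionCLM_apply, Lp.toTemperedDistributionCLM_apply, hR, ← h,
      fourierMultiplierCLM_resolventSymbol 3 hz]
  refine ⟨R, ⟨fun f => ?_, fun u => ?_⟩, huniq⟩
  · have hmem : R f ∈ (momentumPow 3).domain := by
      change MemSobolev ((3 : ℕ) : ℝ) 2 (R f : 𝓢'(ℝ, ℂ))
      have h0 : MemSobolev 0 2 (f : 𝓢'(ℝ, ℂ)) := memSobolev_zero_iff.mpr ⟨f, rfl⟩
      have hb : (fun x : ℝ => (((1 + ‖x‖ ^ 2) ^ ((3 : ℝ) / 2) : ℝ) : ℂ)).HasTemperateGrowth := by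
        fun_prop
      have h1 := h0.fourierMultiplierCLM_of_bounded (F := ℂ)
        ((hasTemperateGrowth_resolventSymbol 3 hz).mul hb)
        ⟨_, fun ξ => by
          have := norm_bessel_mul_resolventSymbol_le hz ξ
          rwa [mul_comm] at this⟩
      have h2 : MemSobolev 0 2 (besselPotential ℝ ℂ 3 (R f : 𝓢'(ℝ, ℂ))) := by
        rw [hR, besselPotential, fourierMultiplierCLM_fourierMultiplierCLM_apply
          (hasTemperateGrowth_resolventSymbol 3 hz) hb]
        exact h1
      rw [memSobolev_besselPotential_iff] at h2
      simpa using h2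
    refine ⟨hmem, ?_⟩
    apply toTemperedDistributionCLM_injective
    rw [map_sub, map_smul, Lp.toTemperedDistributionCLM_apply, Lp.toTemperedDistributionCLM_apply,
      Lp.toTemperedDistributionCLM_apply, momentumPow_apply]
    simp only [hR]
    exact momentum_pow_fourierMultiplierCLM_resolventSymbol 3 hz _
  · apply huniq
    rw [← momentumPow_apply, ← Lp.toTemperedDistributionCLM_apply,
      ← Lp.toTemperedDistributionCLM_apply, ← Lp.toTemperedDistributionCLM_apply, map_sub, map_smul]

end FreeResolvent

/-! ### The Green function and its bounds -/

section Kernel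

/-- The function `t ↦ exp(i a t)`. -/
def planeWave (a : ℂ) (t : ℝ) : ℂ := Complex.exp (Complex.I * a * t)

theorem planeWave_zero (a : ℂ) : planeWave a 0 = 1 := by simp [planeWave]

theorem hasDerivAt_planeWave (a : ℂ) (t : ℝ) :
    HasDerivAt (planeWave a) (Complex.I * a * planeWave a t) t := by
  have h1 : HasDerivAt (fun t : ℝ => Complex.I * a * (t : ℂ)) (Complex.I * a * 1) t :=
    (Complex.ofRealCLM.hasDerivAt (x := t)).const_mul _
  have := h1.cexp
  rwa [mul_one, mul_comm (Complex.exp _)] at this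

theorem continuous_planeWave (a : ℂ) : Continuous (planeWave a) :=
  continuous_iff_continuousAt.mpr fun t => (hasDerivAt_planeWave a t).continuousAt

theorem norm_planeWave (a : ℂ) (t : ℝ) : ‖planeWave a t‖ = Real.exp (-(a.im * t)) := by
  rw [planeWave, Complex.norm_exp]
  simp

theorem norm_planeWave_le_one {a : ℂ} {t : ℝ} (h : 0 ≤ a.im * t) : ‖planeWave a t‖ ≤ 1 := by
  rw [norm_planeWave, Real.exp_le_one_iff]
  linarith

/-- On the half-line where the wave does not grow, its derivative is at most ‖a‖; this is the mean
value inequality there. -/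
theorem norm_planeWave_sub_le_of_nonneg {a : ℂ} (ha : 0 ≤ a.im) {t u : ℝ} (ht : 0 ≤ t)
    (hu : 0 ≤ u) : ‖planeWave a t - planeWave a u‖ ≤ ‖a‖ * |t - u| := by
  refine (convex_Ici (0 : ℝ)).norm_image_sub_le_of_norm_hasDerivWithin_le
    (fun x _ => (hasDerivAt_planeWave a x).hasDerivWithinAt) (fun x hx => ?_) hu ht
  rw [norm_mul, norm_mul, Complex.norm_I, one_mul]
  exact mul_le_of_le_one_right (norm_nonneg a)
    (norm_planeWave_le_one (mul_nonneg ha hx))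

theorem norm_planeWave_sub_le_of_nonpos {a : ℂ} (ha : a.im ≤ 0) {t u : ℝ} (ht : t ≤ 0)
    (hu : u ≤ 0) : ‖planeWave a t - planeWave a u‖ ≤ ‖a‖ * |t - u| := by
  refine (convex_Iic (0 : ℝ)).norm_image_sub_le_of_norm_hasDerivWithin_le
    (fun x _ => (hasDerivAt_planeWave a x).hasDerivWithinAt) (fun x hx => ?_) hu ht
  rw [norm_mul, norm_mul, Complex.norm_I, one_mul]
  exact mul_le_of_le_one_right (norm_nonneg a)
    (norm_planeWave_le_one (mul_nonneg_of_nonpos_of_nonpos ha hx))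

theorem norm_planeWave_sub_taylor_le (a : ℂ) (t : ℝ) :
    ‖planeWave a t - (1 + Complex.I * a * t + (Complex.I * a * t) ^ 2 / 2)‖ ≤
      (‖a‖ * |t|) ^ 3 * Real.exp (‖a‖ * |t|) := by
  have := Complex.norm_exp_sub_sum_le_norm_mul_exp (Complex.I * a * t) 3
  simpa [Finset.sum_range_succ, planeWave] using this

/-- `ω` is a primitive cube root of unity, `ζ` and `ω ζ` lie in the open upper half-plane, and
`ω² ζ` lies in the open lower half-plane. -/
structure IsSectorRoot (ω ζ : ℂ) : Prop where
  root : 1 + ω + ω ^ 2 = 0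
  im_pos : 0 < ζ.im
  im_mul_pos : 0 < (ω * ζ).im
  im_sq_mul_neg : (ω ^ 2 * ζ).im < 0

/-- The Green function of `(-i∂ₓ)³ - ζ³`. -/
def greenKernel (ω ζ : ℂ) (t : ℝ) : ℂ :=
  Complex.I / (3 * ζ ^ 2) * (planeWave ζ (max t 0) + ω * planeWave (ω * ζ) (max t 0) -
    ω ^ 2 * planeWave (ω ^ 2 * ζ) (min t 0) + ω ^ 2)

/-- The derivative of `greenKernel`. -/
def greenKernelDeriv (ω ζ : ℂ) (t : ℝ) : ℂ :=
  -(1 / (3 * ζ)) * (planeWave ζ (max t 0) + ω ^ 2 * planeWave (ω * ζ) (max t 0) -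
    ω * planeWave (ω ^ 2 * ζ) (min t 0) + ω)

/-- The line is the union of two closed half-lines, on each of which `h` is one of the smooth
branches; at 0 both branches apply and have the same derivative `h' 0`. -/
theorem hasDerivAt_of_glue {f g h f' g' h' : ℝ → ℂ} (hf : ∀ t, HasDerivAt f (f' t) t)
    (hg : ∀ t, HasDerivAt g (g' t) t) (h1 : ∀ t, 0 ≤ t → h t = f t) (h2 : ∀ t, t ≤ 0 → h t = g t)
    (h1' : ∀ t, 0 ≤ t → h' t = f' t) (h2' : ∀ t, t ≤ 0 → h' t = g' t) (t : ℝ) :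
    HasDerivAt h (h' t) t := by
  rw [← hasDerivWithinAt_univ, ← Set.Ici_union_Iic (a := (0 : ℝ))]
  refine HasDerivWithinAt.union ?_ ?_
  · by_cases ht : 0 ≤ t
    · rw [h1' t ht]
      exact (hf t).hasDerivWithinAt.congr (fun x hx => h1 x hx) (h1 t ht)
    · exact HasFDerivWithinAt.of_notMem_closure (by rwa [isClosed_Ici.closure_eq])
  · by_cases ht : t ≤ 0
    · rw [h2' t ht]
      exact (hg t).hasDerivWithinAt.congr (fun x hx => h2 x hx) (h2 t ht)
    · exact HasFDerivWithinAt.of_notMem_closure (by rwa [isClosed_Iic.closure_eq])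

namespace IsSectorRoot

variable {ω ζ : ℂ}

theorem cube (h : IsSectorRoot ω ζ) : ω ^ 3 = 1 := by linear_combination (ω - 1) * h.root

theorem norm_eq_one (h : IsSectorRoot ω ζ) : ‖ω‖ = 1 := by
  have := congrArg norm h.cube
  rw [norm_pow, norm_one] at this
  exact (pow_eq_one_iff_of_nonneg (norm_nonneg ω) (by norm_num)).mp this

theorem ne_zero (h : IsSectorRoot ω ζ) : ζ ≠ 0 := by
  rintro rfl
  exact lt_irrefl _ h.im_pos

/-- Waves truncated on the other side equal 1 here and cancel with the added constant; for t ≤ 0 the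
cancellation is 1 + ω + ω² = 0. The one-formula version spares case splits in the Lipschitz
estimates. -/
theorem greenKernel_of_nonneg {t : ℝ} (ht : 0 ≤ t) : greenKernel ω ζ t =
    Complex.I / (3 * ζ ^ 2) * (planeWave ζ t + ω * planeWave (ω * ζ) t) := by
  rw [greenKernel, max_eq_left ht, min_eq_right ht, planeWave_zero]
  ring

theorem greenKernel_of_nonpos (h : IsSectorRoot ω ζ) {t : ℝ} (ht : t ≤ 0) : greenKernel ω ζ t =
    Complex.I / (3 * ζ ^ 2) * (-ω ^ 2 * planeWave (ω ^ 2 * ζ) t) := by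
  rw [greenKernel, max_eq_right ht, min_eq_left ht, planeWave_zero, planeWave_zero]
  linear_combination Complex.I / (3 * ζ ^ 2) * h.root

theorem hasDerivAt_greenKernel (h : IsSectorRoot ω ζ) (t : ℝ) :
    HasDerivAt (greenKernel ω ζ) (greenKernelDeriv ω ζ t) t := by
  have hζ := h.ne_zero
  refine hasDerivAt_of_glue
    (fun t => (((hasDerivAt_planeWave ζ t).add ((hasDerivAt_planeWave (ω * ζ) t).const_mul ω)
      ).const_mul (Complex.I / (3 * ζ ^ 2))))
    (fun t => (((hasDerivAt_planeWave (ω ^ 2 * ζ) t).const_mul (-ω ^ 2)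
      ).const_mul (Complex.I / (3 * ζ ^ 2))))
    (fun t ht => greenKernel_of_nonneg ht) (fun t ht => h.greenKernel_of_nonpos ht)
    (fun t ht => ?_) (fun t ht => ?_) t
  · rw [greenKernelDeriv, max_eq_left ht, min_eq_right ht, planeWave_zero]
    generalize planeWave ζ t = p
    generalize planeWave (ω * ζ) t = q
    field_simp
    linear_combination (-p - ω ^ 2 * q) * Complex.I_sq
  · rw [greenKernelDeriv, max_eq_right ht, min_eq_left ht, planeWave_zero, planeWave_zero]
    generalize planeWave (ω ^ 2 * ζ) t = p
    field_simp
    linear_combination -h.root - p * ω * h.cube + ω ^ 4 * p * Complex.I_sq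

theorem continuous_greenKernel (h : IsSectorRoot ω ζ) : Continuous (greenKernel ω ζ) :=
  continuous_iff_continuousAt.mpr fun t => (h.hasDerivAt_greenKernel t).continuousAt

theorem norm_planeWave_sq_mul_le_one (h : IsSectorRoot ω ζ) (t : ℝ) :
    ‖planeWave (ω ^ 2 * ζ) (min t 0)‖ ≤ 1 :=
  norm_planeWave_le_one
    (mul_nonneg_of_nonpos_of_nonpos h.im_sq_mul_neg.le (min_le_right _ _))

theorem norm_greenKernel_le (h : IsSectorRoot ω ζ) (t : ℝ) :
    ‖greenKernel ω ζ t‖ ≤ 4 / (3 * ‖ζ‖ ^ 2) := by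
  have h1 : ‖planeWave ζ (max t 0)‖ ≤ 1 :=
    norm_planeWave_le_one (mul_nonneg h.im_pos.le (le_max_right _ _))
  have h2 : ‖planeWave (ω * ζ) (max t 0)‖ ≤ 1 :=
    norm_planeWave_le_one (mul_nonneg h.im_mul_pos.le (le_max_right _ _))
  have h3 := h.norm_planeWave_sq_mul_le_one t
  rw [greenKernel, norm_mul, norm_div, Complex.norm_I, norm_mul, norm_pow, Complex.norm_ofNat]
  calc _ ≤ 1 / (3 * ‖ζ‖ ^ 2) * (1 + 1 * 1 + 1 ^ 2 * 1 + 1 ^ 2) := by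
        gcongr
        refine (norm_add_le _ _).trans (add_le_add ((norm_sub_le _ _).trans
          (add_le_add ((norm_add_le _ _).trans (add_le_add h1 ?_)) ?_)) ?_)
        · rw [norm_mul, h.norm_eq_one]; gcongr
        · rw [norm_mul, norm_pow, h.norm_eq_one]; gcongr
        · rw [norm_pow, h.norm_eq_one]
    _ = _ := by ring

/-- Truncation at 0 is a contraction and each truncated wave is ‖ζ‖-Lipschitz. General unimodular
`a`, `b` serve the Green function and its derivative alike. -/
theorem norm_wave_comb_sub_le (h : IsSectorRoot ω ζ) {a b : ℂ} (ha : ‖a‖ = 1) (hb : ‖b‖ = 1)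
    (d : ℂ) (t u : ℝ) :
    ‖(planeWave ζ (max t 0) + a * planeWave (ω * ζ) (max t 0) -
        b * planeWave (ω ^ 2 * ζ) (min t 0) + d) -
      (planeWave ζ (max u 0) + a * planeWave (ω * ζ) (max u 0) -
        b * planeWave (ω ^ 2 * ζ) (min u 0) + d)‖ ≤ 3 * ‖ζ‖ * |t - u| := by
  have hmax : |max t 0 - max u 0| ≤ |t - u| := abs_max_sub_max_le_abs t u 0
  have hmin : |min t 0 - min u 0| ≤ |t - u| := by
    have := abs_min_sub_min_le_max t 0 u 0
    simpa using this
  have h1 := norm_planeWave_sub_le_of_nonneg h.im_pos.le (le_max_right t 0) (le_max_right u 0)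
  have h2 := norm_planeWave_sub_le_of_nonneg h.im_mul_pos.le (le_max_right t 0) (le_max_right u 0)
  have h3 := norm_planeWave_sub_le_of_nonpos h.im_sq_mul_neg.le (min_le_right t 0)
    (min_le_right u 0)
  rw [norm_mul, h.norm_eq_one, one_mul] at h2
  rw [norm_mul, norm_pow, h.norm_eq_one, one_pow, one_mul] at h3
  calc _ = ‖(planeWave ζ (max t 0) - planeWave ζ (max u 0)) +
        a * (planeWave (ω * ζ) (max t 0) - planeWave (ω * ζ) (max u 0)) -
        b * (planeWave (ω ^ 2 * ζ) (min t 0) - planeWave (ω ^ 2 * ζ) (min u 0))‖ := by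
        congr 1; ring
    _ ≤ ‖ζ‖ * |t - u| + ‖ζ‖ * |t - u| + ‖ζ‖ * |t - u| := by
        refine (norm_sub_le _ _).trans (add_le_add ((norm_add_le _ _).trans (add_le_add ?_ ?_)) ?_)
        · exact h1.trans (by gcongr)
        · rw [norm_mul, ha, one_mul]; exact h2.trans (by gcongr)
        · rw [norm_mul, hb, one_mul]; exact h3.trans (by gcongr)
    _ = _ := by ring

theorem norm_greenKernel_sub_le (h : IsSectorRoot ω ζ) (t u : ℝ) :
    ‖greenKernel ω ζ t - greenKernel ω ζ u‖ ≤ ‖ζ‖⁻¹ * |t - u| := by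
  have hζ : 0 < ‖ζ‖ := norm_pos_iff.mpr h.ne_zero
  rw [greenKernel, greenKernel, ← mul_sub, norm_mul, norm_div, Complex.norm_I, norm_mul, norm_pow,
    Complex.norm_ofNat]
  calc _ ≤ 1 / (3 * ‖ζ‖ ^ 2) * (3 * ‖ζ‖ * |t - u|) := by
        gcongr
        exact h.norm_wave_comb_sub_le h.norm_eq_one (by rw [norm_pow, h.norm_eq_one, one_pow]) _ t u
    _ = _ := by field_simp

/-- The prefactor 1/(3ζ) exactly absorbs the Lipschitz constant 3‖ζ‖, so this bound survives ζ → 0.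
-/
theorem norm_greenKernelDeriv_sub_le (h : IsSectorRoot ω ζ) (t u : ℝ) :
    ‖greenKernelDeriv ω ζ t - greenKernelDeriv ω ζ u‖ ≤ |t - u| := by
  have hζ : 0 < ‖ζ‖ := norm_pos_iff.mpr h.ne_zero
  rw [greenKernelDeriv, greenKernelDeriv, ← mul_sub, norm_mul, norm_neg, norm_div, norm_one,
    norm_mul, Complex.norm_ofNat]
  calc _ ≤ 1 / (3 * ‖ζ‖) * (3 * ‖ζ‖ * |t - u|) := by
        gcongr
        exact h.norm_wave_comb_sub_le (by rw [norm_pow, h.norm_eq_one, one_pow]) h.norm_eq_one _ t u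
    _ = _ := by field_simp

/-- A mixed second difference annihilates the singular affine part of the Green function. The mean
value inequality in the first variable reduces it to the Lipschitz bound on the derivative. -/
theorem norm_greenKernel_secondDifference_le (h : IsSectorRoot ω ζ) (x x' y w : ℝ) :
    ‖(greenKernel ω ζ (x - y) - greenKernel ω ζ (x - w)) -
      (greenKernel ω ζ (x' - y) - greenKernel ω ζ (x' - w))‖ ≤ |y - w| * |x - x'| := by
  have hd : ∀ a, HasDerivAt (fun a => greenKernel ω ζ (a - y) - greenKernel ω ζ (a - w))
      (greenKernelDeriv ω ζ (a - y) - greenKernelDeriv ω ζ (a - w)) a := fun a =>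
    ((h.hasDerivAt_greenKernel (a - y)).comp_sub_const a y).sub
      ((h.hasDerivAt_greenKernel (a - w)).comp_sub_const a w)
  refine convex_univ.norm_image_sub_le_of_norm_hasDerivWithin_le
    (fun a _ => (hd a).hasDerivWithinAt) (fun a _ => ?_) (Set.mem_univ x') (Set.mem_univ x)
  refine (h.norm_greenKernelDeriv_sub_le _ _).trans_eq ?_
  rw [sub_sub_sub_cancel_left, abs_sub_comm]

/-- The expansion of the Green function up to terms which vanish as `ζ → 0`. -/
theorem norm_greenKernel_sub_expansion_le (h : IsSectorRoot ω ζ) (t : ℝ) :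
    ‖greenKernel ω ζ t - -Complex.I * ω ^ 2 / (3 * ζ ^ 2) - ω / (3 * ζ) * t -
      -(Complex.I / 6) * (2 * (max t 0 : ℝ) ^ 2 - (min t 0 : ℝ) ^ 2)‖ ≤
      ‖ζ‖ * |t| ^ 3 * Real.exp (‖ζ‖ * |t|) := by
  have hζ : 0 < ‖ζ‖ := norm_pos_iff.mpr h.ne_zero
  have hζ' := h.ne_zero
  have hω := h.norm_eq_one
  have hmax : |max t 0| ≤ |t| := by simpa using abs_max_sub_max_le_abs t 0 0
  have hmin : |min t 0| ≤ |t| := by simpa using abs_min_sub_min_le_max t 0 0 0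
  have key : ∀ (a : ℂ) (r : ℝ), ‖a‖ = ‖ζ‖ → |r| ≤ |t| →
      ‖planeWave a r - (1 + Complex.I * a * r + (Complex.I * a * r) ^ 2 / 2)‖ ≤
        (‖ζ‖ * |t|) ^ 3 * Real.exp (‖ζ‖ * |t|) := by
    intro a r ha hr
    refine (norm_planeWave_sub_taylor_le a r).trans ?_
    rw [ha]
    gcongr
  have h1 := key ζ (max t 0) rfl hmax
  have h2 := key (ω * ζ) (max t 0) (by rw [norm_mul, hω, one_mul]) hmax
  have h3 := key (ω ^ 2 * ζ) (min t 0) (by rw [norm_mul, norm_pow, hω, one_pow, one_mul]) hmin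
  have ht : (t : ℂ) = (max t 0 : ℝ) + (min t 0 : ℝ) := by
    rw [← Complex.ofReal_add, max_add_min, add_zero]
  set p := planeWave ζ (max t 0)
  set q := planeWave (ω * ζ) (max t 0)
  set r := planeWave (ω ^ 2 * ζ) (min t 0)
  set M : ℂ := ((max t 0 : ℝ) : ℂ)
  set m : ℂ := ((min t 0 : ℝ) : ℂ)
  -- The Taylor coefficients use 1 + ω = -ω² at order 0, 1 + ω² = -ω and ω⁴ = ω at order 1 (where M
  -- + m = t), and ω³ = ω⁶ = 1 at order 2.
  have heq : greenKernel ω ζ t - -Complex.I * ω ^ 2 / (3 * ζ ^ 2) - ω / (3 * ζ) * t -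
      -(Complex.I / 6) * (2 * M ^ 2 - m ^ 2) = Complex.I / (3 * ζ ^ 2) *
      ((p - (1 + Complex.I * ζ * M + (Complex.I * ζ * M) ^ 2 / 2)) +
        ω * (q - (1 + Complex.I * (ω * ζ) * M + (Complex.I * (ω * ζ) * M) ^ 2 / 2)) -
        ω ^ 2 * (r - (1 + Complex.I * (ω ^ 2 * ζ) * m +
          (Complex.I * (ω ^ 2 * ζ) * m) ^ 2 / 2))) := by
    have hg : greenKernel ω ζ t = Complex.I / (3 * ζ ^ 2) * (p + ω * q - ω ^ 2 * r + ω ^ 2) := rfl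
    have hI3 : Complex.I ^ 3 = -Complex.I := Complex.I_pow_three
    rw [hg, ht]
    have h4 : ω ^ 4 = ω := by linear_combination ω * h.cube
    have h6 : ω ^ 6 = 1 := by linear_combination (ω ^ 3 + 1) * h.cube
    have h2' : ω ^ 2 = -1 - ω := by linear_combination h.root
    field_simp
    ring_nf
    simp only [hI3, Complex.I_sq, h4, h6, h.cube, h2']
    ring
  rw [heq, norm_mul, norm_div, Complex.norm_I, norm_mul, norm_pow, Complex.norm_ofNat]
  calc _ ≤ 1 / (3 * ‖ζ‖ ^ 2) * ((‖ζ‖ * |t|) ^ 3 * Real.exp (‖ζ‖ * |t|) +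
        (‖ζ‖ * |t|) ^ 3 * Real.exp (‖ζ‖ * |t|) + (‖ζ‖ * |t|) ^ 3 * Real.exp (‖ζ‖ * |t|)) := by
        gcongr
        refine (norm_sub_le _ _).trans (add_le_add ((norm_add_le _ _).trans (add_le_add h1 ?_)) ?_)
        · rw [norm_mul, hω, one_mul]; exact h2
        · rw [norm_mul, norm_pow, hω, one_pow, one_mul]; exact h3
    _ = _ := by field_simp; ring

theorem integrable_greenKernel (h : IsSectorRoot ω ζ) : Integrable (greenKernel ω ζ) := by
  rw [← integrableOn_univ, ← Set.Iic_union_Ioi (a := (0 : ℝ))]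
  refine IntegrableOn.union ?_ ?_
  · have h1 : IntegrableOn (planeWave (ω ^ 2 * ζ)) (Set.Iic 0) :=
      integrableOn_exp_mul_complex_Iic (by rw [Complex.I_mul_re]; linarith [h.im_sq_mul_neg]) 0
    exact IntegrableOn.congr_fun ((h1.const_mul (-ω ^ 2)).const_mul (Complex.I / (3 * ζ ^ 2)))
      (fun t ht => (h.greenKernel_of_nonpos ht).symm) measurableSet_Iic
  · have h1 : IntegrableOn (planeWave ζ) (Set.Ioi 0) :=
      integrableOn_exp_mul_complex_Ioi (by rw [Complex.I_mul_re]; linarith [h.im_pos]) 0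
    have h2 : IntegrableOn (planeWave (ω * ζ)) (Set.Ioi 0) :=
      integrableOn_exp_mul_complex_Ioi (by rw [Complex.I_mul_re]; linarith [h.im_mul_pos]) 0
    exact IntegrableOn.congr_fun ((h1.add (h2.const_mul ω)).const_mul (Complex.I / (3 * ζ ^ 2)))
      (fun t ht => (greenKernel_of_nonneg (le_of_lt ht)).symm) measurableSet_Ioi

end IsSectorRoot

end Kernel

/-! ### The Green function as the kernel of the resolvent -/

section GreenFunction

theorem hasDerivAt_schwartz (ψ : 𝓢(ℝ, ℂ)) (x : ℝ) : HasDerivAt ψ ((∂_{(1 : ℝ)} ψ) x) x := by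
  have h := ψ.hasDerivAt x
  have : (∂_{(1 : ℝ)} ψ) x = deriv ψ x := by
    rw [SchwartzMap.lineDerivOp_apply_eq_fderiv]
    rfl
  rwa [this]

theorem momentum_apply_apply (f : 𝓢'(ℝ, ℂ)) (ψ : 𝓢(ℝ, ℂ)) :
    momentum f ψ = f (Complex.I • ∂_{(1 : ℝ)} ψ) := by
  rw [momentum_apply]
  change (-Complex.I) • f (-∂_{(1 : ℝ)} ψ) = _
  simp

theorem momentum_cube_apply_apply (f : 𝓢'(ℝ, ℂ)) (ψ : 𝓢(ℝ, ℂ)) :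
    (momentum ^ 3) f ψ = f (-Complex.I • ∂_{(1 : ℝ)} (∂_{(1 : ℝ)} (∂_{(1 : ℝ)} ψ))) := by
  rw [pow_succ, pow_succ, pow_one, Module.End.mul_apply, Module.End.mul_apply,
    momentum_apply_apply, momentum_apply_apply, momentum_apply_apply]
  simp only [LineDeriv.lineDerivOp_smul, smul_smul]
  rw [show Complex.I * (Complex.I * Complex.I) = -Complex.I by
    linear_combination Complex.I * Complex.I_mul_I]

/-- The primitive used in the integration by parts against `exp(i a t)`. -/
def planeWavePrimitive (a : ℂ) (y : ℝ) (ψ : 𝓢(ℝ, ℂ)) (x : ℝ) : ℂ :=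
  -Complex.I * (planeWave a (x - y) * ((∂_{(1 : ℝ)} (∂_{(1 : ℝ)} ψ)) x -
    Complex.I * a * (∂_{(1 : ℝ)} ψ) x - a ^ 2 * ψ x))

/-- The intermediate terms telescope, so three integrations by parts are done at once. -/
theorem hasDerivAt_planeWavePrimitive (a : ℂ) (y : ℝ) (ψ : 𝓢(ℝ, ℂ)) (x : ℝ) :
    HasDerivAt (planeWavePrimitive a y ψ) (planeWave a (x - y) *
      (-Complex.I * (∂_{(1 : ℝ)} (∂_{(1 : ℝ)} (∂_{(1 : ℝ)} ψ))) x - a ^ 3 * ψ x)) x := by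
  have h0 := hasDerivAt_schwartz ψ x
  have h1 := hasDerivAt_schwartz (∂_{(1 : ℝ)} ψ) x
  have h2 := hasDerivAt_schwartz (∂_{(1 : ℝ)} (∂_{(1 : ℝ)} ψ)) x
  have hp := (hasDerivAt_planeWave a (x - y)).comp_sub_const x y
  have := (hp.mul ((h2.sub (h1.const_mul (Complex.I * a))).sub (h0.const_mul (a ^ 2)))).const_mul
    (-Complex.I)
  refine this.congr_deriv ?_
  simp only [Pi.sub_apply]
  linear_combination (planeWave a (x - y)) * a ^ 2 * ψ x * a * (Complex.I_sq) +
    Complex.I * planeWave a (x - y) * a ^ 2 * ((∂_{(1 : ℝ)} ψ) x) * Complex.I_sq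

theorem tendsto_planeWavePrimitive {a : ℂ} {y : ℝ} {ψ : 𝓢(ℝ, ℂ)} {l : Filter ℝ}
    (hl : l ≤ cocompact ℝ) (ha : ∀ᶠ x in l, ‖planeWave a (x - y)‖ ≤ 1) :
    Tendsto (planeWavePrimitive a y ψ) l (𝓝 0) := by
  have h0 := (ψ.tendsto_cocompact).mono_left hl
  have h1 := ((∂_{(1 : ℝ)} ψ).tendsto_cocompact).mono_left hl
  have h2 := ((∂_{(1 : ℝ)} (∂_{(1 : ℝ)} ψ)).tendsto_cocompact).mono_left hl
  have h3 := (h2.sub (h1.const_mul (Complex.I * a))).sub (h0.const_mul (a ^ 2))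
  simp only [mul_zero, sub_zero] at h3
  rw [tendsto_zero_iff_norm_tendsto_zero] at h3 ⊢
  refine squeeze_zero' (Eventually.of_forall fun x => norm_nonneg _) ?_ h3
  filter_upwards [ha] with x hx
  rw [planeWavePrimitive, norm_mul, norm_neg, Complex.norm_I, one_mul, norm_mul]
  exact mul_le_of_le_one_left (norm_nonneg _) hx

namespace IsSectorRoot

variable {ω ζ : ℂ}

theorem integrable_greenKernel_mul (h : IsSectorRoot ω ζ) (y : ℝ) (ψ : 𝓢(ℝ, ℂ)) :
    Integrable fun x => greenKernel ω ζ (x - y) * ψ x :=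
  ψ.integrable.bdd_mul
    (h.continuous_greenKernel.comp (continuous_sub_right y)).aestronglyMeasurable
    (Eventually.of_forall fun _ => h.norm_greenKernel_le _)

/-- `greenKernel` is a fundamental solution of `(-i∂ₓ)³ - ζ³`. -/
theorem integral_greenKernel_mul (h : IsSectorRoot ω ζ) (y : ℝ) (ψ : 𝓢(ℝ, ℂ)) :
    ∫ x, greenKernel ω ζ (x - y) *
      (-Complex.I * (∂_{(1 : ℝ)} (∂_{(1 : ℝ)} (∂_{(1 : ℝ)} ψ))) x - ζ ^ 3 * ψ x) = ψ y := by
  set χ : 𝓢(ℝ, ℂ) := -Complex.I • (∂_{(1 : ℝ)} (∂_{(1 : ℝ)} (∂_{(1 : ℝ)} ψ))) - ζ ^ 3 • ψ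
  have hχ : ∀ x, -Complex.I * (∂_{(1 : ℝ)} (∂_{(1 : ℝ)} (∂_{(1 : ℝ)} ψ))) x - ζ ^ 3 * ψ x = χ x :=
    fun x => rfl
  have hω := h.cube
  have c2 : (ω * ζ) ^ 3 = ζ ^ 3 := by linear_combination ζ ^ 3 * hω
  have c3 : (ω ^ 2 * ζ) ^ 3 = ζ ^ 3 := by linear_combination ζ ^ 3 * (ω ^ 3 + 1) * hω
  have hd : ∀ (a : ℂ), a ^ 3 = ζ ^ 3 → ∀ x, HasDerivAt (planeWavePrimitive a y ψ)
      (planeWave a (x - y) * χ x) x := fun a ha x => by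
    have := hasDerivAt_planeWavePrimitive a y ψ x
    rwa [ha, hχ] at this
  have hpos : ∀ a : ℂ, 0 ≤ a.im → a ^ 3 = ζ ^ 3 →
      IntegrableOn (fun x => planeWave a (x - y) * χ x) (Set.Ioi y) ∧
      ∫ x in Set.Ioi y, planeWave a (x - y) * χ x = -planeWavePrimitive a y ψ y := by
    intro a ha ha3
    have hint : IntegrableOn (fun x => planeWave a (x - y) * χ x) (Set.Ioi y) := by
      refine (χ.integrable.integrableOn).bdd_mul (c := 1)
        ((continuous_planeWave a).comp (continuous_sub_right y)).aestronglyMeasurable ?_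
      filter_upwards [ae_restrict_mem measurableSet_Ioi] with x hx
      exact norm_planeWave_le_one (mul_nonneg ha (sub_nonneg.mpr (le_of_lt hx)))
    refine ⟨hint, ?_⟩
    rw [integral_Ioi_of_hasDerivAt_of_tendsto (hd a ha3 y).continuousAt.continuousWithinAt
      (fun x _ => hd a ha3 x) hint (tendsto_planeWavePrimitive atTop_le_cocompact ?_), zero_sub]
    filter_upwards [eventually_ge_atTop y] with x hx
    exact norm_planeWave_le_one (mul_nonneg ha (sub_nonneg.mpr hx))
  have hneg : ∀ a : ℂ, a.im ≤ 0 → a ^ 3 = ζ ^ 3 →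
      IntegrableOn (fun x => planeWave a (x - y) * χ x) (Set.Iic y) ∧
      ∫ x in Set.Iic y, planeWave a (x - y) * χ x = planeWavePrimitive a y ψ y := by
    intro a ha ha3
    have hint : IntegrableOn (fun x => planeWave a (x - y) * χ x) (Set.Iic y) := by
      refine (χ.integrable.integrableOn).bdd_mul (c := 1)
        ((continuous_planeWave a).comp (continuous_sub_right y)).aestronglyMeasurable ?_
      filter_upwards [ae_restrict_mem measurableSet_Iic] with x hx
      exact norm_planeWave_le_one (mul_nonneg_of_nonpos_of_nonpos ha (sub_nonpos.mpr hx))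
    refine ⟨hint, ?_⟩
    rw [integral_Iic_of_hasDerivAt_of_tendsto (hd a ha3 y).continuousAt.continuousWithinAt
      (fun x _ => hd a ha3 x) hint (tendsto_planeWavePrimitive atBot_le_cocompact ?_), sub_zero]
    filter_upwards [eventually_le_atBot y] with x hx
    exact norm_planeWave_le_one (mul_nonneg_of_nonpos_of_nonpos ha (sub_nonpos.mpr hx))
  obtain ⟨i1, e1⟩ := hpos ζ h.im_pos.le rfl
  obtain ⟨i2, e2⟩ := hpos (ω * ζ) h.im_mul_pos.le c2
  obtain ⟨-, e3⟩ := hneg (ω ^ 2 * ζ) h.im_sq_mul_neg.le c3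
  simp_rw [hχ]
  rw [← intervalIntegral.integral_Iic_add_Ioi (b := y)
    (h.integrable_greenKernel_mul y χ).integrableOn (h.integrable_greenKernel_mul y χ).integrableOn]
  have E1 : ∫ x in Set.Iic y, greenKernel ω ζ (x - y) * χ x =
      Complex.I / (3 * ζ ^ 2) * (-ω ^ 2 * planeWavePrimitive (ω ^ 2 * ζ) y ψ y) := by
    rw [← e3, ← integral_const_mul, ← integral_const_mul]
    refine setIntegral_congr_fun measurableSet_Iic fun x hx => ?_
    simp only [h.greenKernel_of_nonpos (sub_nonpos.mpr hx)]
    ring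
  have E2 : ∫ x in Set.Ioi y, greenKernel ω ζ (x - y) * χ x =
      Complex.I / (3 * ζ ^ 2) * (-planeWavePrimitive ζ y ψ y +
        ω * -planeWavePrimitive (ω * ζ) y ψ y) := by
    rw [← e1, ← e2, ← integral_const_mul, ← integral_add i1 (i2.const_mul ω), ← integral_const_mul]
    refine setIntegral_congr_fun measurableSet_Ioi fun x hx => ?_
    simp only [greenKernel_of_nonneg (sub_nonneg.mpr (le_of_lt hx))]
    ring
  rw [E1, E2]
  -- Only boundary terms at y remain. In their sum the coefficients of ψ'' and ψ' are multiples of 1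
  -- + ω + ω² = 0, and the three terms in ψ(y) are equal.
  simp only [planeWavePrimitive, sub_self, planeWave_zero, one_mul]
  have hζ := h.ne_zero
  generalize (∂_{(1 : ℝ)} (∂_{(1 : ℝ)} ψ)) y = p
  generalize (∂_{(1 : ℝ)} ψ) y = q
  generalize ψ y = r
  have h4 : ω ^ 4 = ω := by linear_combination ω * h.cube
  have h6 : ω ^ 6 = 1 := by linear_combination (ω ^ 3 + 1) * h.cube
  have h2' : ω ^ 2 = -1 - ω := by linear_combination h.root
  field_simp
  ring_nf
  simp only [Complex.I_pow_three, Complex.I_sq, h4, h6, h.cube, h2']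
  ring

/-- The convolution of `greenKernel` with an integrable function. -/
theorem memLp_greenKernel_convolution (h : IsSectorRoot ω ζ) {f : ℝ → ℂ} (hf : Integrable f) :
    MemLp (fun x => ∫ y, greenKernel ω ζ (x - y) * f y) 2 (volume : Measure ℝ) := by
  have h1 : Integrable (fun x => ∫ y, greenKernel ω ζ (x - y) * f y) := by
    have := hf.integrable_convolution (ContinuousLinearMap.mul ℂ ℂ) h.integrable_greenKernel
    refine this.congr (Eventually.of_forall fun x => ?_)
    simp only [convolution_def, ContinuousLinearMap.mul_apply']
    simp_rw [mul_comm]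
  -- The convolution is integrable and bounded by c, hence |u|² ≤ c|u| is integrable.
  set c := 4 / (3 * ‖ζ‖ ^ 2) * ∫ y, ‖f y‖ with hc
  have hb : ∀ x, ‖∫ y, greenKernel ω ζ (x - y) * f y‖ ≤ c := by
    intro x
    rw [hc, ← integral_const_mul]
    refine norm_integral_le_of_norm_le (hf.norm.const_mul _) (Eventually.of_forall fun y => ?_)
    rw [norm_mul]
    gcongr
    exact h.norm_greenKernel_le _
  rw [memLp_two_iff_integrable_sq_norm h1.aestronglyMeasurable]
  refine (h1.norm.const_mul c).mono' (h1.aestronglyMeasurable.norm.pow 2)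
    (Eventually.of_forall fun x => ?_)
  rw [norm_pow, norm_norm, sq]
  gcongr
  exact hb x

theorem integrable_greenKernel_prod (h : IsSectorRoot ω ζ) {f g : ℝ → ℂ} (hf : Integrable f)
    (hg : Integrable g) :
    Integrable (fun p : ℝ × ℝ => greenKernel ω ζ (p.1 - p.2) * (g p.1 * f p.2)) :=
  (hg.mul_prod hf).bdd_mul
    (h.continuous_greenKernel.comp (continuous_fst.sub continuous_snd)).aestronglyMeasurable
    (Eventually.of_forall fun _ => h.norm_greenKernel_le _)

/-- The resolvent of `(-i∂ₓ)³` is the convolution with `greenKernel`. -/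
theorem resolvent_ae_eq (h : IsSectorRoot ω ζ)
    {R : Lp ℂ 2 (volume : Measure ℝ) →L[ℂ] Lp ℂ 2 (volume : Measure ℝ)}
    (hR : ∀ (f v : Lp ℂ 2 (volume : Measure ℝ)),
      (momentum ^ 3) (v : 𝓢'(ℝ, ℂ)) - ζ ^ 3 • (v : 𝓢'(ℝ, ℂ)) = (f : 𝓢'(ℝ, ℂ)) → R f = v)
    (f : Lp ℂ 2 (volume : Measure ℝ)) (hf : Integrable f) :
    R f =ᵐ[volume] fun x => ∫ y, greenKernel ω ζ (x - y) * f y := by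
  have hm := h.memLp_greenKernel_convolution hf
  -- By uniqueness of L² solutions it suffices that the convolution solves the equation weakly,
  -- which is Fubini and the fundamental solution property.
  rw [hR f (hm.toLp _) ?_]
  · exact hm.coeFn_toLp
  ext ψ
  set χ : 𝓢(ℝ, ℂ) := -Complex.I • (∂_{(1 : ℝ)} (∂_{(1 : ℝ)} (∂_{(1 : ℝ)} ψ))) - ζ ^ 3 • ψ with hχ
  have h1 : ((momentum ^ 3) ((hm.toLp _ : Lp ℂ 2 (volume : Measure ℝ)) : 𝓢'(ℝ, ℂ)) -
      ζ ^ 3 • ((hm.toLp _ : Lp ℂ 2 (volume : Measure ℝ)) : 𝓢'(ℝ, ℂ))) ψ =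
      ((hm.toLp _ : Lp ℂ 2 (volume : Measure ℝ)) : 𝓢'(ℝ, ℂ)) χ := by
    rw [hχ, map_sub, ← momentum_cube_apply_apply, map_smul]
    rfl
  rw [h1, Lp.toTemperedDistribution_apply, Lp.toTemperedDistribution_apply]
  calc ∫ x, χ x • (hm.toLp _ : ℝ → ℂ) x
      = ∫ x, ∫ y, greenKernel ω ζ (x - y) * (χ x * f y) := by
        refine integral_congr_ae ?_
        filter_upwards [hm.coeFn_toLp] with x hx
        rw [hx, smul_eq_mul, ← integral_const_mul]
        refine integral_congr_ae (Eventually.of_forall fun y => ?_)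
        simp only
        ring
    _ = ∫ y, ∫ x, greenKernel ω ζ (x - y) * (χ x * f y) :=
        integral_integral_swap (h.integrable_greenKernel_prod hf χ.integrable)
    _ = ∫ y, ψ y • f y := by
        refine integral_congr_ae (Eventually.of_forall fun y => ?_)
        simp only [← mul_assoc, smul_eq_mul]
        rw [integral_mul_const]
        congr 1
        exact h.integral_greenKernel_mul y ψ

end IsSectorRoot

end GreenFunction

/-! ### The cube root in its sector -/

section SectorRoot

/-- The cube root of unity `exp(2πi/3)`. -/
def omega : ℂ := Complex.exp ((2 * Real.pi / 3 : ℝ) * Complex.I)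

/-- For `z` in the upper half plane, the cube root of `z` with argument in `(0, π/3)`. -/
theorem isSectorRoot_cpow {z : ℂ} (hz : 0 < z.im) :
    IsSectorRoot omega (z ^ ((3 : ℕ) : ℂ)⁻¹) := by
  have hz0 : z ≠ 0 := by rintro rfl; simp at hz
  have ha : 0 < z.arg := by
    have h1 := Complex.arg_nonneg_iff.mpr hz.le
    refine lt_of_le_of_ne h1 fun h => ?_
    have := (Complex.arg_eq_zero_iff.mp h.symm).2
    exact hz.ne' this
  have hp : z.arg < Real.pi := by
    refine lt_of_le_of_ne (Complex.arg_le_pi z) fun h => ?_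
    exact hz.ne' (Complex.arg_eq_pi_iff.mp h).2
  -- With arg z / 3 in (0, π/3), rotations by 0 and 2π/3 stay in (0, π), and the rotation by 4π/3
  -- lands in (4π/3, 5π/3).
  have him : ∀ θ : ℝ, (Complex.exp ((θ : ℂ) * Complex.I) * z ^ ((3 : ℕ) : ℂ)⁻¹).im =
      Real.exp ((Complex.log z).re / 3) * Real.sin (θ + z.arg / 3) := by
    intro θ
    rw [Complex.cpow_def_of_ne_zero hz0, ← Complex.exp_add, Complex.exp_im]
    have h3 : Complex.log z * ((3 : ℕ) : ℂ)⁻¹ = Complex.log z * ((1 / 3 : ℝ) : ℂ) := by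
      push_cast; ring
    rw [h3, Complex.add_re, Complex.add_im, Complex.re_mul_ofReal, Complex.im_mul_ofReal,
      Complex.log_im]
    simp
    ring_nf
  have hω2 : omega ^ 2 = Complex.exp ((4 * Real.pi / 3 : ℝ) * Complex.I) := by
    rw [omega, ← Complex.exp_nat_mul]
    congr 1
    push_cast; ring
  have hω3 : omega ^ 3 = 1 := by
    rw [omega, ← Complex.exp_nat_mul, ← Complex.exp_two_pi_mul_I]
    congr 1
    push_cast; ring
  refine ⟨?_, ?_, ?_, ?_⟩
  · have h1 : omega - 1 ≠ 0 := by
      intro h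
      have : omega.im = 0 := by rw [sub_eq_zero.mp h]; simp
      rw [omega, Complex.exp_ofReal_mul_I_im] at this
      exact (Real.sin_pos_of_pos_of_lt_pi (by positivity)
        (by linarith [Real.pi_pos])).ne' this
    refine mul_left_cancel₀ h1 ?_
    linear_combination hω3
  · have := him 0
    simp only [Complex.ofReal_zero, zero_mul, Complex.exp_zero, one_mul, zero_add] at this
    rw [this]
    exact mul_pos (Real.exp_pos _) (Real.sin_pos_of_pos_of_lt_pi (by positivity) (by linarith))
  · rw [omega, him]
    exact mul_pos (Real.exp_pos _) (Real.sin_pos_of_pos_of_lt_pi (by positivity) (by linarith))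
  · rw [hω2, him]
    refine mul_neg_of_pos_of_neg (Real.exp_pos _) ?_
    rw [← Real.sin_sub_two_pi]
    exact Real.sin_neg_of_neg_of_neg_pi_lt (by linarith) (by linarith)

theorem tendsto_cpow_inv_three :
    Tendsto (fun z : ℂ => z ^ ((3 : ℕ) : ℂ)⁻¹) (𝓝 0) (𝓝 0) := by
  have h := Complex.continuousAt_cpow_const_of_re_pos (z := 0) (w := ((3 : ℕ) : ℂ)⁻¹)
    (Or.inl (by simp)) (by norm_num)
  have h0 : (0 : ℂ) ^ ((3 : ℕ) : ℂ)⁻¹ = 0 := Complex.zero_cpow (by norm_num)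
  simpa only [ContinuousAt, h0] using h

theorem neBot_nhdsWithin_upperHalfPlane : (𝓝[{z : ℂ | 0 < z.im}] 0).NeBot := by
  rw [← mem_closure_iff_nhdsWithin_neBot, Complex.closure_setOfPred_lt_im]
  simp

end SectorRoot

/-! ### Means over the unit interval -/

section Average

/-- The mean value over `[0, 1]`. -/
def avg (f : ℝ → ℂ) : ℂ := ∫ w in (0 : ℝ)..1, f w

theorem avg_const (c : ℂ) : avg (fun _ => c) = c := by simp [avg]

theorem avg_add {f g : ℝ → ℂ} (hf : Continuous f) (hg : Continuous g) :
    avg (fun w => f w + g w) = avg f + avg g :=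
  intervalIntegral.integral_add (hf.intervalIntegrable _ _) (hg.intervalIntegrable _ _)

theorem avg_sub {f g : ℝ → ℂ} (hf : Continuous f) (hg : Continuous g) :
    avg (fun w => f w - g w) = avg f - avg g :=
  intervalIntegral.integral_sub (hf.intervalIntegrable _ _) (hg.intervalIntegrable _ _)

theorem avg_affine (a b : ℂ) : avg (fun w => a + b * w) = a + b / 2 := by
  have h : ∫ w in (0 : ℝ)..1, (w : ℂ) = 1 / 2 := by
    have := intervalIntegral.integral_ofReal (μ := volume) (a := (0 : ℝ)) (b := 1)
      (f := fun w : ℝ => w)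
    rw [this]
    simp
  rw [avg_add continuous_const (by fun_prop), avg_const]
  simp only [avg, intervalIntegral.integral_const_mul, h]
  ring

theorem norm_avg_le {f : ℝ → ℂ} {c : ℝ} (h : ∀ w, 0 ≤ w → w ≤ 1 → ‖f w‖ ≤ c) : ‖avg f‖ ≤ c := by
  have := intervalIntegral.norm_integral_le_of_norm_le_const (a := (0 : ℝ)) (b := 1) (f := f)
    (C := c) fun w hw => by
      rw [Set.uIoc_of_le zero_le_one] at hw
      exact h w hw.1.le hw.2
  simpa [avg] using this

theorem continuous_avg {f : ℝ → ℝ → ℂ} (hf : Continuous (Function.uncurry f)) :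
    Continuous fun x => avg (f x) :=
  intervalIntegral.continuous_parametric_intervalIntegral_of_continuous' hf 0 1

theorem tendsto_avg {ι : Type*} {l : Filter ι} {f : ι → ℝ → ℂ} {f₀ : ℝ → ℂ} {b : ι → ℝ}
    (hf : ∀ᶠ i in l, Continuous (f i)) (hf₀ : Continuous f₀)
    (hb : ∀ᶠ i in l, ∀ w, 0 ≤ w → w ≤ 1 → ‖f i w - f₀ w‖ ≤ b i) (hb0 : Tendsto b l (𝓝 0)) :
    Tendsto (fun i => avg (f i)) l (𝓝 (avg f₀)) := by
  rw [tendsto_iff_norm_sub_tendsto_zero]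
  refine squeeze_zero' (Eventually.of_forall fun i => norm_nonneg _) ?_ hb0
  filter_upwards [hf, hb] with i hi hbi
  rw [← avg_sub hi hf₀]
  exact norm_avg_le hbi

end Average

/-! ### The rank one perturbation: cancellation of singular parts and the limit -/

section PerturbedKernel

/-- The mean over `w ∈ [0, 1]` of `greenKernel (x - w)`. -/
def greenMeanRight (ω ζ : ℂ) (x : ℝ) : ℂ := avg fun w => greenKernel ω ζ (x - w)

/-- The mean over `w ∈ [0, 1]` of `greenKernel (w - y)`. -/
def greenMeanLeft (ω ζ : ℂ) (y : ℝ) : ℂ := avg fun w => greenKernel ω ζ (w - y)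

/-- The mean of the Green function over the unit square. -/
def greenMean (ω ζ : ℂ) : ℂ := avg (greenMeanRight ω ζ)

/-- The kernel of the resolvent of `(-i∂ₓ)³ + 1_[0,1] ⟨1_[0,1], ·⟩`. -/
def perturbedKernel (ω ζ : ℂ) (x y : ℝ) : ℂ :=
  greenKernel ω ζ (x - y) - greenMeanRight ω ζ x * greenMeanLeft ω ζ y / (1 + greenMean ω ζ)

/-- The Green function minus its affine part `α + β t`, in the limit `ζ → 0`. -/
def cubicKernel (t : ℝ) : ℂ := -(Complex.I / 6) * (2 * (max t 0 : ℝ) ^ 2 - (min t 0 : ℝ) ^ 2)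

theorem continuous_cubicKernel : Continuous cubicKernel := by
  unfold cubicKernel
  fun_prop

/-- The Green function minus its affine part at `0`. -/
def reducedKernel (ω ζ : ℂ) (t : ℝ) : ℂ :=
  greenKernel ω ζ t - -Complex.I * ω ^ 2 / (3 * ζ ^ 2) - ω / (3 * ζ) * t

namespace IsSectorRoot

variable {ω ζ : ℂ}

theorem continuous_reducedKernel (h : IsSectorRoot ω ζ) : Continuous (reducedKernel ω ζ) := by
  unfold reducedKernel
  have := h.continuous_greenKernel
  fun_prop

theorem norm_reducedKernel_sub_le (h : IsSectorRoot ω ζ) {t M : ℝ} (ht : |t| ≤ M) :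
    ‖reducedKernel ω ζ t - cubicKernel t‖ ≤ ‖ζ‖ * M ^ 3 * Real.exp (‖ζ‖ * M) := by
  have hM := (abs_nonneg t).trans ht
  refine (h.norm_greenKernel_sub_expansion_le t).trans ?_
  gcongr

theorem continuous_sub_right (h : IsSectorRoot ω ζ) :
    Continuous (Function.uncurry fun x w => greenKernel ω ζ (x - w)) :=
  h.continuous_greenKernel.comp (continuous_fst.sub continuous_snd)

theorem continuous_sub_left (h : IsSectorRoot ω ζ) :
    Continuous (Function.uncurry fun y w => greenKernel ω ζ (w - y)) :=
  h.continuous_greenKernel.comp (continuous_snd.sub continuous_fst)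

theorem continuous_greenMeanRight (h : IsSectorRoot ω ζ) : Continuous (greenMeanRight ω ζ) :=
  continuous_avg h.continuous_sub_right

theorem continuous_greenMeanLeft (h : IsSectorRoot ω ζ) : Continuous (greenMeanLeft ω ζ) :=
  continuous_avg h.continuous_sub_left

theorem continuous_perturbedKernel (h : IsSectorRoot ω ζ) :
    Continuous fun p : ℝ × ℝ => perturbedKernel ω ζ p.1 p.2 := by
  unfold perturbedKernel
  have h1 := h.continuous_greenKernel
  have h2 := h.continuous_greenMeanRight
  have h3 := h.continuous_greenMeanLeft
  fun_prop

theorem greenMeanRight_eq (h : IsSectorRoot ω ζ) (x : ℝ) : greenMeanRight ω ζ x =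
    -Complex.I * ω ^ 2 / (3 * ζ ^ 2) + ω / (3 * ζ) * (x - 1 / 2) +
      avg fun w => reducedKernel ω ζ (x - w) := by
  have hκ := h.continuous_reducedKernel
  have : (fun w : ℝ => greenKernel ω ζ (x - w)) = fun w : ℝ =>
      ((-Complex.I * ω ^ 2 / (3 * ζ ^ 2) + ω / (3 * ζ) * x) + (-(ω / (3 * ζ))) * w) +
        reducedKernel ω ζ (x - w) := by
    ext w
    simp only [reducedKernel]
    push_cast
    ring
  rw [greenMeanRight, this, avg_add (by fun_prop) (by fun_prop), avg_affine]
  ring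

theorem greenMeanLeft_eq (h : IsSectorRoot ω ζ) (y : ℝ) : greenMeanLeft ω ζ y =
    -Complex.I * ω ^ 2 / (3 * ζ ^ 2) + ω / (3 * ζ) * (1 / 2 - y) +
      avg fun w => reducedKernel ω ζ (w - y) := by
  have hκ := h.continuous_reducedKernel
  have : (fun w : ℝ => greenKernel ω ζ (w - y)) = fun w : ℝ =>
      ((-Complex.I * ω ^ 2 / (3 * ζ ^ 2) - ω / (3 * ζ) * y) + ω / (3 * ζ) * w) +
        reducedKernel ω ζ (w - y) := by
    ext w
    simp only [reducedKernel]
    push_cast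
    ring
  rw [greenMeanLeft, this, avg_add (by fun_prop) (by fun_prop), avg_affine]
  ring

/-- The linear part is odd under exchange of the two variables, so it has mean zero over the square
and no ζ⁻¹ term remains. -/
theorem greenMean_eq (h : IsSectorRoot ω ζ) : greenMean ω ζ =
    -Complex.I * ω ^ 2 / (3 * ζ ^ 2) + avg fun x => avg fun w => reducedKernel ω ζ (x - w) := by
  have hκ : Continuous fun x => avg fun w => reducedKernel ω ζ (x - w) :=
    continuous_avg (f := fun x w => reducedKernel ω ζ (x - w))
      (h.continuous_reducedKernel.comp (continuous_fst.sub continuous_snd))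
  have : greenMeanRight ω ζ = fun x : ℝ =>
      ((-Complex.I * ω ^ 2 / (3 * ζ ^ 2) - ω / (3 * ζ) / 2) + ω / (3 * ζ) * x) +
        avg fun w => reducedKernel ω ζ (x - w) := by
    ext x
    rw [h.greenMeanRight_eq]
    ring
  rw [greenMean, this, avg_add (by fun_prop) hκ, avg_affine]
  ring

/-- Subtracting the mean removes the ζ⁻² constant; averaging the Lipschitz bound leaves order ζ⁻¹
only. -/
theorem norm_greenMeanRight_sub_greenMean_le (h : IsSectorRoot ω ζ) (x : ℝ) :
    ‖greenMeanRight ω ζ x - greenMean ω ζ‖ ≤ ‖ζ‖⁻¹ * (1 + |x|) := by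
  have hc := h.continuous_greenMeanRight
  have hK := h.continuous_greenKernel
  rw [greenMean, ← avg_const (greenMeanRight ω ζ x), ← avg_sub continuous_const hc]
  refine norm_avg_le fun x' h0 h1 => ?_
  rw [greenMeanRight, greenMeanRight, ← avg_sub (by fun_prop) (by fun_prop)]
  refine norm_avg_le fun w _ _ => (h.norm_greenKernel_sub_le _ _).trans ?_
  gcongr
  rw [sub_sub_sub_cancel_right]
  exact (abs_sub _ _).trans (by rw [abs_of_nonneg h0]; linarith)

theorem norm_greenMeanLeft_sub_greenMean_le (h : IsSectorRoot ω ζ) (y : ℝ) :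
    ‖greenMeanLeft ω ζ y - greenMean ω ζ‖ ≤ ‖ζ‖⁻¹ * (1 + |y|) := by
  have hc := h.continuous_greenMeanRight
  have hK := h.continuous_greenKernel
  rw [greenMean, greenMeanLeft, ← avg_sub (by fun_prop) hc]
  refine norm_avg_le fun x' h0 h1 => ?_
  rw [greenMeanRight, ← avg_const (greenKernel ω ζ (x' - y)),
    ← avg_sub (by fun_prop) (by fun_prop)]
  refine norm_avg_le fun w h0' h1' => (h.norm_greenKernel_sub_le _ _).trans ?_
  gcongr
  rw [sub_sub_sub_cancel_left]
  exact (abs_sub _ _).trans (by rw [abs_of_nonneg h0']; linarith)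

/-- The expression is the mean of mixed second differences over base points in the unit square, so
the ζ-independent bound on these applies. -/
theorem norm_regularPart_le (h : IsSectorRoot ω ζ) (x y : ℝ) :
    ‖greenKernel ω ζ (x - y) - greenMeanRight ω ζ x - greenMeanLeft ω ζ y + greenMean ω ζ‖ ≤
      (1 + |x|) * (1 + |y|) := by
  have hc := h.continuous_greenMeanRight
  have hK := h.continuous_greenKernel
  have e1 : greenKernel ω ζ (x - y) - greenMeanRight ω ζ x - greenMeanLeft ω ζ y +
      greenMean ω ζ = avg fun x' => (greenKernel ω ζ (x - y) - greenMeanRight ω ζ x) -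
        (greenKernel ω ζ (x' - y) - greenMeanRight ω ζ x') := by
    rw [avg_sub (by fun_prop) (by fun_prop), avg_const, avg_sub (by fun_prop) hc, greenMean,
      greenMeanLeft]
    ring
  rw [e1]
  refine norm_avg_le fun x' h0 h1 => ?_
  have e2 : ∀ x, greenKernel ω ζ (x - y) - greenMeanRight ω ζ x =
      avg fun w => greenKernel ω ζ (x - y) - greenKernel ω ζ (x - w) := by
    intro x
    rw [avg_sub (by fun_prop) (by fun_prop), avg_const, greenMeanRight]
  rw [e2, e2, ← avg_sub (by fun_prop) (by fun_prop)]
  refine norm_avg_le fun w h0' h1' =>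
    (h.norm_greenKernel_secondDifference_le x x' y w).trans ?_
  rw [mul_comm]
  gcongr
  · exact (abs_sub _ _).trans (by rw [abs_of_nonneg h0]; linarith)
  · exact (abs_sub _ _).trans (by rw [abs_of_nonneg h0']; linarith)

/-- The singular parts of the kernel cancel. -/
theorem perturbedKernel_eq (h : IsSectorRoot ω ζ) (hm : 1 + greenMean ω ζ ≠ 0) (x y : ℝ) :
    perturbedKernel ω ζ x y =
      (greenKernel ω ζ (x - y) - greenMeanRight ω ζ x - greenMeanLeft ω ζ y + greenMean ω ζ) +
      1 - (ζ * (greenMeanRight ω ζ x - greenMean ω ζ - 1)) *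
        (ζ * (greenMeanLeft ω ζ y - greenMean ω ζ - 1)) / (ζ ^ 2 * (1 + greenMean ω ζ)) := by
  have hζ := h.ne_zero
  rw [perturbedKernel]
  field_simp
  ring

/-- In `perturbedKernel_eq` the regular part and the constant contribute 1 each, and the quotient 2
· 2 · 6 = 24. -/
theorem norm_perturbedKernel_le (h : IsSectorRoot ω ζ) (hζ : ‖ζ‖ ≤ 1)
    (hm : 1 / 6 ≤ ‖ζ ^ 2 * (1 + greenMean ω ζ)‖) (x y : ℝ) :
    ‖perturbedKernel ω ζ x y‖ ≤ 26 * ((1 + |x|) * (1 + |y|)) := by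
  have hζ0 : 0 < ‖ζ‖ := norm_pos_iff.mpr h.ne_zero
  have hm0 : 1 + greenMean ω ζ ≠ 0 := by
    intro h0
    rw [h0, mul_zero, norm_zero] at hm
    norm_num at hm
  have aux : ∀ (a : ℂ) (t : ℝ), ‖a‖ ≤ ‖ζ‖⁻¹ * (1 + |t|) → ‖ζ * (a - 1)‖ ≤ 2 * (1 + |t|) := by
    intro a t ha
    calc ‖ζ * (a - 1)‖ = ‖ζ * a - ζ‖ := by rw [mul_sub, mul_one]
      _ ≤ ‖ζ * a‖ + ‖ζ‖ := norm_sub_le _ _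
      _ ≤ (1 + |t|) + 1 := by
        rw [norm_mul]
        gcongr
        calc ‖ζ‖ * ‖a‖ ≤ ‖ζ‖ * (‖ζ‖⁻¹ * (1 + |t|)) := by gcongr
          _ = 1 + |t| := by field_simp
      _ ≤ _ := by linarith [abs_nonneg t]
  have h1 := h.norm_regularPart_le x y
  have h2 := aux _ x (h.norm_greenMeanRight_sub_greenMean_le x)
  have h3 := aux _ y (h.norm_greenMeanLeft_sub_greenMean_le y)
  have h4 : 1 ≤ (1 + |x|) * (1 + |y|) := by nlinarith [abs_nonneg x, abs_nonneg y]
  rw [h.perturbedKernel_eq hm0]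
  refine (norm_sub_le _ _).trans ?_
  have h5 : ‖(ζ * (greenMeanRight ω ζ x - greenMean ω ζ - 1)) *
        (ζ * (greenMeanLeft ω ζ y - greenMean ω ζ - 1)) / (ζ ^ 2 * (1 + greenMean ω ζ))‖ ≤
      24 * ((1 + |x|) * (1 + |y|)) := by
    rw [norm_div, norm_mul]
    calc _ ≤ (2 * (1 + |x|)) * (2 * (1 + |y|)) / (1 / 6) := by gcongr
      _ = _ := by ring
  have h6 := norm_add_le (greenKernel ω ζ (x - y) - greenMeanRight ω ζ x -
    greenMeanLeft ω ζ y + greenMean ω ζ) 1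
  rw [norm_one] at h6
  linarith

end IsSectorRoot

section Limit

variable {ι : Type*} {l : Filter ι} {ω : ℂ} {ζ : ι → ℂ}

theorem tendsto_reducedKernel_bound (hζ0 : Tendsto ζ l (𝓝 0)) (M : ℝ) :
    Tendsto (fun i => ‖ζ i‖ * M ^ 3 * Real.exp (‖ζ i‖ * M)) l (𝓝 0) := by
  have h := hζ0.norm
  rw [norm_zero] at h
  have := (h.mul_const (M ^ 3)).mul ((Real.continuous_exp.tendsto _).comp (h.mul_const M))
  simpa using this

theorem tendsto_avg_reducedKernel (hζ : ∀ᶠ i in l, IsSectorRoot ω (ζ i))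
    (hζ0 : Tendsto ζ l (𝓝 0)) {u : ℝ → ℝ} (hu : Continuous u) {M : ℝ}
    (hM : ∀ w, 0 ≤ w → w ≤ 1 → |u w| ≤ M) :
    Tendsto (fun i => avg fun w => reducedKernel ω (ζ i) (u w)) l
      (𝓝 (avg fun w => cubicKernel (u w))) := by
  refine tendsto_avg (hζ.mono fun i h => h.continuous_reducedKernel.comp hu)
    (continuous_cubicKernel.comp hu) (hζ.mono fun i h w h0 h1 => ?_)
    (tendsto_reducedKernel_bound hζ0 M)
  exact h.norm_reducedKernel_sub_le (hM w h0 h1)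

theorem tendsto_avg_avg_reducedKernel (hζ : ∀ᶠ i in l, IsSectorRoot ω (ζ i))
    (hζ0 : Tendsto ζ l (𝓝 0)) :
    Tendsto (fun i => avg fun x => avg fun w => reducedKernel ω (ζ i) (x - w)) l
      (𝓝 (avg fun x => avg fun w => cubicKernel (x - w))) := by
  have hc : ∀ {κ : ℝ → ℂ}, Continuous κ → Continuous fun x => avg fun w => κ (x - w) :=
    fun hκ => continuous_avg (hκ.comp (continuous_fst.sub continuous_snd))
  refine tendsto_avg (hζ.mono fun i h => hc h.continuous_reducedKernel)
    (hc continuous_cubicKernel) (hζ.mono fun i h x h0 h1 => ?_)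
    (tendsto_reducedKernel_bound hζ0 1)
  have hκ := h.continuous_reducedKernel
  have hκ0 := continuous_cubicKernel
  rw [← avg_sub (by fun_prop) (by fun_prop)]
  refine norm_avg_le fun w h0' h1' => h.norm_reducedKernel_sub_le ?_
  rw [abs_le]
  constructor <;> linarith

/-- The factor ζ² isolates the leading coefficient. For ω ≠ 0 the limit is nonzero, which makes the
denominator of the perturbed kernel of exact order ζ⁻². -/
theorem tendsto_sq_mul_greenMean (hζ : ∀ᶠ i in l, IsSectorRoot ω (ζ i))
    (hζ0 : Tendsto ζ l (𝓝 0)) :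
    Tendsto (fun i => ζ i ^ 2 * (1 + greenMean ω (ζ i))) l (𝓝 (-Complex.I * ω ^ 2 / 3)) := by
  have h1 := ((hζ0.pow 2).mul ((tendsto_avg_avg_reducedKernel hζ hζ0).const_add 1)).const_add
    (-Complex.I * ω ^ 2 / 3)
  rw [zero_pow two_ne_zero, zero_mul, add_zero] at h1
  refine h1.congr' (hζ.mono fun i h => ?_)
  have := h.ne_zero
  simp only
  rw [h.greenMean_eq]
  field_simp
  ring

theorem exists_tendsto_perturbedKernel (hζ : ∀ᶠ i in l, IsSectorRoot ω (ζ i))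
    (hζ0 : Tendsto ζ l (𝓝 0)) (hω : ω ≠ 0) (x y : ℝ) :
    ∃ k₀ : ℂ, Tendsto (fun i => perturbedKernel ω (ζ i) x y) l (𝓝 k₀) := by
  have habs : ∀ t w : ℝ, 0 ≤ w → w ≤ 1 → |t - w| ≤ 1 + |t| := fun t w h0 h1 =>
    (abs_sub _ _).trans (by rw [abs_of_nonneg h0]; linarith)
  have hm := tendsto_sq_mul_greenMean hζ hζ0
  have hΓ := tendsto_avg_avg_reducedKernel hζ hζ0
  have hG := tendsto_avg_reducedKernel hζ hζ0 (u := fun w => x - w) (by fun_prop) (habs x)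
  have hG' := tendsto_avg_reducedKernel hζ hζ0 (u := fun w => w - y) (by fun_prop)
    (M := 1 + |y|) fun w h0 h1 => by rw [abs_sub_comm]; exact habs y w h0 h1
  have hκ : Tendsto (fun i => reducedKernel ω (ζ i) (x - y)) l (𝓝 (cubicKernel (x - y))) := by
    rw [tendsto_iff_norm_sub_tendsto_zero]
    refine squeeze_zero' (Eventually.of_forall fun i => norm_nonneg _) ?_
      (tendsto_reducedKernel_bound hζ0 |x - y|)
    exact hζ.mono fun i h => h.norm_reducedKernel_sub_le le_rfl
  have ha : -Complex.I * ω ^ 2 / 3 ≠ 0 := by simp [hω]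
  -- The affine parts cancel in the double difference, so it may be formed with the reduced kernels,
  -- which converge.
  have hS := ((hκ.sub hG).sub hG').add hΓ
  -- After multiplication by ζ the linear part leaves ω(x - 1/2)/3 and all the rest tends to 0.
  have hp := (hζ0.mul ((hG.sub hΓ).sub_const 1)).const_add (ω / 3 * (x - 1 / 2))
  have hq := (hζ0.mul ((hG'.sub hΓ).sub_const 1)).const_add (ω / 3 * (1 / 2 - y))
  refine ⟨_, (((hS.add_const 1).sub ((hp.mul hq).div hm ha))).congr' ?_⟩
  filter_upwards [hζ, hm.eventually_ne ha] with i h hi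
  have hζi := h.ne_zero
  rw [h.perturbedKernel_eq (right_ne_zero_of_mul hi)]
  have hp' : ω / 3 * (x - 1 / 2) + ζ i * ((avg fun w => reducedKernel ω (ζ i) (x - w)) -
      (avg fun x => avg fun w => reducedKernel ω (ζ i) (x - w)) - 1) =
      ζ i * (greenMeanRight ω (ζ i) x - greenMean ω (ζ i) - 1) := by
    rw [h.greenMeanRight_eq, h.greenMean_eq]
    field_simp
    ring
  have hq' : ω / 3 * (1 / 2 - y) + ζ i * ((avg fun w => reducedKernel ω (ζ i) (w - y)) -
      (avg fun x => avg fun w => reducedKernel ω (ζ i) (x - w)) - 1) =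
      ζ i * (greenMeanLeft ω (ζ i) y - greenMean ω (ζ i) - 1) := by
    rw [h.greenMeanLeft_eq, h.greenMean_eq]
    field_simp
    ring
  have hS' : reducedKernel ω (ζ i) (x - y) - (avg fun w => reducedKernel ω (ζ i) (x - w)) -
      (avg fun w => reducedKernel ω (ζ i) (w - y)) +
      (avg fun x => avg fun w => reducedKernel ω (ζ i) (x - w)) =
      greenKernel ω (ζ i) (x - y) - greenMeanRight ω (ζ i) x - greenMeanLeft ω (ζ i) y +
        greenMean ω (ζ i) := by
    rw [h.greenMeanRight_eq, h.greenMeanLeft_eq, h.greenMean_eq]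
    simp only [reducedKernel]
    push_cast
    ring
  rw [← hp', ← hq', ← hS']
  rfl

end Limit

end PerturbedKernel

/-! ### Hilbert-Schmidt estimates in weighted spaces -/

section WeightedKernel

variable {s s' : ℝ}

theorem lintegral_weightedMeasure (s : ℝ) (f : ℝ → ℝ≥0∞) :
    ∫⁻ x, f x ∂(weightedMeasure s) = ∫⁻ x, ENNReal.ofReal ((1 + x ^ 2) ^ s) * f x := by
  rw [weightedMeasure, lintegral_withDensity_eq_lintegral_mul_non_measurable _ (by fun_prop)
    (Eventually.of_forall fun x => ENNReal.ofReal_lt_top)]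
  rfl

theorem enorm_rpow_two_eq_lintegral {μ : Measure ℝ} (f : Lp ℂ 2 μ) :
    ‖f‖ₑ ^ (2 : ℝ) = ∫⁻ x, ‖f x‖ₑ ^ (2 : ℝ) ∂μ := by
  rw [Lp.enorm_def]
  exact eLpNorm_nnreal_pow_eq_lintegral (p := 2) two_ne_zero

instance : SFinite (weightedMeasure s) := by
  unfold weightedMeasure
  infer_instance

theorem aestronglyMeasurable_of_weightedL2 (f : WeightedL2 s) :
    AEStronglyMeasurable f (volume : Measure ℝ) :=
  (Lp.aestronglyMeasurable f).mono_ac (volume_absolutelyContinuous_weightedMeasure s)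

/-- The Cauchy-Schwarz inequality for the pairing of `L²_{-s}` and `L²_s`. -/
theorem lintegral_mul_enorm_rpow_two_le {a : ℝ → ℝ≥0∞} (ha : AEMeasurable a volume)
    (f : WeightedL2 s) :
    (∫⁻ y, a y * ‖f y‖ₑ) ^ (2 : ℝ) ≤
      (∫⁻ y, a y ^ (2 : ℝ) ∂(weightedMeasure (-s))) * ‖f‖ₑ ^ (2 : ℝ) := by
  set ρ : ℝ → ℝ≥0∞ := fun y => ENNReal.ofReal ((1 + y ^ 2) ^ s)
  have hρ : ∀ y : ℝ, ENNReal.ofReal ((1 + y ^ 2) ^ (-s)) * ρ y = 1 := fun y => by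
    rw [← ENNReal.ofReal_mul (by positivity), ← Real.rpow_add (by positivity)]
    simp
  have hfm := (aestronglyMeasurable_of_weightedL2 f).enorm
  have hac : weightedMeasure (-s) ≪ volume := withDensity_absolutelyContinuous _ _
  -- Inserting ρ turns Lebesgue measure into the weight ⟨y⟩^(-2s), against which ρ f has the same
  -- norm as f in L²_s.
  have e1 : ∫⁻ y, a y * ‖f y‖ₑ = ∫⁻ y, (a * fun y => ρ y * ‖f y‖ₑ) y ∂(weightedMeasure (-s)) := by
    rw [lintegral_weightedMeasure]
    refine lintegral_congr fun y => ?_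
    simp only [Pi.mul_apply]
    rw [← mul_assoc, mul_comm _ (a y), mul_assoc, ← mul_assoc _ (ρ y), hρ, one_mul]
  have e2 : ∫⁻ y, (ρ y * ‖f y‖ₑ) ^ (2 : ℝ) ∂(weightedMeasure (-s)) = ‖f‖ₑ ^ (2 : ℝ) := by
    rw [enorm_rpow_two_eq_lintegral, lintegral_weightedMeasure, lintegral_weightedMeasure]
    refine lintegral_congr fun y => ?_
    simp only [ENNReal.rpow_two]
    calc _ = (ENNReal.ofReal ((1 + y ^ 2) ^ (-s)) * ρ y) * (ρ y * ‖f y‖ₑ ^ 2) := by ring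
      _ = _ := by rw [hρ, one_mul]
  have hρm : AEMeasurable (fun y => ρ y * ‖f y‖ₑ) (weightedMeasure (-s)) :=
    AEMeasurable.mono_ac (AEMeasurable.mul (by fun_prop) hfm) hac
  have := ENNReal.lintegral_mul_le_Lp_mul_Lq (weightedMeasure (-s)) Real.HolderConjugate.two_two
    (ha.mono_ac hac) hρm
  rw [← e1, e2] at this
  refine (ENNReal.rpow_le_rpow this (by norm_num : (0 : ℝ) ≤ 2)).trans_eq ?_
  rw [ENNReal.mul_rpow_of_nonneg _ _ (by norm_num : (0 : ℝ) ≤ 2), ← ENNReal.rpow_mul,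
    ← ENNReal.rpow_mul]
  norm_num

/-- A bounded operator given by a square integrable kernel is bounded by its Hilbert-Schmidt
norm. -/
theorem norm_le_sqrt_lintegral_kernel {k : ℝ → ℝ → ℂ}
    (hk : Measurable (Function.uncurry k)) (L : WeightedL2 s →L[ℂ] WeightedL2 (-s'))
    (hL : ∀ f : WeightedL2 s, L f =ᵐ[volume] fun x => ∫ y, k x y * f y)
    (hfin : ∫⁻ p, ‖k p.1 p.2‖ₑ ^ (2 : ℝ)
      ∂((weightedMeasure (-s')).prod (weightedMeasure (-s))) ≠ ∞) :
    ‖L‖ ≤ Real.sqrt (∫⁻ p, ‖k p.1 p.2‖ₑ ^ (2 : ℝ)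
      ∂((weightedMeasure (-s')).prod (weightedMeasure (-s)))).toReal := by
  set H := ∫⁻ p, ‖k p.1 p.2‖ₑ ^ (2 : ℝ)
      ∂((weightedMeasure (-s')).prod (weightedMeasure (-s))) with hH
  have hHm : Measurable fun p : ℝ × ℝ => ‖k p.1 p.2‖ₑ ^ (2 : ℝ) := (hk.enorm).pow_const _
  refine ContinuousLinearMap.opNorm_le_bound _ (Real.sqrt_nonneg _) fun f => ?_
  have hle : ‖L f‖ₑ ^ (2 : ℝ) ≤ H * ‖f‖ₑ ^ (2 : ℝ) := by
    rw [enorm_rpow_two_eq_lintegral, hH, lintegral_prod _ hHm.aemeasurable,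
      ← lintegral_mul_const _ hHm.lintegral_prod_right']
    refine lintegral_mono_ae ?_
    have hac : weightedMeasure (-s') ≪ volume := withDensity_absolutelyContinuous _ _
    filter_upwards [hac.ae_le (hL f)] with x hx
    have hkx : Measurable fun y => ‖k x y‖ₑ := (hk.comp measurable_prodMk_left).enorm
    rw [hx]
    refine le_trans ?_ (lintegral_mul_enorm_rpow_two_le hkx.aemeasurable f)
    refine ENNReal.rpow_le_rpow ?_ (by norm_num)
    refine (enorm_integral_le_lintegral_enorm _).trans_eq ?_
    simp only [enorm_mul]
  have h2 := ENNReal.toReal_mono (ENNReal.mul_ne_top hfin (by simp)) hle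
  rw [ENNReal.toReal_mul, ← ENNReal.toReal_rpow, ← ENNReal.toReal_rpow, toReal_enorm,
    toReal_enorm, Real.rpow_two, Real.rpow_two] at h2
  refine abs_le_of_sq_le_sq' ?_ (by positivity) |>.2
  rwa [mul_pow, Real.sq_sqrt ENNReal.toReal_nonneg]

/-- The integrand is of size ⟨x⟩^(2-2s), integrable exactly for s > 3/2. This is where the threshold
N - 3/2 comes from. -/
theorem lintegral_sq_one_add_abs_weightedMeasure_lt_top (hs : 3 / 2 < s) :
    ∫⁻ x, ENNReal.ofReal (1 + |x|) ^ (2 : ℝ) ∂(weightedMeasure (-s)) < ∞ := by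
  have hi := integrable_rpow_neg_one_add_norm_sq (E := ℝ) (r := 2 * (s - 1)) (μ := volume) (by
    rw [Module.finrank_self]; norm_num; linarith)
  rw [lintegral_weightedMeasure]
  refine lt_of_le_of_lt (lintegral_mono fun x => ?_) (hi.const_mul 2).lintegral_lt_top
  have h1 : (0 : ℝ) < 1 + x ^ 2 := by positivity
  rw [ENNReal.rpow_two, ← ENNReal.ofReal_pow (by positivity),
    ← ENNReal.ofReal_mul (by positivity)]
  refine ENNReal.ofReal_le_ofReal ?_
  have h2 : (1 + |x|) ^ 2 ≤ 2 * (1 + x ^ 2) := by nlinarith [sq_abs x, sq_nonneg (|x| - 1)]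
  calc (1 + x ^ 2) ^ (-s) * (1 + |x|) ^ 2 ≤ (1 + x ^ 2) ^ (-s) * (2 * (1 + x ^ 2)) := by gcongr
    _ = 2 * ((1 + x ^ 2) ^ (-s) * (1 + x ^ 2) ^ (1 : ℝ)) := by rw [Real.rpow_one]; ring
    _ = 2 * (1 + ‖x‖ ^ 2) ^ (-(2 * (s - 1)) / 2) := by
      rw [← Real.rpow_add h1, Real.norm_eq_abs, sq_abs]
      ring_nf

theorem integrable_one_add_abs_mul (hs : 3 / 2 < s) (f : WeightedL2 s) :
    Integrable fun x => (1 + |x|) * ‖f x‖ := by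
  have hm := aestronglyMeasurable_of_weightedL2 f
  refine ⟨AEStronglyMeasurable.mul (by fun_prop) hm.norm, ?_⟩
  have h1 := lintegral_mul_enorm_rpow_two_le (a := fun x => ENNReal.ofReal (1 + |x|))
    (by fun_prop) f
  have h2 : (∫⁻ y, ENNReal.ofReal (1 + |y|) * ‖f y‖ₑ) ^ (2 : ℝ) < ∞ :=
    h1.trans_lt (ENNReal.mul_lt_top (lintegral_sq_one_add_abs_weightedMeasure_lt_top hs)
      (by simp))
  have h3 : ∫⁻ y, ENNReal.ofReal (1 + |y|) * ‖f y‖ₑ < ∞ := by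
    rwa [ENNReal.rpow_lt_top_iff_of_pos (by norm_num)] at h2
  refine lt_of_le_of_lt (lintegral_mono fun x => ?_) h3
  rw [enorm_mul, enorm_norm, Real.enorm_of_nonneg (by positivity)]

theorem integrable_of_weightedL2 (hs : 3 / 2 < s) (f : WeightedL2 s) : Integrable f := by
  refine (integrable_one_add_abs_mul hs f).mono' (aestronglyMeasurable_of_weightedL2 f)
    (Eventually.of_forall fun x => ?_)
  nlinarith [abs_nonneg x, norm_nonneg (f x), mul_nonneg (abs_nonneg x) (norm_nonneg (f x))]

/-- Operators with kernels which converge pointwise and are bounded by `C (1 + |x|) (1 + |y|)`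
converge in norm. -/
theorem exists_tendsto_of_tendsto_kernel (hs : 3 / 2 < s) (hs' : 3 / 2 < s') {ι : Type*}
    {l : Filter ι} [l.NeBot] [l.IsCountablyGenerated] {k : ι → ℝ → ℝ → ℂ}
    {L : ι → WeightedL2 s →L[ℂ] WeightedL2 (-s')} {C : ℝ}
    (hk : ∀ᶠ i in l, Measurable (Function.uncurry (k i)))
    (hL : ∀ᶠ i in l, ∀ f : WeightedL2 s, L i f =ᵐ[volume] fun x => ∫ y, k i x y * f y)
    (hC : ∀ᶠ i in l, ∀ x y, ‖k i x y‖ ≤ C * ((1 + |x|) * (1 + |y|)))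
    (hlim : ∀ x y, ∃ c, Tendsto (fun i => k i x y) l (𝓝 c)) :
    ∃ L₀, Tendsto L l (𝓝 L₀) := by
  -- A Cauchy argument avoids constructing the limit operator: only differences of kernels are
  -- estimated.
  suffices h : Cauchy (map L l) from CompleteSpace.complete h
  rw [cauchy_map_iff]
  refine ⟨inferInstance, tendsto_uniformity_iff_dist_tendsto_zero.mpr ?_⟩
  set μ := (weightedMeasure (-s')).prod (weightedMeasure (-s))
  set H : ι × ι → ℝ≥0∞ := fun i => ∫⁻ p, ‖k i.1 p.1 p.2 - k i.2 p.1 p.2‖ₑ ^ (2 : ℝ) ∂μ with hH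
  have hk2 : ∀ᶠ i in l ×ˢ l, Measurable (Function.uncurry fun x y => k i.1 x y - k i.2 x y) :=
    (hk.prod_mk hk).mono fun i h => h.1.sub h.2
  set b : ℝ × ℝ → ℝ≥0∞ := fun p =>
    ENNReal.ofReal (2 * C) ^ (2 : ℝ) * (ENNReal.ofReal (1 + |p.1|) ^ (2 : ℝ) *
      ENNReal.ofReal (1 + |p.2|) ^ (2 : ℝ)) with hb
  have hbfin : ∫⁻ p, b p ∂μ ≠ ∞ := by
    rw [hb, lintegral_const_mul _ (by fun_prop), lintegral_prod_mul
      (f := fun x : ℝ => ENNReal.ofReal (1 + |x|) ^ (2 : ℝ))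
      (g := fun x : ℝ => ENNReal.ofReal (1 + |x|) ^ (2 : ℝ)) (by fun_prop) (by fun_prop)]
    exact ENNReal.mul_ne_top (by finiteness) (ENNReal.mul_ne_top
      (lintegral_sq_one_add_abs_weightedMeasure_lt_top hs').ne
      (lintegral_sq_one_add_abs_weightedMeasure_lt_top hs).ne)
  have hle : ∀ᶠ i in l ×ˢ l, ∀ p : ℝ × ℝ,
      ‖k i.1 p.1 p.2 - k i.2 p.1 p.2‖ₑ ^ (2 : ℝ) ≤ b p := by
    refine (hC.prod_mk hC).mono fun i h p => ?_
    simp only [hb]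
    rw [← ENNReal.mul_rpow_of_nonneg _ _ (by norm_num : (0 : ℝ) ≤ 2),
      ← ENNReal.mul_rpow_of_nonneg _ _ (by norm_num : (0 : ℝ) ≤ 2)]
    refine ENNReal.rpow_le_rpow ?_ (by norm_num)
    have h3 := (norm_sub_le _ _).trans (add_le_add (h.1 p.1 p.2) (h.2 p.1 p.2))
    rw [← ENNReal.ofReal_mul (by positivity), ← ENNReal.ofReal_mul' (by positivity),
      ← ofReal_norm]
    exact ENNReal.ofReal_le_ofReal (h3.trans_eq (by ring))
  have hHt : Tendsto H (l ×ˢ l) (𝓝 0) := by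
    have := tendsto_lintegral_filter_of_dominated_convergence (μ := μ) (l := l ×ˢ l)
      (F := fun i p => ‖k i.1 p.1 p.2 - k i.2 p.1 p.2‖ₑ ^ (2 : ℝ)) (f := fun _ => 0) b
      (hk2.mono fun i h => (h.enorm).pow_const _)
      (hle.mono fun i h => Eventually.of_forall h) hbfin (Eventually.of_forall fun p => ?_)
    · simpa only [lintegral_zero] using this
    · obtain ⟨c, hc⟩ := hlim p.1 p.2
      have h0 := ((hc.comp tendsto_fst).sub (hc.comp tendsto_snd)).enorm
      have h1 := (ENNReal.continuous_rpow_const (y := 2)).tendsto _ |>.comp h0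
      simpa [Function.comp_def] using h1
  have hsq : Tendsto (fun i => Real.sqrt (H i).toReal) (l ×ˢ l) (𝓝 0) := by
    have h1 := (ENNReal.tendsto_toReal ENNReal.zero_ne_top).comp hHt
    have h2 := (Real.continuous_sqrt.tendsto _).comp h1
    simpa [Function.comp_def] using h2
  refine squeeze_zero' (Eventually.of_forall fun i => dist_nonneg) ?_ hsq
  filter_upwards [hk2, hle, hL.prod_mk hL, hC.prod_mk hC, hk.prod_mk hk] with i hki hlei hLi hCi hkm
  rw [dist_eq_norm]
  refine norm_le_sqrt_lintegral_kernel hki (L i.1 - L i.2) (fun f => ?_)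
    (ne_top_of_le_ne_top hbfin (lintegral_mono hlei))
  have hac := volume_absolutelyContinuous_weightedMeasure (-s')
  have hint : ∀ (κ : ℝ → ℝ → ℂ), Measurable (Function.uncurry κ) →
      (∀ x y, ‖κ x y‖ ≤ C * ((1 + |x|) * (1 + |y|))) → ∀ x, Integrable fun y => κ x y * f y := by
    intro κ hκm hκ x
    refine ((integrable_one_add_abs_mul hs f).const_mul (C * (1 + |x|))).mono'
      ((hκm.comp measurable_prodMk_left).aestronglyMeasurable.mul
        (aestronglyMeasurable_of_weightedL2 f)) (Eventually.of_forall fun y => ?_)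
    rw [norm_mul]
    calc _ ≤ C * ((1 + |x|) * (1 + |y|)) * ‖f y‖ := by gcongr; exact hκ x y
      _ = _ := by ring
  filter_upwards [hac.ae_le (Lp.coeFn_sub (L i.1 f) (L i.2 f)), hLi.1 f, hLi.2 f] with x h1 h2 h3
  rw [sub_apply, h1, Pi.sub_apply, h2, h3,
    ← integral_sub (hint _ hkm.1 hCi.1 x) (hint _ hkm.2 hCi.2 x)]
  simp only [sub_mul]

end WeightedKernel

/-! ### Rank one perturbations -/

namespace EmbeddedTriple

variable {E X F : Type*}
  [NormedAddCommGroup E] [NormedSpace ℂ E]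
  [NormedAddCommGroup X] [NormedSpace ℂ X]
  [NormedAddCommGroup F] [NormedSpace ℂ F]
  {T : EmbeddedTriple E X F} {A : X →ₗ.[ℂ] X}

/-- The resolvent of a rank one perturbation. -/
theorem resolvent_rankOne {z : ℂ} {R : X →L[ℂ] X} (hR : IsResolventAt A z R) {φ : E}
    {ℓ : F →L[ℂ] ℂ} (hm : 1 + ℓ (T.emb₂ (R (T.emb₁ φ))) ≠ 0) :
    z ∈ resolventSet (T.perturb A (T.boundedOnDomain A (ℓ.smulRight φ))) ∧
      ∀ e, T.resolventEF (T.perturb A (T.boundedOnDomain A (ℓ.smulRight φ))) z e =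
        T.emb₂ (R (T.emb₁ e)) - (ℓ (T.emb₂ (R (T.emb₁ e))) /
          (1 + ℓ (T.emb₂ (R (T.emb₁ φ))))) • T.emb₂ (R (T.emb₁ φ)) := by
  set m := 1 + ℓ (T.emb₂ (R (T.emb₁ φ))) with hm_def
  let Λ : E →L[ℂ] ℂ := ℓ ∘L T.emb₂ ∘L R ∘L T.emb₁
  have hΛ : ∀ e, Λ e = ℓ (T.emb₂ (R (T.emb₁ e))) := fun e => rfl
  rw [← hΛ] at hm_def
  let N : X →L[ℂ] E := (ℓ ∘L T.emb₂ ∘L R).smulRight φ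
  have hN : ∀ x, N x = ℓ (T.emb₂ (R x)) • φ := fun x => rfl
  -- The Sherman-Morrison inverse of 1 + Λ(·) φ, with m = 1 + Λ φ.
  let J : E →L[ℂ] E := 1 - (m⁻¹ • Λ).smulRight φ
  have hJ : ∀ e, J e = e - (m⁻¹ * Λ e) • φ := fun e => rfl
  have hJφ : J φ = m⁻¹ • φ := by
    rw [hJ, ← one_smul ℂ φ, smul_smul, ← sub_smul, one_smul, mul_one]
    congr 1
    field_simp
    rw [hm_def]
    ring
  have hR0 : IsResolventAt (T.perturb A 0) z R := by
    rw [isResolventAt_perturb_iff]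
    simpa [IsResolventAt] using hR
  have key := isResolventAt_perturb (w₂ := T.boundedOnDomain A (ℓ.smulRight φ)) hR0 (N := N)
    (fun x hx => by
      rw [boundedOnDomain_apply, LinearMap.zero_apply, sub_zero]
      rfl) (J := J) (fun e => by
      rw [hN, ← hΛ, map_add, map_smul, hJφ, hJ, smul_smul]
      rw [mul_comm, sub_add_cancel]) (fun e => by
      rw [hN, ← hΛ, hJ, map_sub, map_smul, sub_add, ← sub_smul]
      have : m⁻¹ * Λ e - (Λ e - (m⁻¹ * Λ e) • Λ φ) = 0 := by
        rw [smul_eq_mul]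
        field_simp
        rw [hm_def]
        ring
      rw [this, zero_smul, sub_zero])
  refine ⟨⟨_, key⟩, fun e => ?_⟩
  rw [resolventEF, key.resolventOp_eq]
  change T.emb₂ (R (T.emb₁ e - T.emb₁ (J (N (T.emb₁ e))))) = _
  rw [hN, map_smul, hJφ, map_smul, map_smul, map_sub, map_smul, map_smul, map_sub, map_smul,
    map_smul, smul_smul, div_eq_mul_inv]

end EmbeddedTriple

/-! ### The perturbation by the indicator of the unit interval -/

section RankOne

theorem isLocallyFiniteMeasure_weightedMeasure (s : ℝ) :
    IsLocallyFiniteMeasure (weightedMeasure s) := by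
  refine IsLocallyFiniteMeasure.withDensity_ofReal ?_
  exact Continuous.rpow_const (by fun_prop) fun x => Or.inl (by positivity)

/-- The class of the indicator function of the unit interval. -/
theorem exists_weightedL2_indicator (s : ℝ) :
    ∃ φ : WeightedL2 s, φ =ᵐ[volume] (Set.Ioc (0 : ℝ) 1).indicator fun _ => 1 := by
  have := isLocallyFiniteMeasure_weightedMeasure s
  have h := memLp_indicator_const (μ := weightedMeasure s) 2 (s := Set.Ioc (0 : ℝ) 1)
    measurableSet_Ioc (1 : ℂ) (Or.inr measure_Ioc_lt_top.ne)
  exact ⟨h.toLp _, (volume_absolutelyContinuous_weightedMeasure s).ae_le h.coeFn_toLp⟩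

/-- The mean over the unit interval is a continuous functional on the weighted spaces. -/
theorem exists_avg_functional (s : ℝ) :
    ∃ ℓ : WeightedL2 (-s) →L[ℂ] ℂ, ∀ u, ℓ u = avg u := by
  have := isLocallyFiniteMeasure_weightedMeasure (-s)
  -- The factor (1 + x²)^s undoes the density of the measure, so pairing with `h` is the unweighted
  -- mean.
  set h : ℝ → ℂ := (Set.Ioc (0 : ℝ) 1).indicator fun x => (((1 + x ^ 2) ^ s : ℝ) : ℂ) with hh
  have hc : Continuous fun x : ℝ => (1 + x ^ 2) ^ s :=
    Continuous.rpow_const (by fun_prop) fun x => Or.inl (by positivity)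
  obtain ⟨c, hcb⟩ := isCompact_Icc.exists_bound_of_continuousOn (s := Set.Icc (0 : ℝ) 1)
    hc.continuousOn
  have hm : MemLp h 2 (weightedMeasure (-s)) := by
    refine (memLp_indicator_const (μ := weightedMeasure (-s)) 2 (s := Set.Ioc (0 : ℝ) 1)
      measurableSet_Ioc c (Or.inr measure_Ioc_lt_top.ne)).mono'
      ((Complex.continuous_ofReal.comp hc).aestronglyMeasurable.indicator measurableSet_Ioc)
      (Eventually.of_forall fun x => ?_)
    by_cases hx : x ∈ Set.Ioc (0 : ℝ) 1
    · rw [hh, Set.indicator_of_mem hx, Set.indicator_of_mem hx, Complex.norm_real]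
      exact hcb x (Set.Ioc_subset_Icc_self hx)
    · rw [hh, Set.indicator_of_notMem hx, Set.indicator_of_notMem hx, norm_zero]
  refine ⟨innerSL ℂ (hm.toLp _), fun u => ?_⟩
  rw [innerSL_apply_apply, L2.inner_def, avg, intervalIntegral.integral_of_le zero_le_one,
    ← integral_indicator measurableSet_Ioc]
  rw [integral_weightedMeasure]
  refine integral_congr_ae ?_
  filter_upwards [(volume_absolutelyContinuous_weightedMeasure (-s)).ae_le hm.coeFn_toLp]
    with x hx
  rw [hx]
  by_cases hx : x ∈ Set.Ioc (0 : ℝ) 1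
  · have hw : (((1 + x ^ 2) ^ (-s) : ℝ) : ℂ) * (((1 + x ^ 2) ^ s : ℝ) : ℂ) = 1 := by
      rw [← Complex.ofReal_mul, ← Real.rpow_add (by positivity)]
      simp
    rw [hh, Set.indicator_of_mem hx, Set.indicator_of_mem hx, RCLike.inner_apply,
      Complex.conj_ofReal]
    linear_combination u x * hw
  · rw [hh, Set.indicator_of_notMem hx, Set.indicator_of_notMem hx]
    simp

theorem finiteDimensional_range_smulRight {E F : Type*} [NormedAddCommGroup E] [NormedSpace ℂ E]
    [NormedAddCommGroup F] [NormedSpace ℂ F] (ℓ : F →L[ℂ] ℂ) (φ : E) :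
    FiniteDimensional ℂ (LinearMap.range (ℓ.smulRight φ : F →ₗ[ℂ] E)) := by
  refine Submodule.finiteDimensional_of_le (S₂ := ℂ ∙ φ) ?_
  rintro _ ⟨u, rfl⟩
  exact Submodule.smul_mem _ _ (Submodule.mem_span_singleton_self φ)

variable {s s' : ℝ} {ω ζ : ℂ}

theorem emb₁_ae_eq {hs : 0 ≤ s} {hs' : 0 ≤ s'} (f : WeightedL2 s) :
    (weightedTriple s s' hs hs').emb₁ f =ᵐ[volume] f :=
  lpInclusion_coeFn (volume_le_weightedMeasure hs) f

theorem emb₂_ae_eq {hs : 0 ≤ s} {hs' : 0 ≤ s'} (u : Lp ℂ 2 (volume : Measure ℝ)) :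
    (weightedTriple s s' hs hs').emb₂ u =ᵐ[volume] u :=
  (volume_absolutelyContinuous_weightedMeasure (-s')).ae_le
    (lpInclusion_coeFn (weightedMeasure_le_volume (neg_nonpos.mpr hs')) u)

theorem avg_congr_ae {f g : ℝ → ℂ} (h : f =ᵐ[volume] g) : avg f = avg g :=
  intervalIntegral.integral_congr_ae (h.mono fun _ hx _ => hx)

theorem IsSectorRoot.avg_convolution (h : IsSectorRoot ω ζ) {f : ℝ → ℂ} (hf : Integrable f) :
    avg (fun x => ∫ y, greenKernel ω ζ (x - y) * f y) = ∫ y, greenMeanLeft ω ζ y * f y := by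
  have hi : Integrable (fun p : ℝ × ℝ => greenKernel ω ζ (p.1 - p.2) * (1 * f p.2))
      ((volume.restrict (Set.Ioc 0 1)).prod volume) :=
    (Integrable.mul_prod (integrable_const (1 : ℂ)) hf).bdd_mul
      (h.continuous_greenKernel.comp (continuous_fst.sub continuous_snd)).aestronglyMeasurable
      (Eventually.of_forall fun _ => h.norm_greenKernel_le _)
  simp only [one_mul] at hi
  simp only [greenMeanLeft, avg, intervalIntegral.integral_of_le zero_le_one]
  rw [integral_integral_swap hi]
  simp only [integral_mul_const]

theorem integral_greenKernel_indicator (x : ℝ) :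
    ∫ y, greenKernel ω ζ (x - y) * (Set.Ioc (0 : ℝ) 1).indicator (fun _ => 1) y =
      greenMeanRight ω ζ x := by
  rw [greenMeanRight, avg, intervalIntegral.integral_of_le zero_le_one,
    ← integral_indicator measurableSet_Ioc]
  congr 1
  ext y
  by_cases hy : y ∈ Set.Ioc (0 : ℝ) 1
  · rw [Set.indicator_of_mem hy, Set.indicator_of_mem hy, mul_one]
  · rw [Set.indicator_of_notMem hy, Set.indicator_of_notMem hy, mul_zero]

/-- The resolvent of the rank one perturbation is given by `perturbedKernel`. -/
theorem IsSectorRoot.resolvent_perturbed (h : IsSectorRoot ω ζ) (hs : 3 / 2 < s)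
    (hs' : 3 / 2 < s') {T : EmbeddedTriple (WeightedL2 s) (Lp ℂ 2 (volume : Measure ℝ))
      (WeightedL2 (-s'))} (hT : T = weightedTriple s s' (by linarith) (by linarith))
    (him : (ζ ^ 3).im ≠ 0) {φ : WeightedL2 s}
    (hφ : φ =ᵐ[volume] (Set.Ioc (0 : ℝ) 1).indicator fun _ => 1)
    {ℓ : WeightedL2 (-s') →L[ℂ] ℂ} (hℓ : ∀ u, ℓ u = avg u) (hm : 1 + greenMean ω ζ ≠ 0) :
    ζ ^ 3 ∈ resolventSet (T.perturb (momentumPow 3)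
        (T.boundedOnDomain (momentumPow 3) (ℓ.smulRight φ))) ∧
      ∀ f, T.resolventEF (T.perturb (momentumPow 3)
        (T.boundedOnDomain (momentumPow 3) (ℓ.smulRight φ))) (ζ ^ 3) f =ᵐ[volume]
        fun x => ∫ y, perturbedKernel ω ζ x y * f y := by
  obtain ⟨R, hR, hRv⟩ := exists_resolvent_momentumPow him
  have hRF : ∀ f, T.emb₂ (R (T.emb₁ f)) =ᵐ[volume]
      fun x => ∫ y, greenKernel ω ζ (x - y) * f y := by
    intro f
    have h1 : T.emb₁ f =ᵐ[volume] f := by rw [hT]; exact emb₁_ae_eq f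
    have h2 : T.emb₂ (R (T.emb₁ f)) =ᵐ[volume] R (T.emb₁ f) := by rw [hT]; exact emb₂_ae_eq _
    refine h2.trans ((h.resolvent_ae_eq hRv _
      ((integrable_of_weightedL2 hs f).congr h1.symm)).trans (Eventually.of_forall fun x => ?_))
    refine integral_congr_ae (h1.mono fun y hy => ?_)
    simp only [hy]
  have hℓR : ∀ f, ℓ (T.emb₂ (R (T.emb₁ f))) = ∫ y, greenMeanLeft ω ζ y * f y := fun f => by
    rw [hℓ, avg_congr_ae (hRF f), h.avg_convolution (integrable_of_weightedL2 hs f)]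
  have hRφ : T.emb₂ (R (T.emb₁ φ)) =ᵐ[volume] greenMeanRight ω ζ := by
    refine (hRF φ).trans (Eventually.of_forall fun x => ?_)
    rw [← integral_greenKernel_indicator]
    refine integral_congr_ae (hφ.mono fun y hy => ?_)
    simp only [hy]
  have hℓφ : ℓ (T.emb₂ (R (T.emb₁ φ))) = greenMean ω ζ := by
    rw [hℓ, avg_congr_ae hRφ, greenMean]
  obtain ⟨h1, h2⟩ := T.resolvent_rankOne hR (φ := φ) (ℓ := ℓ) (by rwa [hℓφ])
  refine ⟨h1, fun f => ?_⟩
  have hf := integrable_of_weightedL2 hs f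
  have hac := volume_absolutelyContinuous_weightedMeasure (-s')
  have hi1 : ∀ x, Integrable fun y => greenKernel ω ζ (x - y) * f y := fun x =>
    hf.bdd_mul (h.continuous_greenKernel.comp (_root_.continuous_sub_left x)).aestronglyMeasurable
      (Eventually.of_forall fun _ => h.norm_greenKernel_le _)
  have hi2 : Integrable fun y => greenMeanLeft ω ζ y * f y :=
    hf.bdd_mul h.continuous_greenMeanLeft.aestronglyMeasurable
      (Eventually.of_forall fun _ => norm_avg_le fun _ _ _ => h.norm_greenKernel_le _)
  rw [h2, hℓR, hℓφ]
  filter_upwards [hac.ae_le (Lp.coeFn_sub (T.emb₂ (R (T.emb₁ f)))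
    (((∫ y, greenMeanLeft ω ζ y * f y) / (1 + greenMean ω ζ)) • T.emb₂ (R (T.emb₁ φ)))),
    hac.ae_le (Lp.coeFn_smul ((∫ y, greenMeanLeft ω ζ y * f y) / (1 + greenMean ω ζ))
      (T.emb₂ (R (T.emb₁ φ)))), hRF f, hRφ] with x e1 e2 e3 e4
  rw [e1, Pi.sub_apply, e2, Pi.smul_apply, e3, e4]
  have : ∀ y, perturbedKernel ω ζ x y * f y = greenKernel ω ζ (x - y) * f y -
      greenMeanRight ω ζ x / (1 + greenMean ω ζ) * (greenMeanLeft ω ζ y * f y) := fun y => by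
    rw [perturbedKernel]
    ring
  simp only [this]
  rw [integral_sub (hi1 x) (hi2.const_mul _), integral_const_mul, smul_eq_mul]
  ring

end RankOne

end VirtualLevels

end

/-! ### The case N = 3 -/

theorem theorem1 (s s' : ℝ) (hs : (3 : ℝ) - 3 / 2 < s) (hs' : (3 : ℝ) - 3 / 2 < s')
    (T : EmbeddedTriple (WeightedL2 s) (Lp ℂ 2 (volume : Measure ℝ)) (WeightedL2 (-s')))
    (hT : T = weightedTriple s s' (by linarith) (by linarith))
    (A : Lp ℂ 2 (volume : Measure ℝ) →ₗ.[ℂ] Lp ℂ 2 (volume : Measure ℝ))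
    (hA : A = momentumPow 3)
    (Ω : Set ℂ) (hΩ : Ω = {z : ℂ | 0 < z.im})
    (B : WeightedL2 (-s') →ₗ.[ℂ] WeightedL2 s)
    (hB : IsRelativelyCompact (T.extension A) B) :
    (T.SatisfiesLAP (A + T.perturbX B) Ω 0 ∧
        T.ResolventConvergesUniformly (A + T.perturbX B) Ω 0 ∧
        ¬ ∃ Ψ : WeightedL2 (-s'), T.IsVirtualState A B Ω 0 Ψ) ∨
      (¬ T.SatisfiesLAP (A + T.perturbX B) Ω 0 ∧
        ∃ Ψ : WeightedL2 (-s'), T.IsVirtualState A B Ω 0 Ψ) := by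
  have hs1 : 3 / 2 < s := by linarith
  have hs1' : 3 / 2 < s' := by linarith
  have hcl : (T.extension A).IsClosed := by
    rw [hT, hA]
    exact (momentumPow_extension_isClosed 3 s s' _ _).1
  have hne : (𝓝[Ω] (0 : ℂ)).NeBot := hΩ ▸ neBot_nhdsWithin_upperHalfPlane
  have hcg : (𝓝[Ω] (0 : ℂ)).IsCountablyGenerated := inferInstance
  obtain ⟨φ, hφ⟩ := exists_weightedL2_indicator s
  obtain ⟨ℓ, hℓ⟩ := exists_avg_functional s'
  have hfd := finiteDimensional_range_smulRight ℓ φ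
  set ζ : ℂ → ℂ := fun z => z ^ ((3 : ℕ) : ℂ)⁻¹ with hζ_def
  have hΩ_mem : ∀ᶠ z in 𝓝[Ω] (0 : ℂ), 0 < z.im := by
    rw [hΩ]
    exact eventually_mem_nhdsWithin
  have hζ : ∀ᶠ z in 𝓝[Ω] (0 : ℂ), IsSectorRoot omega (ζ z) :=
    hΩ_mem.mono fun z hz => isSectorRoot_cpow hz
  have hζ3 : ∀ z, ζ z ^ 3 = z := fun z => Complex.cpow_nat_inv_pow z three_ne_zero
  have hζ0 : Tendsto ζ (𝓝[Ω] 0) (𝓝 0) := tendsto_cpow_inv_three.mono_left nhdsWithin_le_nhds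
  -- Any point of the upper half-plane would do; only |ω| = 1 is extracted.
  have hω := (isSectorRoot_cpow (z := Complex.I) (by simp)).norm_eq_one
  have hω0 : omega ≠ 0 := norm_ne_zero_iff.mp (by rw [hω]; exact one_ne_zero)
  have hm := tendsto_sq_mul_greenMean hζ hζ0
  -- The limit has modulus 1/3, so any smaller positive bound holds eventually; 1/6 is the one
  -- behind the constant 26.
  have hm6 : ∀ᶠ z in 𝓝[Ω] (0 : ℂ), 1 / 6 ≤ ‖ζ z ^ 2 * (1 + greenMean omega (ζ z))‖ := by
    have h3 : ‖-Complex.I * omega ^ 2 / 3‖ = 1 / 3 := by simp [hω]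
    refine (hm.norm.eventually_const_lt (u := 1 / 6) ?_).mono fun _ h => h.le
    rw [h3]
    norm_num
  have hζ1 : ∀ᶠ z in 𝓝[Ω] (0 : ℂ), ‖ζ z‖ ≤ 1 :=
    (hζ0.norm.eventually_lt_const (u := 1) (by simp)).mono fun _ h => h.le
  have hres : ∀ᶠ z in 𝓝[Ω] (0 : ℂ),
      z ∈ resolventSet (T.perturb A (T.boundedOnDomain A (ℓ.smulRight φ))) ∧
      ∀ f, T.resolventEF (T.perturb A (T.boundedOnDomain A (ℓ.smulRight φ))) z f =ᵐ[volume]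
        fun x => ∫ y, perturbedKernel omega (ζ z) x y * f y := by
    filter_upwards [hΩ_mem, hζ, hm6] with z hz h h6
    have hm0 : 1 + greenMean omega (ζ z) ≠ 0 := by
      intro h0
      rw [h0, mul_zero, norm_zero] at h6
      norm_num at h6
    have := h.resolvent_perturbed hs1 hs1' hT (by rw [hζ3]; exact hz.ne') hφ hℓ hm0
    rwa [hζ3, ← hA] at this
  obtain ⟨L₁, hL₁⟩ := exists_tendsto_of_tendsto_kernel hs1 hs1' (l := 𝓝[Ω] (0 : ℂ))
    (k := fun z => perturbedKernel omega (ζ z)) (C := 26)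
    (hζ.mono fun z h => h.continuous_perturbedKernel.measurable)
    (hres.mono fun z h => h.2)
    (by filter_upwards [hζ, hζ1, hm6] with z h h1 h6 using h.norm_perturbedKernel_le h1 h6)
    (exists_tendsto_perturbedKernel hζ hζ0 hω0)
  exact T.virtualState_dichotomy hcl (hres.mono fun z h => h.1) hL₁ hB
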